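/- **Setting.** Let $K$ be a field of characteristic $0$, $N\ge 1$, and let $q\in K$ be nonzero and not a root of unity. Put $k:=q-q^{-1}$ and $[y]_q:=\frac{q^y-q^{-y}}{q-q^{-1}}$. Write $e_i^j$ for the $N\times N$ matrix unit with $1$ in column $i$ and row $j$, and write $A^{ij}_{hk}$ for the entry of an $N^2\times N^2$ matrix $A$ in row $(i,j)$ and column $(h,k)$. For such an $A$, $A_{m(m+1)}$ is the $N^l\times N^l$ matrix acting as $A$ on the $m$-th and $(m+1)$-th tensor factors of $(K^N)^{\otimes l}$ and as the identity on the others. *Case $H=U_qgl(N)$.* The indices are $1,\dots,N$ and $$\hat R=q\sum_i e_i^i\otimes e_i^i+\sum_{i\neq j}e_i^j\otimes e_j^i+k\sum_{i<j}e_i^i\otimes e_j^j,\qquad \mathcal P^\pm=\frac{q^{\mp1}\mathbf 1_{N^2}\pm\hat R}{q+q^{-1}}.$$ Put $d^{-,l}=\binom Nl$ and $d^{+,l}=\binom{N-1+l}{N-1}$. *Case $H=U_qso(N)$.* Here fix moreover a square root $q^{1/2}\in K$ of $q$. The indices are $-n,\dots,-1,0,1,\dots,n$ if $N=2n+1$,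 and $-n,\dots,-1,1,\dots,n$ if $N=2n$. In this order of the indices, $(2\rho_i)=(N-2,N-4,\dots,1,0,-1,\dots,2-N)$ for $N$ odd and $(2\rho_i)=(N-2,N-4,\dots,0,0,\dots,2-N)$ for $N$ even. Put $g_{ij}=g^{ij}=q^{\rho_j}\delta_{-i,j}$, $Q_N=\sum_{l,m}g^{lm}g_{lm}$, $\mathcal P^{t\,ij}_{\ \ hk}=\frac1{Q_N}g^{ij}g_{hk}$, $$\hat R=q\sum_{i\ne0}e_i^i\otimes e_i^i+\sum_{\substack{i\neq j,-j\\ \text{or }i=-j=0}}e_i^j\otimes e_j^i+q^{-1}\sum_{i\neq0}e_i^{-i}\otimes e_{-i}^i+k\Big(\sum_{i<j}e_i^i\otimes e_j^j-\sum_{i<j}q^{-\rho_i+\rho_j}e_i^{-j}\otimes e_{-i}^j\Big),$$ $$\mathcal P^\pm=\frac{q^{\mp1}\mathbf 1_{N^2}\pm\hat R-(q^{\mp1}\pm q^{1-N})\mathcal P^t}{q+q^{-1}}.$$ Put $d^{-,l}=\binom Nl$, and let $d^{+,l}=\binom{N-1+l}{N-1}-\binom{N-3+l}{N-1}$ for $l\ge2$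 and $d^{+,1}=N$. **Definition.** In either case and for $l\ge1$, the completely symmetric/antisymmetric projector $\mathcal P^{\pm,l}$ is the $N^l\times N^l$ matrix characterized by $$\mathcal P^{\pm,l}\mathcal P^\pi_{m(m+1)}=\delta^\pm_\pi\,\mathcal P^{\pm,l}=\mathcal P^\pi_{m(m+1)}\mathcal P^{\pm,l},\qquad(\mathcal P^{\pm,l})^2=\mathcal P^{\pm,l},\qquad \operatorname{tr}\mathcal P^{\pm,l}=d^{\pm,l},$$ for all $m=1,\dots,l-1$ and all $\pi\in\{-,+\}$ (for $U_qgl(N)$), respectively $\pi\in\{-,+,t\}$ (for $U_qso(N)$). **Proposition 1.** In both cases and for both signs, for every $l\ge1$ there is exactly one matrix $\mathcal P^{\pm,l}$ with these properties; $\mathcal P^{\pm,1}=\mathbf 1_N$; and for every $l\ge 1$ both recursive relations $$\mathcal P^{\pm,l+1}=\mathcal P^{\pm,l}_{1\dots l}\,M^{\pm,l+1}_{l(l+1)}\,\mathcal P^{\pm,l}_{1\dots l},\qquad \mathcal P^{\pm,l+1}=\mathcal P^{\pm,l}_{2\dots(l+1)}\,M^{\pm,l+1}_{12}\,\mathcal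 P^{\pm,l}_{2\dots(l+1)}$$ hold, where $\mathcal P^{\pm,l}_{1\dots l}=\mathcal P^{\pm,l}\otimes\mathbf 1_N$, $\mathcal P^{\pm,l}_{2\dots(l+1)}=\mathbf 1_N\otimes\mathcal P^{\pm,l}$ and $$M^{\pm,l+1}=\frac1{[l+1]_q}\Big[q^{\mp l}\mathbf 1_{N^2}\pm[l]_q\hat R\Big]\quad\text{if }H=U_qgl(N),$$ $$M^{\pm,l+1}=\frac1{[l+1]_q}\Big[q^{\mp l}\mathbf 1_{N^2}\pm[l]_q\hat R+\frac{Q_N(q^{\pm2}-1)[l]_q}{q^{\pm1}\mp q^{N-1\pm2l}}\mathcal P^t\Big]\quad\text{if }H=U_qso(N).$$ Moreover, for every $l\ge1$, $\mathcal P^{\pm,l}$ is a polynomial in $\hat R_{12},\dots,\hat R_{(l-1)l}$ and is symmetric, $(\mathcal P^{\pm,l})^T=\mathcal P^{\pm,l}$; and if $H=U_qso(N)$ then, for all indices $i_1,\dots,i_l,k_1,\dots,k_l$ and with summation over the $j$'s, $$\mathcal P^{\pm,l\,i_1\dots i_l}_{\ \ \ \ j_1\dots j_l}\,g^{j_1k_1}\cdots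 g^{j_lk_l}=g^{i_1j_1}\cdots g^{i_lj_l}\,\mathcal P^{\pm,l\,j_l\dots j_1}_{\ \ \ \ k_l\dots k_1},$$ and the same holds with the matrix $g^{ij}$ replaced by its transpose $g^{ji}$. -/

import Mathlib

open scoped Kronecker

namespace QProj

/-- The two signs `±`: `plus` labels symmetric, `minus` antisymmetric objects. -/
inductive PM where
  | plus
  | minus
  deriving DecidableEq

/-- The sign as the integer `+1` or `-1`. -/
def PM.sgn : PM → ℤ
  | .plus => 1
  | .minus => -1

/-- `N² × N²` matrices; the entry `A (i, j) (h, k)` is `A^{ij}_{hk}`. -/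
abbrev Mat2 (K : Type*) (N : ℕ) := Matrix (Fin N × Fin N) (Fin N × Fin N) K

/-- `N^l × N^l` matrices; the entry `P i j` is `P^{i_1 … i_l}_{j_1 … j_l}`. -/
abbrev TMat (K : Type*) (N l : ℕ) := Matrix (Fin l → Fin N) (Fin l → Fin N) K

section
variable {K : Type*} [Field K] {N : ℕ}

/-- `A_{m(m+1)}`: the matrix on `l`-tensors acting as `A` on two adjacent tensor factors and as the
identity on the others. The factors are numbered from `0` here. -/
def atSite {l : ℕ} (A : Mat2 K N) (m : ℕ) (h : m + 1 < l) : TMat K N l :=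
  Matrix.of fun i j =>
    if ∀ r : Fin l, (r : ℕ) ≠ m → (r : ℕ) ≠ m + 1 → i r = j r then
      A (i ⟨m, Nat.lt_of_succ_lt h⟩, i ⟨m + 1, h⟩) (j ⟨m, Nat.lt_of_succ_lt h⟩, j ⟨m + 1, h⟩)
    else 0

/-- `P_{1…l} = P ⊗ 1_N`. -/
def tensorOne {l : ℕ} (P : TMat K N l) : TMat K N (l + 1) :=
  Matrix.of fun i j =>
    if i (Fin.last l) = j (Fin.last l) then P (Fin.init i) (Fin.init j) else 0

/-- `P_{2…(l+1)} = 1_N ⊗ P`. -/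
def oneTensor {l : ℕ} (P : TMat K N l) : TMat K N (l + 1) :=
  Matrix.of fun i j => if i 0 = j 0 then P (Fin.tail i) (Fin.tail j) else 0

/-- The `q`-number `[y]_q = (q^y - q^{-y}) / (q - q^{-1})`. -/
def qnum (q : K) (y : ℤ) : K := (q ^ y - q ^ (-y)) / (q - q⁻¹)

/-- `e_i^j`, the matrix unit with a `1` in column `i` and row `j`. -/
def e (i j : Fin N) : Matrix (Fin N) (Fin N) K := Matrix.single j i 1

/-- The defining properties of a completely (anti)symmetric projector on `l`-tensors, relative to
the family `p` of projectors of 2-tensors, the member `p ε` of this family and the dimension `d`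
of the target. -/
structure IsCompleteProjector {ι : Type*} [DecidableEq ι] (p : ι → Mat2 K N) (ε : ι) (d : ℕ)
    (l : ℕ) (P : TMat K N l) : Prop where
  mul_right : ∀ (π : ι) (m : ℕ) (h : m + 1 < l),
    P * atSite (p π) m h = if π = ε then P else 0
  mul_left : ∀ (π : ι) (m : ℕ) (h : m + 1 < l),
    atSite (p π) m h * P = if π = ε then P else 0
  idem : P ^ 2 = P
  trace : P.trace = (d : K)

/-- The unital algebra of polynomials in the (noncommuting) matrices
`R_{12}, R_{23}, …, R_{(l-1)l}`. -/
def braidPolynomials (R : Mat2 K N) (l : ℕ) : Subalgebra K (TMat K N l) :=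
  Algebra.adjoin K {A | ∃ (m : ℕ) (h : m + 1 < l), A = atSite R m h}

/-! ### The series `U_q gl(N)`; the indices `1, …, N` are the elements of `Fin N`. -/

/-- The braid matrix of `U_q gl(N)`. -/
def glR (q : K) : Mat2 K N :=
  q • (∑ i : Fin N, e i i ⊗ₖ e i i)
    + (∑ i : Fin N, ∑ j : Fin N with i ≠ j, e i j ⊗ₖ e j i)
    + (q - q⁻¹) • (∑ i : Fin N, ∑ j : Fin N with i < j, e i i ⊗ₖ e j j)

/-- The projectors `P^±` of 2-tensors for `U_q gl(N)`. -/
def glP (q : K) (ε : PM) : Mat2 K N :=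
  (q + q⁻¹)⁻¹ • (q ^ (-ε.sgn) • (1 : Mat2 K N) + (ε.sgn : K) • glR q)

/-- The dimension of the `l`-fold completely (anti)symmetric representation of `U_q gl(N)`. -/
def glDim (N : ℕ) : PM → ℕ → ℕ
  | .plus, l => (N - 1 + l).choose (N - 1)
  | .minus, l => N.choose l

/-- `P` is the projector `P^{±,l}` of `U_q gl(N)`. -/
def IsGlProjector (q : K) (ε : PM) (l : ℕ) (P : TMat K N l) : Prop :=
  IsCompleteProjector (glP q) ε (glDim N ε l) l P

/-- The matrix `M^{±,l+1}` for `U_q gl(N)`. -/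
def glM (q : K) (ε : PM) (l : ℕ) : Mat2 K N :=
  (qnum q (l + 1))⁻¹ •
    (q ^ (-(ε.sgn * l)) • (1 : Mat2 K N) + ((ε.sgn : K) * qnum q l) • glR q)

/-! ### The series `U_q so(N)`

The parameter is `s = q^{1/2}`. The indices `-n, …, n` (with `0` omitted if `N = 2n`) are, in this
order, the elements of `Fin N`, so that `-i` is `i.rev`, and `i = 0` means `i.rev = i`. -/

/-- The integers `2ρ_i`: `(N-2, N-4, …, 1, 0, -1, …, 2-N)` for odd `N`,
`(N-2, N-4, …, 0, 0, …, 2-N)` for even `N`. -/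
def twoRho (i : Fin N) : ℤ :=
  if i < i.rev then (N : ℤ) - 2 - 2 * (i : ℕ)
  else if i = i.rev then 0
  else (N : ℤ) - 2 * (i : ℕ)

/-- The metric `g_{ij} = g^{ij} = q^{ρ_j} δ_{-i,j}`. -/
def soG (s : K) : Matrix (Fin N) (Fin N) K :=
  Matrix.of fun i j => if i.rev = j then s ^ twoRho j else 0

/-- `Q_N = g^{lm} g_{lm}`. -/
def soQ (N : ℕ) (s : K) : K := ∑ l : Fin N, ∑ m : Fin N, soG s l m * soG s l m

/-- The trace projector `P^t`. -/
def soPt (s : K) : Mat2 K N :=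
  Matrix.of fun a b => (soQ N s)⁻¹ * (soG s a.1 a.2 * soG s b.1 b.2)

/-- The braid matrix of `U_q so(N)`, `q = s²`. -/
def soR (s : K) : Mat2 K N :=
  s ^ 2 • (∑ i : Fin N with i ≠ i.rev, e i i ⊗ₖ e i i)
    + (∑ i : Fin N, ∑ j : Fin N with (i ≠ j ∧ i ≠ j.rev) ∨ (i = j.rev ∧ i = i.rev),
        e i j ⊗ₖ e j i)
    + (s ^ 2)⁻¹ • (∑ i : Fin N with i ≠ i.rev, e i i.rev ⊗ₖ e i.rev i)
    + (s ^ 2 - (s ^ 2)⁻¹) •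
      ((∑ i : Fin N, ∑ j : Fin N with i < j, e i i ⊗ₖ e j j)
        - ∑ i : Fin N, ∑ j : Fin N with i < j,
            s ^ (-twoRho i + twoRho j) • (e i j.rev ⊗ₖ e i.rev j))

/-- The projectors of 2-tensors for `U_q so(N)`, `q = s²`: `some ε` labels `P^±` and `none`
labels `P^t`. -/
def soP (s : K) : Option PM → Mat2 K N
  | some ε => (s ^ 2 + (s ^ 2)⁻¹)⁻¹ •
      ((s ^ 2) ^ (-ε.sgn) • (1 : Mat2 K N) + (ε.sgn : K) • soR s
        - ((s ^ 2) ^ (-ε.sgn) + (ε.sgn : K) * (s ^ 2) ^ (1 - (N : ℤ))) • soPt s)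
  | none => soPt s

/-- The dimension of the `l`-fold completely (anti)symmetric (and, for `+`, trace-free)
representation of `U_q so(N)`. -/
def soDim (N : ℕ) : PM → ℕ → ℕ
  | .plus, l => (N - 1 + l).choose (N - 1) - if 2 ≤ l then (N + l - 3).choose (N - 1) else 0
  | .minus, l => N.choose l

/-- `P` is the projector `P^{±,l}` of `U_q so(N)`, `q = s²`. -/
def IsSoProjector (s : K) (ε : PM) (l : ℕ) (P : TMat K N l) : Prop :=
  IsCompleteProjector (soP s) (some ε) (soDim N ε l) l P

/-- The matrix `M^{±,l+1}` for `U_q so(N)`, `q = s²`. -/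
def soM (s : K) (ε : PM) (l : ℕ) : Mat2 K N :=
  (qnum (s ^ 2) (l + 1))⁻¹ •
    ((s ^ 2) ^ (-(ε.sgn * l)) • (1 : Mat2 K N) + ((ε.sgn : K) * qnum (s ^ 2) l) • soR s
      + (soQ N s * ((s ^ 2) ^ (2 * ε.sgn) - 1) * qnum (s ^ 2) l
          / ((s ^ 2) ^ ε.sgn - (ε.sgn : K) * (s ^ 2) ^ ((N : ℤ) - 1 + 2 * ε.sgn * l))) • soPt s)

/-- Compatibility of `P` with a metric `g`:
`P^{i_1…i_l}_{j_1…j_l} g^{j_1k_1} ⋯ g^{j_lk_l} = g^{i_1j_1} ⋯ g^{i_lj_l} P^{j_l…j_1}_{k_l…k_1}`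
(sums over the `j`'s). -/
def MetricCompatible (g : Matrix (Fin N) (Fin N) K) {l : ℕ} (P : TMat K N l) : Prop :=
  ∀ i k : Fin l → Fin N,
    ∑ j : Fin l → Fin N, P i j * ∏ r, g (j r) (k r)
      = ∑ j : Fin l → Fin N, (∏ r, g (i r) (j r)) * P (j ∘ Fin.rev) (k ∘ Fin.rev)

end

end QProj

namespace QProj

/-! ### Tensor factors -/

section Tensor
variable {K : Type*} [Field K] {N : ℕ}

/-! Put $k=q-q^{-1}$, $t=q^{1-N}$, and $E=0$ for $gl$, $E=Q_N\mathcal P^t$ for $so$. On neighbouring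
tensor factors $\hat R$ and $E$ satisfy relations of Birman–Murakami–Wenzl type (`BMWPair`): the
skein relation $\hat R^2=1+k\hat R-ktE$, the twist $\hat RE=tE$, and the braid, slide and zigzag
relations. These, together with the symmetry of both matrices, carry the whole theory of the
projectors.

Existence: the recursion is taken as the definition (`chainProj`, `tensorProj`). Let $c=\pm
q^{\pm1}$. If $\hat R_ix=cx$ and $E_ix=0$, then two consecutive factors applied to $x$ give an
eigenvector of $\hat R_{i+1}$ for $c$ (`BMWChain.eigen_step`); this is a computation with six
vectors and explains the coefficients of $M^{\pm,l+1}$. By induction the recursion maps into the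
common eigenspace (`BMWChain.chainProj_eigen`). Every factor is the identity there, so the result is
the idempotent onto that space. The recursion from the opposite end has the same property and both
results are symmetric, so they agree (`BMWPair.chainProj_rev`); this gives the second recursion and
the compatibility with the metric.

Uniqueness: a competitor $P$ of the same trace satisfies $TP=P=PT$ with the constructed $T$, so
$T-P$ is an idempotent of trace $0$ and vanishes in characteristic $0$ (`BMWPair.eq_tensorProj`).

Trace: for general $q$ the ordinary partial trace of $\hat R$ is not scalar. So $q$ (for $so$,
$q^{1/2}$) is replaced by a variable $X$. The trace of an idempotent over $K(X)$ is a natural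
number, hence unchanged by specialization. At $X=1$ the braid matrix is the flip and partial traces
give the recursion of the dimensions; specialization to the given parameter finishes
(`BMWPair.trace_tensorProj_of_spec`, `gl_trace`, `so_trace`).

There remain the relations. The hard one is the braid relation for $so$. It is checked directly on
$(a,b,c)$ without opposite indices and on $(z,y,-z)$ with $z\ne\pm y$. The other vectors are reached
through the defect $D=\hat R_{12}\hat R_{23}\hat R_{12}-\hat R_{23}\hat R_{12}\hat R_{23}$: it kills
the images of $E_{12}$ and $E_{23}$ and its kernel is stable under both braid generators, and the
last entries vanish because a vector $D(y,y,-y)$ has eigenvalue $-q^{-1}$ where a row of $\hat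
R_{23}$ demands $q$ (`braidDefect_eq_zero`). -/

theorem sum_tuple_snoc {l : ℕ} {M : Type*} [AddCommMonoid M] (f : (Fin (l + 1) → Fin N) → M) :
    ∑ i, f i = ∑ x : Fin N, ∑ i : Fin l → Fin N, f (Fin.snoc i x) := by
  rw [← (Fin.snocEquiv fun _ : Fin (l + 1) => Fin N).sum_comp, Fintype.sum_prod_type]
  rfl

theorem sum_tuple_cons {l : ℕ} {M : Type*} [AddCommMonoid M] (f : (Fin (l + 1) → Fin N) → M) :
    ∑ i, f i = ∑ x : Fin N, ∑ i : Fin l → Fin N, f (Fin.cons x i) := by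
  rw [← (Fin.consEquiv fun _ : Fin (l + 1) => Fin N).sum_comp, Fintype.sum_prod_type]
  rfl

theorem tensorOne_apply {l : ℕ} (P : TMat K N l) (i j : Fin (l + 1) → Fin N) :
    tensorOne P i j =
      if i (Fin.last l) = j (Fin.last l) then P (Fin.init i) (Fin.init j) else 0 := rfl

theorem oneTensor_apply {l : ℕ} (P : TMat K N l) (i j : Fin (l + 1) → Fin N) :
    oneTensor P i j = if i 0 = j 0 then P (Fin.tail i) (Fin.tail j) else 0 := rfl

theorem atSite_apply {l : ℕ} (A : Mat2 K N) (m : ℕ) (h : m + 1 < l) (i j : Fin l → Fin N) :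
    atSite A m h i j =
      if ∀ r : Fin l, (r : ℕ) ≠ m → (r : ℕ) ≠ m + 1 → i r = j r then
        A (i ⟨m, Nat.lt_of_succ_lt h⟩, i ⟨m + 1, h⟩) (j ⟨m, Nat.lt_of_succ_lt h⟩, j ⟨m + 1, h⟩)
      else 0 := rfl

theorem init_eq_iff {l : ℕ} (i j : Fin (l + 1) → Fin N) :
    i = j ↔ Fin.init i = Fin.init j ∧ i (Fin.last l) = j (Fin.last l) := by
  constructor
  · rintro rfl; exact ⟨rfl, rfl⟩
  · rintro ⟨h1, h2⟩
    rw [← Fin.snoc_init_self i, ← Fin.snoc_init_self j, h1, h2]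

theorem tail_eq_iff {l : ℕ} (i j : Fin (l + 1) → Fin N) :
    i = j ↔ Fin.tail i = Fin.tail j ∧ i 0 = j 0 := by
  constructor
  · rintro rfl; exact ⟨rfl, rfl⟩
  · rintro ⟨h1, h2⟩
    rw [← Fin.cons_self_tail i, ← Fin.cons_self_tail j, h1, h2]

/-- `P ↦ P ⊗ 1` as a homomorphism of algebras. -/
def tensorOneHom (K : Type*) [Field K] (N l : ℕ) : TMat K N l →ₐ[K] TMat K N (l + 1) where
  toFun := tensorOne
  map_one' := by
    ext i j
    simp only [tensorOne_apply, Matrix.one_apply, init_eq_iff i j]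
    split_ifs <;> simp_all
  map_mul' P Q := by
    ext i j
    rw [Matrix.mul_apply, sum_tuple_snoc]
    simp [tensorOne_apply, Matrix.mul_apply]
  map_zero' := by ext; simp [tensorOne_apply]
  map_add' P Q := by ext; simp only [tensorOne_apply, Matrix.add_apply]; split_ifs <;> simp
  commutes' r := by
    ext i j
    simp only [tensorOne_apply, Matrix.algebraMap_eq_diagonal, Matrix.diagonal_apply,
      init_eq_iff i j]
    split_ifs <;> simp_all

/-- `P ↦ 1 ⊗ P` as a homomorphism of algebras. -/
def oneTensorHom (K : Type*) [Field K] (N l : ℕ) : TMat K N l →ₐ[K] TMat K N (l + 1) where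
  toFun := oneTensor
  map_one' := by
    ext i j
    simp only [oneTensor_apply, Matrix.one_apply, tail_eq_iff i j]
    split_ifs <;> simp_all
  map_mul' P Q := by
    ext i j
    rw [Matrix.mul_apply, sum_tuple_cons]
    simp [oneTensor_apply, Matrix.mul_apply]
  map_zero' := by ext; simp [oneTensor_apply]
  map_add' P Q := by ext; simp only [oneTensor_apply, Matrix.add_apply]; split_ifs <;> simp
  commutes' r := by
    ext i j
    simp only [oneTensor_apply, Matrix.algebraMap_eq_diagonal, Matrix.diagonal_apply,
      tail_eq_iff i j]
    split_ifs <;> simp_all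

theorem tensorOneHom_apply {l : ℕ} (P : TMat K N l) : tensorOneHom K N l P = tensorOne P := rfl

theorem oneTensorHom_apply {l : ℕ} (P : TMat K N l) : oneTensorHom K N l P = oneTensor P := rfl

theorem tensorOne_atSite {l : ℕ} (A : Mat2 K N) (m : ℕ) (h : m + 1 < l) :
    tensorOneHom K N l (atSite A m h) = atSite A m (Nat.lt_succ_of_lt h) := by
  ext i j
  rw [tensorOneHom_apply, tensorOne_apply, atSite_apply, atSite_apply, ← ite_and]
  have : (i (Fin.last l) = j (Fin.last l) ∧ ∀ r : Fin l, (r : ℕ) ≠ m → (r : ℕ) ≠ m + 1 →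
      Fin.init i r = Fin.init j r) ↔
      ∀ r : Fin (l + 1), (r : ℕ) ≠ m → (r : ℕ) ≠ m + 1 → i r = j r := by
    rw [Fin.forall_fin_succ', and_comm]
    simp only [Fin.init, Fin.val_castSucc, Fin.val_last]
    constructor
    · rintro ⟨h1, h2⟩; exact ⟨h1, fun _ _ => h2⟩
    · rintro ⟨h1, h2⟩; exact ⟨h1, h2 (by omega) (by omega)⟩
  simp only [this]
  rfl

theorem oneTensor_atSite {l : ℕ} (A : Mat2 K N) (m : ℕ) (h : m + 1 < l) :
    oneTensorHom K N l (atSite A m h) = atSite A (m + 1) (Nat.succ_lt_succ h) := by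
  ext i j
  rw [oneTensorHom_apply, oneTensor_apply, atSite_apply, atSite_apply, ← ite_and]
  have : (i 0 = j 0 ∧ ∀ r : Fin l, (r : ℕ) ≠ m → (r : ℕ) ≠ m + 1 →
      Fin.tail i r = Fin.tail j r) ↔
      ∀ r : Fin (l + 1), (r : ℕ) ≠ m + 1 → (r : ℕ) ≠ m + 1 + 1 → i r = j r := by
    rw [Fin.forall_fin_succ]
    simp [Fin.tail]
  simp only [this]
  rfl

/-- Every site arises from the only site of 2-tensors by adding tensor factors on the right or on
the left, so an identity preserved by `tensorOneHom` and `oneTensorHom` need only be checked for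
2-tensors. -/
theorem site_induction {motive : ∀ l m : ℕ, m + 1 < l → Prop}
    (base : motive 2 0 (by omega))
    (right : ∀ l m h, motive l m h → motive (l + 1) m (Nat.lt_succ_of_lt h))
    (left : ∀ l m h, motive l m h → motive (l + 1) (m + 1) (Nat.succ_lt_succ h)) :
    ∀ l m h, motive l m h := by
  intro l
  induction l with
  | zero => intro m h; omega
  | succ l ih =>
    intro m h
    by_cases h1 : m + 1 < l
    · exact right l m h1 (ih m h1)
    · obtain rfl : l = m + 1 := by omega
      cases m with
      | zero => exact base
      | succ m => exact left _ m (by omega) (ih m (by omega))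

theorem site_pair_induction {motive : ∀ l m : ℕ, m + 2 < l → Prop}
    (base : motive 3 0 (by omega))
    (right : ∀ l m h, motive l m h → motive (l + 1) m (Nat.lt_succ_of_lt h))
    (left : ∀ l m h, motive l m h → motive (l + 1) (m + 1) (Nat.succ_lt_succ h)) :
    ∀ l m h, motive l m h := by
  intro l
  induction l with
  | zero => intro m h; omega
  | succ l ih =>
    intro m h
    by_cases h1 : m + 2 < l
    · exact right l m h1 (ih m h1)
    · obtain rfl : l = m + 2 := by omega
      cases m with
      | zero => exact base
      | succ m => exact left _ m (by omega) (ih m (by omega))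

theorem forall_fin_two_off (p : Fin 2 → Prop) :
    (∀ r : Fin 2, (r : ℕ) ≠ 0 → (r : ℕ) ≠ 0 + 1 → p r) ↔ True := by
  simp [Fin.forall_fin_two]

theorem atSite_two (A : Mat2 K N) (i j : Fin 2 → Fin N) :
    atSite A 0 (by omega : 0 + 1 < 2) i j = A (i 0, i 1) (j 0, j 1) := by
  rw [atSite_apply]
  simp only [forall_fin_two_off, if_true]
  rfl

theorem sum_tuple_two {M : Type*} [AddCommMonoid M] (f : (Fin 2 → Fin N) → M) :
    ∑ i, f i = ∑ a : Fin N, ∑ b : Fin N, f ![a, b] := by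
  rw [← (finTwoArrowEquiv (Fin N)).symm.sum_comp, Fintype.sum_prod_type]
  rfl

theorem atSite_one (l m : ℕ) (h : m + 1 < l) : atSite (1 : Mat2 K N) m h = 1 := by
  revert l m
  refine site_induction ?_ ?_ ?_
  · ext i j
    rw [atSite_two, Matrix.one_apply, Matrix.one_apply]
    congr 1
    simp [funext_iff, Fin.forall_fin_two]
  · intro l m h ih
    rw [← tensorOne_atSite _ _ h, ih, map_one]
  · intro l m h ih
    rw [← oneTensor_atSite _ _ h, ih, map_one]

theorem atSite_add {l : ℕ} (A B : Mat2 K N) (m : ℕ) (h : m + 1 < l) :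
    atSite (A + B) m h = atSite A m h + atSite B m h := by
  ext i j
  simp only [atSite_apply, Matrix.add_apply]
  split_ifs <;> simp

theorem atSite_smul {l : ℕ} (a : K) (A : Mat2 K N) (m : ℕ) (h : m + 1 < l) :
    atSite (a • A) m h = a • atSite A m h := by
  ext i j
  simp only [atSite_apply, Matrix.smul_apply]
  split_ifs <;> simp

theorem atSite_sub {l : ℕ} (A B : Mat2 K N) (m : ℕ) (h : m + 1 < l) :
    atSite (A - B) m h = atSite A m h - atSite B m h := by
  ext i j
  simp only [atSite_apply, Matrix.sub_apply]
  split_ifs <;> simp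

theorem atSite_zero {l : ℕ} (m : ℕ) (h : m + 1 < l) : atSite (0 : Mat2 K N) m h = 0 := by
  ext i j
  simp [atSite_apply]

theorem atSite_mul (A B : Mat2 K N) (l m : ℕ) (h : m + 1 < l) :
    atSite (A * B) m h = atSite A m h * atSite B m h := by
  revert l m
  refine site_induction ?_ ?_ ?_
  · ext i j
    rw [atSite_two, Matrix.mul_apply, Matrix.mul_apply, Fintype.sum_prod_type, sum_tuple_two]
    simp [atSite_two]
  · intro l m h ih
    rw [← tensorOne_atSite _ _ h, ih, map_mul, tensorOne_atSite, tensorOne_atSite]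
  · intro l m h ih
    rw [← oneTensor_atSite _ _ h, ih, map_mul, oneTensor_atSite, oneTensor_atSite]

theorem atSite_transpose {l : ℕ} (A : Mat2 K N) (m : ℕ) (h : m + 1 < l) :
    (atSite A m h).transpose = atSite A.transpose m h := by
  ext i j
  simp only [atSite_apply, Matrix.transpose_apply, eq_comm]

theorem atSite_commute {l : ℕ} (A B : Mat2 K N) (m m' : ℕ) (h : m + 1 < l) (h' : m' + 1 < l)
    (hm : m + 2 ≤ m') : Commute (atSite A m h) (atSite B m' h') := by
  have key : ∀ (C D : Mat2 K N) (n n' : ℕ) (hn : n + 1 < l) (hn' : n' + 1 < l)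
      (_ : n + 2 ≤ n' ∨ n' + 2 ≤ n) (i j : Fin l → Fin N),
      (atSite C n hn * atSite D n' hn') i j =
        if ∀ r : Fin l, (r : ℕ) ≠ n → (r : ℕ) ≠ n + 1 → (r : ℕ) ≠ n' → (r : ℕ) ≠ n' + 1 →
          i r = j r then
          C (i ⟨n, Nat.lt_of_succ_lt hn⟩, i ⟨n + 1, hn⟩)
              (j ⟨n, Nat.lt_of_succ_lt hn⟩, j ⟨n + 1, hn⟩) *
            D (i ⟨n', Nat.lt_of_succ_lt hn'⟩, i ⟨n' + 1, hn'⟩)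
              (j ⟨n', Nat.lt_of_succ_lt hn'⟩, j ⟨n' + 1, hn'⟩)
        else 0 := by
    intro C D n n' hn hn' hnn i j
    rw [Matrix.mul_apply]
    -- The only intermediate tuple that contributes: `C` has already replaced `i` by `j` on its two
    -- sites, and nothing else has changed yet.
    set k : Fin l → Fin N := fun r => if (r : ℕ) = n ∨ (r : ℕ) = n + 1 then j r else i r with hk
    rw [Finset.sum_eq_single k]
    · simp only [atSite_apply]
      have h1 : ∀ r : Fin l, (r : ℕ) ≠ n → (r : ℕ) ≠ n + 1 → i r = k r := by
        intro r h1 h2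
        simp [hk, h1, h2]
      have h2 : (∀ r : Fin l, (r : ℕ) ≠ n' → (r : ℕ) ≠ n' + 1 → k r = j r) ↔
          ∀ r : Fin l, (r : ℕ) ≠ n → (r : ℕ) ≠ n + 1 → (r : ℕ) ≠ n' → (r : ℕ) ≠ n' + 1 →
            i r = j r := by
        refine forall_congr' fun r => ?_
        simp only [hk]
        by_cases hr : (r : ℕ) = n ∨ (r : ℕ) = n + 1
        · rcases hr with hr | hr <;> simp [hr]
        · push Not at hr
          simp [hr.1, hr.2]
      rw [if_pos h1]
      simp only [h2]
      have e1 : k ⟨n, Nat.lt_of_succ_lt hn⟩ = j ⟨n, Nat.lt_of_succ_lt hn⟩ := by simp [hk]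
      have e2 : k ⟨n + 1, hn⟩ = j ⟨n + 1, hn⟩ := by simp [hk]
      have e3 : k ⟨n', Nat.lt_of_succ_lt hn'⟩ = i ⟨n', Nat.lt_of_succ_lt hn'⟩ := by
        simp only [hk]; rw [if_neg (by omega)]
      have e4 : k ⟨n' + 1, hn'⟩ = i ⟨n' + 1, hn'⟩ := by
        simp only [hk]; rw [if_neg (by omega)]
      rw [e1, e2, e3, e4]
      split_ifs <;> simp
    · intro p _ hp
      by_contra hne
      apply hp
      have hA : atSite C n hn i p ≠ 0 := left_ne_zero_of_mul hne
      have hB : atSite D n' hn' p j ≠ 0 := right_ne_zero_of_mul hne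
      rw [atSite_apply] at hA hB
      have hA' := (ite_ne_right_iff.mp hA).1
      have hB' := (ite_ne_right_iff.mp hB).1
      funext r
      simp only [hk]
      by_cases hr : (r : ℕ) = n ∨ (r : ℕ) = n + 1
      · rw [if_pos hr]
        exact hB' r (by omega) (by omega)
      · rw [if_neg hr]
        push Not at hr
        exact (hA' r hr.1 hr.2).symm
    · simp
  ext i j
  rw [key A B m m' h h' (Or.inl hm), key B A m' m h' h (Or.inr hm), mul_comm]
  congr 1
  refine propext (forall_congr' fun r => ?_)
  tauto

end Tensor

end QProj

namespace QProj

/-! ### Idempotents in algebras with Birman–Murakami–Wenzl relations -/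

section Abstract
variable {K : Type*} [Field K] {𝒜 : Type*} [Ring 𝒜] [Algebra K 𝒜]

/-- The elements `σ 0, …, σ (n - 1)` and `e 0, …, e (n - 1)` satisfy the relations of the
Birman–Murakami–Wenzl algebra on `n + 1` strands that are used below; `k` and `t` are its
parameters. -/
structure BMWChain (k t : K) (n : ℕ) (σ e : ℕ → 𝒜) : Prop where
  skein : ∀ i < n, σ i * σ i = 1 + k • σ i - (k * t) • e i
  twist : ∀ i < n, σ i * e i = t • e i
  braid : ∀ i, i + 1 < n → σ (i + 1) * σ i * σ (i + 1) = σ i * σ (i + 1) * σ i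
  slide_left : ∀ i, i + 1 < n → σ (i + 1) * σ i * e (i + 1) = e i * e (i + 1)
  slide_right : ∀ i, i + 1 < n → e i * σ (i + 1) * σ i = e i * e (i + 1)
  zigzag : ∀ i, i + 1 < n → e (i + 1) * e i * e (i + 1) = e (i + 1)
  twist_right : ∀ i < n, e i * σ i = t • e i
  commute_σ_σ : ∀ i j, i + 2 ≤ j → j < n → Commute (σ i) (σ j)
  commute_σ_e : ∀ i j, i + 2 ≤ j → j < n → Commute (σ i) (e j)
  commute_e_σ : ∀ i j, i + 2 ≤ j → j < n → Commute (e i) (σ j)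
  commute_e_e : ∀ i j, i + 2 ≤ j → j < n → Commute (e i) (e j)

/-- Coefficients `α l + β l σ + γ l e` of the factors of the recursion. -/
structure Coeffs (K : Type*) where
  α : ℕ → K
  β : ℕ → K
  γ : ℕ → K

/-- The identities between coefficients that make the recursion produce the projector onto the
common eigenspace of the `σ i` for the eigenvalue `c`. -/
structure Coeffs.Good (C : Coeffs K) (k t c : K) : Prop where
  unit : ∀ l, C.α l + c * C.β l = 1
  αβ : ∀ a, c * C.α (a + 1) = C.β (a + 1) * C.α a
  γβ : ∀ a, C.γ a * (C.β (a + 1) + c * C.γ (a + 1)) = c ^ 2 * (C.γ (a + 1) * C.β a)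
  γα : ∀ a, C.γ (a + 1) * C.α a * (t - c) =
    k * t * (C.β (a + 1) * C.α a) + k * c * (C.γ (a + 1) * C.β a)
  α_zero : C.α 0 = 1
  β_zero : C.β 0 = 0

/-- The factor `α l + β l σ + γ l e`. -/
def Coeffs.factor (C : Coeffs K) (l : ℕ) (s e : 𝒜) : 𝒜 :=
  C.α l • (1 : 𝒜) + C.β l • s + C.γ l • e

/-- The idempotents defined by the recursion, `chainProj C σ e j` living on `j + 1` strands. -/
def chainProj (C : Coeffs K) (σ e : ℕ → 𝒜) : ℕ → 𝒜
  | 0 => 1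
  | j + 1 => chainProj C σ e j * C.factor (j + 1) (σ j) (e j) * chainProj C σ e j

variable {k t c : K} {n : ℕ} {σ e : ℕ → 𝒜} {C : Coeffs K}

theorem chainProj_zero (C : Coeffs K) (σ e : ℕ → 𝒜) : chainProj C σ e 0 = 1 := rfl

theorem chainProj_succ (C : Coeffs K) (σ e : ℕ → 𝒜) (j : ℕ) : chainProj C σ e (j + 1) =
    chainProj C σ e j * C.factor (j + 1) (σ j) (e j) * chainProj C σ e j := rfl

theorem Coeffs.factor_commute (C : Coeffs K) (l : ℕ) {s f y : 𝒜} (hs : Commute s y)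
    (hf : Commute f y) : Commute (C.factor l s f) y :=
  (((Commute.one_left y).smul_left _).add_left (hs.smul_left _)).add_left (hf.smul_left _)

theorem chainProj_commute (C : Coeffs K) {y : 𝒜} (j : ℕ) (hσ : ∀ i < j, Commute (σ i) y)
    (he : ∀ i < j, Commute (e i) y) : Commute (chainProj C σ e j) y := by
  induction j with
  | zero => exact Commute.one_left y
  | succ j ih =>
    have h := ih (fun i hi => hσ i (by omega)) (fun i hi => he i (by omega))
    exact (h.mul_left (C.factor_commute _ (hσ j (by omega)) (he j (by omega)))).mul_left h

theorem Coeffs.Good.factor_mul (hC : C.Good k t c) (l : ℕ) {s f y : 𝒜} (hs : s * y = c • y)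
    (hf : f * y = 0) : C.factor l s f * y = y := by
  rw [Coeffs.factor, add_mul, add_mul, smul_mul_assoc, smul_mul_assoc, smul_mul_assoc, hs, hf,
    one_mul, smul_zero, add_zero, smul_smul, ← add_smul, mul_comm, hC.unit, one_smul]

/-- Because $\alpha_l+c\beta_l=1$, every factor of the recursion fixes `y`. -/
theorem chainProj_mul (hC : C.Good k t c) {y : 𝒜} (j : ℕ) (hσ : ∀ i < j, σ i * y = c • y)
    (he : ∀ i < j, e i * y = 0) : chainProj C σ e j * y = y := by
  induction j with
  | zero => exact one_mul y
  | succ j ih =>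
    have h := ih (fun i hi => hσ i (by omega)) (fun i hi => he i (by omega))
    rw [chainProj_succ, mul_assoc, h, mul_assoc,
      hC.factor_mul _ (hσ j (by omega)) (he j (by omega)), h]

/-- On an eigenvector for a root of $c^2=1+kc$ all terms of the skein relation cancel except the one
with $f$, whose coefficient $kt$ is invertible. -/
theorem e_mul_eq_zero (hk : k * t ≠ 0) (hc : c ^ 2 = 1 + k * c) {s f y : 𝒜}
    (skein : s * s = 1 + k • s - (k * t) • f) (hs : s * y = c • y) : f * y = 0 := by
  have h := congrArg (· * y) skein
  simp only [sub_mul, add_mul, smul_mul_assoc, one_mul, mul_assoc, hs, mul_smul_comm] at h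
  have h2 : (k * t) • (f * y) = 0 := by
    have : (c * c - 1 - k * c) • y = -((k * t) • (f * y)) := by
      linear_combination (norm := module) h
    rw [show c * c - 1 - k * c = 0 by linear_combination hc, zero_smul] at this
    exact neg_eq_zero.mp this.symm
  exact (smul_eq_zero.mp h2).resolve_left hk

/-- The eigenvalue property of the product of two consecutive factors. -/
theorem BMWChain.eigen_step (h : BMWChain k t n σ e) (hC : C.Good k t c) (hc0 : c ≠ 0)
    (hc : c ^ 2 = 1 + k * c) {i : ℕ} (hi : i + 1 < n) (a : ℕ) {x : 𝒜} (hx : σ i * x = c • x)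
    (hx' : e i * x = 0) :
    σ (i + 1) * (C.factor a (σ i) (e i) * (C.factor (a + 1) (σ (i + 1)) (e (i + 1)) * x)) =
      c • (C.factor a (σ i) (e i) * (C.factor (a + 1) (σ (i + 1)) (e (i + 1)) * x)) := by
  -- Write $\sigma,e$ for the generators at `i` and $\sigma',e'$ for those at `i + 1`. The relations
  -- below express everything through $x,\ \sigma'x,\ e'x,\ \sigma\sigma'x,\ \sigma e'x,\ ee'x$,
  -- whose span is stable under $\sigma'$; the claim becomes six identities between scalars.
  have r1 : c • (e i * (σ (i + 1) * x)) = e i * (e (i + 1) * x) := by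
    rw [← mul_assoc (e i) (e (i + 1)), ← h.slide_right i hi, mul_assoc, hx, mul_smul_comm,
      mul_assoc]
  have r1' : e i * (σ (i + 1) * x) = c⁻¹ • (e i * (e (i + 1) * x)) := by
    rw [← r1, smul_smul, inv_mul_cancel₀ hc0, one_smul]
  have r2 : σ (i + 1) * (σ (i + 1) * x) =
      x + k • (σ (i + 1) * x) - (k * t) • (e (i + 1) * x) := by
    rw [← mul_assoc, h.skein _ hi, sub_mul, add_mul, one_mul, smul_mul_assoc, smul_mul_assoc]
  have r3 : σ (i + 1) * (e (i + 1) * x) = t • (e (i + 1) * x) := by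
    rw [← mul_assoc, h.twist _ hi, smul_mul_assoc]
  have r4 : σ (i + 1) * (σ i * (σ (i + 1) * x)) = c • (σ i * (σ (i + 1) * x)) := by
    rw [← mul_assoc, ← mul_assoc, h.braid i hi, mul_assoc, hx, mul_smul_comm, mul_assoc]
  have r5 : σ (i + 1) * (σ i * (e (i + 1) * x)) = e i * (e (i + 1) * x) := by
    rw [← mul_assoc, ← mul_assoc, h.slide_left i hi, mul_assoc]
  -- Twist, slide and zigzag combine to $t\,e'\sigma e'=e'$, which removes the term $e'\sigma e'x$
  -- produced by the skein relation in `r7`.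
  have r6 : t • (e (i + 1) * (σ i * (e (i + 1) * x))) = e (i + 1) * x := by
    rw [← smul_mul_assoc, ← h.twist_right _ hi, mul_assoc, r5, ← mul_assoc, ← mul_assoc,
      h.zigzag i hi]
  have r7 : σ (i + 1) * (e i * (e (i + 1) * x)) =
      σ i * (e (i + 1) * x) + k • (e i * (e (i + 1) * x)) - k • (e (i + 1) * x) := by
    rw [← r5, ← mul_assoc (σ (i + 1)) (σ (i + 1)), h.skein _ hi, sub_mul, add_mul, one_mul,
      smul_mul_assoc, smul_mul_assoc, mul_smul, r6]
  have hci : c * c⁻¹ = 1 := mul_inv_cancel₀ hc0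
  have hA := hC.αβ a
  have hB := hC.γβ a
  have hG := hC.γα a
  have hU := hC.unit a
  have hkc : k = c - c⁻¹ := by
    field_simp
    linear_combination -hc
  simp only [Coeffs.factor, add_mul, mul_add, smul_mul_assoc, mul_smul_comm, one_mul, hx, hx', r1',
    r2, r3, r4, r5, r7, mul_zero, smul_zero, smul_add, smul_sub, smul_smul]
  have hA' : C.α (a + 1) = c⁻¹ * (C.β (a + 1) * C.α a) := by
    rw [← hA, ← mul_assoc, inv_mul_cancel₀ hc0, one_mul]
  have hB' : C.γ a * (c⁻¹ * C.β (a + 1) + C.γ (a + 1)) = c * (C.γ (a + 1) * C.β a) := by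
    field_simp
    linear_combination hB
  match_scalars
  · linear_combination C.α (a + 1) * hU + hA' + C.β (a + 1) * C.α a * hkc
  · linear_combination -(c * C.α (a + 1)) * hU - hA
  · linear_combination hG - k * hB'
  · ring
  · linear_combination hB'
  · linear_combination (k - c) * hB' - C.γ (a + 1) * C.β a * hc

/-- `chainProj C σ e j` maps to the common eigenspace of the `σ i` for the eigenvalue `c`, on which
the `e i` vanish. -/
theorem BMWChain.chainProj_eigen (h : BMWChain k t n σ e) (hC : C.Good k t c) (hk : k ≠ 0)
    (ht : t ≠ 0) (hc0 : c ≠ 0) (hc : c ^ 2 = 1 + k * c) (j : ℕ) (hj : j ≤ n) :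
    ∀ i < j, σ i * chainProj C σ e j = c • chainProj C σ e j ∧ e i * chainProj C σ e j = 0 := by
  induction j with
  | zero => intro i hi; omega
  | succ j ih =>
    have ih := ih (by omega)
    suffices hlast : σ j * chainProj C σ e (j + 1) = c • chainProj C σ e (j + 1) by
      intro i hi
      rcases Nat.lt_succ_iff_lt_or_eq.mp hi with hi | rfl
      · rw [chainProj_succ, ← mul_assoc, ← mul_assoc, ← mul_assoc, ← mul_assoc, (ih i hi).1,
          (ih i hi).2]
        simp only [smul_mul_assoc, zero_mul, and_self]
      · exact ⟨hlast, e_mul_eq_zero (mul_ne_zero hk ht) hc (h.skein i (by omega)) hlast⟩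
    cases j with
    -- Two strands: there is no earlier projector, and the identities at $a=0$ with $\alpha_0=1$,
    -- $\beta_0=0$ are exactly the eigenvalue equation in terms of $1,\sigma,e$.
    | zero =>
      have hA := hC.αβ 0
      have hG := hC.γα 0
      rw [hC.α_zero] at hA hG
      rw [hC.β_zero] at hG
      have hA' : C.α (0 + 1) = c⁻¹ * C.β (0 + 1) := by
        field_simp
        linear_combination hA
      have hkc : k = c - c⁻¹ := by
        field_simp
        linear_combination -hc
      simp only [chainProj_succ, chainProj_zero, one_mul, mul_one, Coeffs.factor, mul_add,
        mul_smul_comm, smul_add, zero_add, h.skein 0 (by omega), h.twist 0 (by omega), smul_sub,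
        smul_smul] at *
      match_scalars
      · linear_combination hA' + C.β 1 * hkc
      · linear_combination -hA
      · linear_combination hG
    | succ j =>
      set p := chainProj C σ e j with hp
      have hcomm : ∀ y : 𝒜, (∀ i < j, Commute (σ i) y) → (∀ i < j, Commute (e i) y) →
          p * y = y * p := fun y h1 h2 => chainProj_commute C j h1 h2
      have hσ : p * σ (j + 1) = σ (j + 1) * p :=
        hcomm _ (fun i hi => h.commute_σ_σ i _ (by omega) (by omega))
          (fun i hi => h.commute_e_σ i _ (by omega) (by omega))
      have hf : p * C.factor (j + 1 + 1) (σ (j + 1)) (e (j + 1)) =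
          C.factor (j + 1 + 1) (σ (j + 1)) (e (j + 1)) * p :=
        hcomm _
          (fun i hi => (C.factor_commute _ (h.commute_σ_σ i _ (by omega) (by omega)).symm
            (h.commute_σ_e i _ (by omega) (by omega)).symm).symm)
          (fun i hi => (C.factor_commute _ (h.commute_e_σ i _ (by omega) (by omega)).symm
            (h.commute_e_e i _ (by omega) (by omega)).symm).symm)
      have habs : p * chainProj C σ e (j + 1) = chainProj C σ e (j + 1) :=
        chainProj_mul hC j (fun i hi => (ih i (by omega)).1) (fun i hi => (ih i (by omega)).2)
      -- Expand the left copy of the previous projector as $p\,f\,p$, move its inner $p$ past the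
      -- new factor and absorb it in the right copy. The remaining outer $p$ commutes with
      -- $\sigma_{j+1}$, which leaves the product of two factors treated in `eigen_step`.
      have hform : chainProj C σ e (j + 1 + 1) = p * (C.factor (j + 1) (σ j) (e j) *
          (C.factor (j + 1 + 1) (σ (j + 1)) (e (j + 1)) * chainProj C σ e (j + 1))) := by
        have hP : chainProj C σ e (j + 1) = p * C.factor (j + 1) (σ j) (e j) * p :=
          chainProj_succ C σ e j
        rw [chainProj_succ]
        nth_rw 1 [hP]
        rw [mul_assoc _ p, hf, mul_assoc, mul_assoc, mul_assoc, habs]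
      have hstep := h.eigen_step hC hc0 hc (i := j) (by omega) (j + 1)
        (ih j (by omega)).1 (ih j (by omega)).2
      rw [hform, ← mul_assoc, ← hσ, mul_assoc, hstep, mul_smul_comm]

theorem chainProj_map {ℬ : Type*} [Ring ℬ] [Algebra K ℬ] (f : 𝒜 →ₐ[K] ℬ) (C : Coeffs K)
    {σ e : ℕ → 𝒜} {σ' e' : ℕ → ℬ} (j : ℕ) (hσ : ∀ i < j, f (σ i) = σ' i)
    (he : ∀ i < j, f (e i) = e' i) : f (chainProj C σ e j) = chainProj C σ' e' j := by
  induction j with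
  | zero => exact map_one f
  | succ j ih =>
    rw [chainProj_succ, chainProj_succ, map_mul, map_mul,
      ih (fun i hi => hσ i (by omega)) (fun i hi => he i (by omega))]
    simp only [Coeffs.factor, map_add, map_smul, map_one, hσ j (by omega), he j (by omega)]

theorem chainProj_mem (C : Coeffs K) (S : Subalgebra K 𝒜) (j : ℕ) (hσ : ∀ i < j, σ i ∈ S)
    (he : ∀ i < j, e i ∈ S) : chainProj C σ e j ∈ S := by
  induction j with
  | zero => exact S.one_mem
  | succ j ih =>
    have h := ih (fun i hi => hσ i (by omega)) (fun i hi => he i (by omega))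
    exact S.mul_mem (S.mul_mem h (S.add_mem (S.add_mem (S.smul_mem S.one_mem _)
      (S.smul_mem (hσ j (by omega)) _)) (S.smul_mem (he j (by omega)) _))) h

end Abstract

end QProj

namespace QProj

/-! ### Chains of matrices on tensor powers -/

/-- The relations between the generators on two neighbouring sites. -/
structure TripleRel {𝒜 : Type*} [Ring 𝒜] (σ e σ' e' : 𝒜) : Prop where
  braid : σ' * σ * σ' = σ * σ' * σ
  slide_left : σ' * σ * e' = e * e'
  slide_left' : σ * σ' * e = e' * e
  slide_right : e * σ' * σ = e * e'
  slide_right' : e' * σ * σ' = e' * e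
  zigzag : e' * e * e' = e'
  zigzag' : e * e' * e = e

theorem TripleRel.map {𝒜 ℬ : Type*} [Ring 𝒜] [Ring ℬ] (f : 𝒜 →+* ℬ) {σ e σ' e' : 𝒜}
    (h : TripleRel σ e σ' e') : TripleRel (f σ) (f e) (f σ') (f e') := by
  constructor <;> simp only [← map_mul]
  · rw [h.braid]
  · rw [h.slide_left]
  · rw [h.slide_left']
  · rw [h.slide_right]
  · rw [h.slide_right']
  · rw [h.zigzag]
  · rw [h.zigzag']

section Sites
variable {K : Type*} [Field K] {N : ℕ}

/-- The symmetric matrices `R` and `E` of 2-tensors generate representations of the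
Birman–Murakami–Wenzl algebras on tensor powers. -/
structure BMWPair (k t : K) (R E : Mat2 K N) : Prop where
  skein : R * R = 1 + k • R - (k * t) • E
  twist : R * E = t • E
  symm_R : R.transpose = R
  symm_E : E.transpose = E
  triple : TripleRel (atSite R 0 (by omega : 0 + 1 < 3)) (atSite E 0 (by omega : 0 + 1 < 3))
    (atSite R 1 (by omega : 1 + 1 < 3)) (atSite E 1 (by omega : 1 + 1 < 3))

/-- `A_{m(m+1)}` as a function of the natural number `m`, zero if there is no such site. -/
def site (l : ℕ) (A : Mat2 K N) (m : ℕ) : TMat K N l := if h : m + 1 < l then atSite A m h else 0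

theorem site_eq {l : ℕ} (A : Mat2 K N) {m : ℕ} (h : m + 1 < l) : site l A m = atSite A m h :=
  dif_pos h

theorem site_transpose {l : ℕ} (A : Mat2 K N) (m : ℕ) :
    (site l A m).transpose = site l A.transpose m := by
  unfold site
  split_ifs
  · exact atSite_transpose A m _
  · exact Matrix.transpose_zero

theorem tensorOne_site {l : ℕ} (A : Mat2 K N) {m : ℕ} (h : m + 1 < l) :
    tensorOneHom K N l (site l A m) = site (l + 1) A m := by
  rw [site_eq A h, site_eq A (Nat.lt_succ_of_lt h), tensorOne_atSite]

theorem oneTensor_site {l : ℕ} (A : Mat2 K N) {m : ℕ} (h : m + 1 < l) :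
    oneTensorHom K N l (site l A m) = site (l + 1) A (m + 1) := by
  rw [site_eq A h, site_eq A (Nat.succ_lt_succ h), oneTensor_atSite]

theorem site_commute {l : ℕ} (A B : Mat2 K N) {m m' : ℕ} (hm : m + 2 ≤ m') :
    Commute (site l A m) (site l B m') := by
  unfold site
  split_ifs
  · exact atSite_commute A B m m' _ _ hm
  · exact Commute.zero_right _
  · exact Commute.zero_left _
  · exact Commute.zero_right _

variable {k t : K} {R E : Mat2 K N}

theorem BMWPair.triple_site (h : BMWPair k t R E) (l m : ℕ) (hm : m + 2 < l) :
    TripleRel (site l R m) (site l E m) (site l R (m + 1)) (site l E (m + 1)) := by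
  have key : ∀ (l m : ℕ) (hm : m + 2 < l),
      TripleRel (atSite R m (by omega : m + 1 < l)) (atSite E m (by omega : m + 1 < l))
        (atSite R (m + 1) hm) (atSite E (m + 1) hm) := by
    refine site_pair_induction h.triple ?_ ?_
    · intro l m hm ih
      have := ih.map (tensorOneHom K N l).toRingHom
      simpa only [AlgHom.toRingHom_eq_coe, RingHom.coe_coe, tensorOne_atSite] using this
    · intro l m hm ih
      have := ih.map (oneTensorHom K N l).toRingHom
      simpa only [AlgHom.toRingHom_eq_coe, RingHom.coe_coe, oneTensor_atSite] using this
  rw [site_eq _ (by omega : m + 1 < l), site_eq _ (by omega : m + 1 < l), site_eq _ hm,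
    site_eq _ hm]
  exact key l m hm

theorem BMWPair.twist_right (h : BMWPair k t R E) : E * R = t • E := by
  have := congrArg Matrix.transpose h.twist
  rwa [Matrix.transpose_mul, Matrix.transpose_smul, h.symm_R, h.symm_E] at this

theorem BMWPair.site_skein (h : BMWPair k t R E) {l m : ℕ} (hm : m + 1 < l) :
    site l R m * site l R m = 1 + k • site l R m - (k * t) • site l E m := by
  simp only [site_eq _ hm]
  rw [← atSite_mul, h.skein, atSite_sub, atSite_add, atSite_smul, atSite_smul, atSite_one]

theorem BMWPair.site_twist (h : BMWPair k t R E) {l m : ℕ} (hm : m + 1 < l) :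
    site l R m * site l E m = t • site l E m := by
  simp only [site_eq _ hm]
  rw [← atSite_mul, h.twist, atSite_smul]

theorem BMWPair.site_twist_right (h : BMWPair k t R E) {l m : ℕ} (hm : m + 1 < l) :
    site l E m * site l R m = t • site l E m := by
  simp only [site_eq _ hm]
  rw [← atSite_mul, h.twist_right, atSite_smul]

theorem BMWPair.chain (h : BMWPair k t R E) (l : ℕ) :
    BMWChain k t (l - 1) (site l R) (site l E) where
  skein i hi := h.site_skein (by omega)
  twist i hi := h.site_twist (by omega)
  twist_right i hi := h.site_twist_right (by omega)
  braid i hi := (h.triple_site l i (by omega)).braid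
  slide_left i hi := (h.triple_site l i (by omega)).slide_left
  slide_right i hi := (h.triple_site l i (by omega)).slide_right
  zigzag i hi := (h.triple_site l i (by omega)).zigzag
  commute_σ_σ i j hij _ := site_commute _ _ hij
  commute_σ_e i j hij _ := site_commute _ _ hij
  commute_e_σ i j hij _ := site_commute _ _ hij
  commute_e_e i j hij _ := site_commute _ _ hij

/-- Numbering the sites from the right gives another chain. This is why `TripleRel` contains each
slide and zigzag relation together with its mirror image; the braid relation is its own mirror
image. -/
theorem BMWPair.chain_rev (h : BMWPair k t R E) (l : ℕ) :
    BMWChain k t (l - 1) (fun i => site l R (l - 2 - i)) (fun i => site l E (l - 2 - i)) := by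
  have key : ∀ i, i + 1 < l - 1 → l - 2 - i = l - 2 - (i + 1) + 1 := fun i hi => by omega
  constructor
  · intro i hi; exact h.site_skein (by omega)
  · intro i hi; exact h.site_twist (by omega)
  · intro i hi
    simp only [key i hi]
    exact (h.triple_site l (l - 2 - (i + 1)) (by omega)).braid.symm
  · intro i hi
    simp only [key i hi]
    exact (h.triple_site l (l - 2 - (i + 1)) (by omega)).slide_left'
  · intro i hi
    simp only [key i hi]
    exact (h.triple_site l (l - 2 - (i + 1)) (by omega)).slide_right'
  · intro i hi
    simp only [key i hi]
    exact (h.triple_site l (l - 2 - (i + 1)) (by omega)).zigzag'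
  · intro i hi; exact h.site_twist_right (by omega)
  all_goals exact fun i j hij hj => (site_commute _ _ (by omega)).symm

/-! ### The projectors -/

/-- The projector of `l`-tensors produced by the recursion. -/
def tensorProj (C : Coeffs K) (R E : Mat2 K N) (l : ℕ) : TMat K N l :=
  chainProj C (site l R) (site l E) (l - 1)

/-- The parameters `k`, `t` and the eigenvalue `c` are generic enough for the recursion with
coefficients `C`. -/
structure Coeffs.Generic (C : Coeffs K) (k t c : K) : Prop extends C.Good k t c where
  k_ne : k ≠ 0
  t_ne : t ≠ 0
  c_ne : c ≠ 0
  quad : c ^ 2 = 1 + k * c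

variable {C : Coeffs K} {c : K}

theorem tensorProj_one (C : Coeffs K) (R E : Mat2 K N) : tensorProj C R E 1 = 1 := rfl

/-- The recursion is palindromic and its factors are symmetric. -/
theorem chainProj_transpose (C : Coeffs K) {l : ℕ} {σ e : ℕ → TMat K N l} (j : ℕ)
    (hσ : ∀ i, (σ i).transpose = σ i) (he : ∀ i, (e i).transpose = e i) :
    (chainProj C σ e j).transpose = chainProj C σ e j := by
  induction j with
  | zero => exact Matrix.transpose_one
  | succ j ih =>
    rw [chainProj_succ, Matrix.transpose_mul, Matrix.transpose_mul, ih, mul_assoc]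
    simp only [Coeffs.factor, Matrix.transpose_add, Matrix.transpose_smul, Matrix.transpose_one,
      hσ, he]

theorem BMWPair.site_R_transpose (h : BMWPair k t R E) (l m : ℕ) :
    (site l R m).transpose = site l R m := by rw [site_transpose, h.symm_R]

theorem BMWPair.site_E_transpose (h : BMWPair k t R E) (l m : ℕ) :
    (site l E m).transpose = site l E m := by rw [site_transpose, h.symm_E]

theorem BMWPair.tensorProj_transpose (h : BMWPair k t R E) (C : Coeffs K) (l : ℕ) :
    (tensorProj C R E l).transpose = tensorProj C R E l :=
  chainProj_transpose C _ (h.site_R_transpose l) (h.site_E_transpose l)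

theorem BMWPair.R_mul_tensorProj (h : BMWPair k t R E) (hC : C.Generic k t c) {l m : ℕ}
    (hm : m + 1 < l) : site l R m * tensorProj C R E l = c • tensorProj C R E l :=
  ((h.chain l).chainProj_eigen hC.toGood hC.k_ne hC.t_ne hC.c_ne hC.quad _ le_rfl m (by omega)).1

theorem BMWPair.E_mul_tensorProj (h : BMWPair k t R E) (hC : C.Generic k t c) {l m : ℕ}
    (hm : m + 1 < l) : site l E m * tensorProj C R E l = 0 :=
  ((h.chain l).chainProj_eigen hC.toGood hC.k_ne hC.t_ne hC.c_ne hC.quad _ le_rfl m (by omega)).2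

theorem BMWPair.tensorProj_mul_R (h : BMWPair k t R E) (hC : C.Generic k t c) {l m : ℕ}
    (hm : m + 1 < l) : tensorProj C R E l * site l R m = c • tensorProj C R E l := by
  have := congrArg Matrix.transpose (h.R_mul_tensorProj hC hm)
  rwa [Matrix.transpose_mul, Matrix.transpose_smul, h.tensorProj_transpose,
    h.site_R_transpose] at this

theorem BMWPair.tensorProj_mul_E (h : BMWPair k t R E) (hC : C.Generic k t c) {l m : ℕ}
    (hm : m + 1 < l) : tensorProj C R E l * site l E m = 0 := by
  have := congrArg Matrix.transpose (h.E_mul_tensorProj hC hm)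
  rwa [Matrix.transpose_mul, Matrix.transpose_zero, h.tensorProj_transpose,
    h.site_E_transpose] at this

/-- The projector is the identity on the common eigenspace. -/
theorem tensorProj_mul (hC : C.Generic k t c) {l : ℕ} {Y : TMat K N l}
    (hR : ∀ m, m + 1 < l → site l R m * Y = c • Y) (hE : ∀ m, m + 1 < l → site l E m * Y = 0) :
    tensorProj C R E l * Y = Y :=
  chainProj_mul hC.toGood _ (fun i hi => hR i (by omega)) (fun i hi => hE i (by omega))

theorem BMWPair.mul_tensorProj (h : BMWPair k t R E) (hC : C.Generic k t c) {l : ℕ}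
    {Y : TMat K N l} (hR : ∀ m, m + 1 < l → Y * site l R m = c • Y)
    (hE : ∀ m, m + 1 < l → Y * site l E m = 0) : Y * tensorProj C R E l = Y := by
  have := tensorProj_mul (R := R) (E := E) (l := l) hC (Y := Y.transpose)
    (fun m hm => by
      rw [← h.site_R_transpose, ← Matrix.transpose_mul, hR m hm, Matrix.transpose_smul])
    (fun m hm => by
      rw [← h.site_E_transpose, ← Matrix.transpose_mul, hE m hm, Matrix.transpose_zero])
  have := congrArg Matrix.transpose this
  rwa [Matrix.transpose_mul, Matrix.transpose_transpose, h.tensorProj_transpose] at this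

theorem BMWPair.tensorProj_idem (h : BMWPair k t R E) (hC : C.Generic k t c) (l : ℕ) :
    tensorProj C R E l * tensorProj C R E l = tensorProj C R E l :=
  tensorProj_mul hC (fun _ hm => h.R_mul_tensorProj hC hm) (fun _ hm => h.E_mul_tensorProj hC hm)

/-- The factor of the recursion as a matrix of 2-tensors. -/
theorem factor_site (C : Coeffs K) (j : ℕ) (R E : Mat2 K N) {l m : ℕ} (hm : m + 1 < l) :
    C.factor j (site l R m) (site l E m) = atSite (C.factor j R E) m hm := by
  simp only [Coeffs.factor, atSite_add, atSite_smul, atSite_one, site_eq _ hm]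

theorem last_site_lt {l : ℕ} (hl : 1 ≤ l) : l - 1 + 1 < l + 1 := by
  rw [Nat.sub_add_cancel hl]
  exact Nat.lt_succ_self l

theorem first_site_lt {l : ℕ} (hl : 1 ≤ l) : 0 + 1 < l + 1 := Nat.succ_lt_succ hl

theorem tensorProj_succ (C : Coeffs K) (R E : Mat2 K N) {l : ℕ} (hl : 1 ≤ l) :
    tensorProj C R E (l + 1) = tensorOne (tensorProj C R E l) *
      atSite (C.factor l R E) (l - 1) (last_site_lt hl) * tensorOne (tensorProj C R E l) := by
  obtain ⟨l, rfl⟩ : ∃ m, l = m + 1 := ⟨l - 1, by omega⟩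
  have h1 : tensorOneHom K N (l + 1) (tensorProj C R E (l + 1)) =
      chainProj C (site (l + 2) R) (site (l + 2) E) l :=
    chainProj_map _ C l (fun i hi => tensorOne_site _ (by omega))
      (fun i hi => tensorOne_site _ (by omega))
  rw [← tensorOneHom_apply, h1, ← factor_site]
  rfl

/-- The mirrored recursion produces the same projector. -/
theorem BMWPair.chainProj_rev (h : BMWPair k t R E) (hC : C.Generic k t c) (l : ℕ) :
    chainProj C (fun i => site l R (l - 2 - i)) (fun i => site l E (l - 2 - i)) (l - 1) =
      tensorProj C R E l := by
  set P' := chainProj C (fun i => site l R (l - 2 - i)) (fun i => site l E (l - 2 - i)) (l - 1)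
    with hP'
  have heig := (h.chain_rev l).chainProj_eigen hC.toGood hC.k_ne hC.t_ne hC.c_ne hC.quad _ le_rfl
  have hsub : ∀ m, m + 1 < l → l - 2 - (l - 2 - m) = m := fun m hm => by omega
  have h1 : tensorProj C R E l * P' = P' := by
    refine tensorProj_mul hC (fun m hm => ?_) (fun m hm => ?_)
    · have := (heig (l - 2 - m) (by omega)).1
      simpa only [hsub m hm] using this
    · have := (heig (l - 2 - m) (by omega)).2
      simpa only [hsub m hm] using this
  -- By `h1` and `h2`, with $T$ the projector from the left, $TP'=P'$ and $P'T=T$. Transposing the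
  -- second equation gives $TP'=T$, as both matrices are symmetric.
  have h2 : P' * tensorProj C R E l = tensorProj C R E l :=
    chainProj_mul hC.toGood _ (fun i hi => h.R_mul_tensorProj hC (by omega))
      (fun i hi => h.E_mul_tensorProj hC (by omega))
  have h3 : P'.transpose = P' :=
    chainProj_transpose C _ (fun i => h.site_R_transpose l _) (fun i => h.site_E_transpose l _)
  have h4 := congrArg Matrix.transpose h2
  rw [Matrix.transpose_mul, h3, h.tensorProj_transpose] at h4
  rw [← h1, h4]

theorem BMWPair.tensorProj_succ' (h : BMWPair k t R E) (hC : C.Generic k t c) {l : ℕ}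
    (hl : 1 ≤ l) : tensorProj C R E (l + 1) = oneTensor (tensorProj C R E l) *
      atSite (C.factor l R E) 0 (first_site_lt hl) * oneTensor (tensorProj C R E l) := by
  obtain ⟨l, rfl⟩ : ∃ m, l = m + 1 := ⟨l - 1, by omega⟩
  have h1 : oneTensorHom K N (l + 1) (tensorProj C R E (l + 1)) =
      chainProj C (fun i => site (l + 1 + 1) R (l + 1 + 1 - 2 - i))
        (fun i => site (l + 1 + 1) E (l + 1 + 1 - 2 - i)) l := by
    rw [← h.chainProj_rev hC]
    refine chainProj_map _ C l (fun i hi => ?_) (fun i hi => ?_)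
    · rw [oneTensor_site _ (by omega), show l + 1 - 2 - i + 1 = l + 1 + 1 - 2 - i by omega]
    · rw [oneTensor_site _ (by omega), show l + 1 - 2 - i + 1 = l + 1 + 1 - 2 - i by omega]
  rw [← h.chainProj_rev hC (l + 1 + 1), ← oneTensorHom_apply, h1, ← factor_site]
  change chainProj C _ _ (l + 1) = _
  rw [chainProj_succ]
  simp only [show l + 1 + 1 - 2 - l = 0 by omega]

theorem BMWPair.tensorProj_mem (h : BMWPair k t R E) (hC : C.Generic k t c) (l : ℕ) :
    tensorProj C R E l ∈ braidPolynomials R l := by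
  have hR : ∀ i < l - 1, site l R i ∈ braidPolynomials R l := fun i hi => by
    rw [site_eq R (by omega : i + 1 < l)]
    exact Algebra.subset_adjoin ⟨i, _, rfl⟩
  refine chainProj_mem C _ _ hR (fun i hi => ?_)
  have hs := h.site_skein (l := l) (m := i) (by omega)
  -- The skein relation solved for $E$, possible since $kt\neq0$: polynomials in $\hat R$ and $E$
  -- are polynomials in $\hat R$ alone.
  have hE : site l E i = (k * t)⁻¹ • (1 + k • site l R i - site l R i * site l R i) := by
    rw [hs, sub_sub_cancel, smul_smul, inv_mul_cancel₀ (mul_ne_zero hC.k_ne hC.t_ne), one_smul]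
  rw [hE]
  exact Subalgebra.smul_mem _ (sub_mem (add_mem (one_mem _) (Subalgebra.smul_mem _ (hR i hi) _))
    (mul_mem (hR i hi) (hR i hi))) _

/-! ### Metrics -/

/-- `g ⊗ ⋯ ⊗ g`. -/
def metricPower (g : Matrix (Fin N) (Fin N) K) (l : ℕ) : TMat K N l :=
  Matrix.of fun i j => ∏ r, g (i r) (j r)

/-- Reversal of the order of the tensor factors. -/
def reverseHom (K : Type*) [Field K] (N l : ℕ) : TMat K N l →ₐ[K] TMat K N l :=
  (Matrix.reindexAlgEquiv K K ((Equiv.arrowCongr Fin.revPerm (Equiv.refl (Fin N))))).toAlgHom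

theorem reverseHom_apply {l : ℕ} (A : TMat K N l) (i j : Fin l → Fin N) :
    reverseHom K N l A i j = A (i ∘ Fin.rev) (j ∘ Fin.rev) := rfl

theorem metricCompatible_iff (g : Matrix (Fin N) (Fin N) K) {l : ℕ} (P : TMat K N l) :
    MetricCompatible g P ↔ P * metricPower g l = metricPower g l * reverseHom K N l P := by
  rw [← Matrix.ext_iff]
  rfl

/-- Interchange of the two factors. -/
def flip (A : Mat2 K N) : Mat2 K N := A.submatrix Prod.swap Prod.swap

theorem reverseHom_atSite {l : ℕ} (A : Mat2 K N) (m : ℕ) (hm : m + 1 < l) :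
    reverseHom K N l (atSite A m hm) = atSite (flip A) (l - 2 - m) (by omega) := by
  ext i j
  rw [reverseHom_apply, atSite_apply, atSite_apply]
  have h1 : Fin.rev (⟨m, Nat.lt_of_succ_lt hm⟩ : Fin l) =
      ⟨l - 2 - m + 1, by omega⟩ := by
    ext; simp only [Fin.val_rev]; omega
  have h2 : Fin.rev (⟨m + 1, hm⟩ : Fin l) = ⟨l - 2 - m, by omega⟩ := by
    ext; simp only [Fin.val_rev]; omega
  simp only [Function.comp, h1, h2, flip, Matrix.submatrix_apply, Prod.swap]
  congr 1
  refine propext ⟨fun H r h1 h2 => ?_, fun H r h1 h2 => ?_⟩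
  · have := H r.rev (by rw [Fin.val_rev]; omega) (by rw [Fin.val_rev]; omega)
    rwa [Fin.rev_rev] at this
  · exact H r.rev (by rw [Fin.val_rev]; omega) (by rw [Fin.val_rev]; omega)

theorem tensorOne_mul_metricPower (g : Matrix (Fin N) (Fin N) K) {l : ℕ} {A B : TMat K N l}
    (h : A * metricPower g l = metricPower g l * B) :
    tensorOneHom K N l A * metricPower g (l + 1) =
      metricPower g (l + 1) * tensorOneHom K N l B := by
  ext i j
  have h' := congrFun (congrFun h (Fin.init i)) (Fin.init j)
  rw [Matrix.mul_apply, Matrix.mul_apply] at h'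
  rw [Matrix.mul_apply, Matrix.mul_apply, sum_tuple_snoc, sum_tuple_snoc]
  simp only [tensorOneHom_apply, tensorOne_apply, metricPower, Matrix.of_apply,
    Fin.prod_univ_castSucc, Fin.snoc_last, Fin.init_snoc, Fin.snoc_castSucc] at h' ⊢
  simp only [ite_mul, mul_ite, zero_mul, mul_zero]
  rw [Finset.sum_eq_single (i (Fin.last l)), Finset.sum_eq_single (j (Fin.last l))]
  · have h'' := congrArg (· * g (i (Fin.last l)) (j (Fin.last l))) h'
    simp only [Finset.sum_mul] at h''
    simp only [if_true]
    refine (Finset.sum_congr rfl fun x _ => ?_).trans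
      (h''.trans (Finset.sum_congr rfl fun x _ => ?_))
    · exact (mul_assoc _ _ _).symm
    · exact mul_right_comm _ _ _
  · intro x _ hx; simp [hx]
  · simp
  · intro x _ hx; simp [hx.symm]
  · simp

theorem oneTensor_mul_metricPower (g : Matrix (Fin N) (Fin N) K) {l : ℕ} {A B : TMat K N l}
    (h : A * metricPower g l = metricPower g l * B) :
    oneTensorHom K N l A * metricPower g (l + 1) =
      metricPower g (l + 1) * oneTensorHom K N l B := by
  ext i j
  have h' := congrFun (congrFun h (Fin.tail i)) (Fin.tail j)
  rw [Matrix.mul_apply, Matrix.mul_apply] at h'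
  rw [Matrix.mul_apply, Matrix.mul_apply, sum_tuple_cons, sum_tuple_cons]
  simp only [oneTensorHom_apply, oneTensor_apply, metricPower, Matrix.of_apply,
    Fin.prod_univ_succ, Fin.cons_zero, Fin.tail_cons, Fin.cons_succ] at h' ⊢
  simp only [ite_mul, mul_ite, zero_mul, mul_zero]
  rw [Finset.sum_eq_single (i 0), Finset.sum_eq_single (j 0)]
  · simp only [if_true, mul_left_comm _ (g _ _), mul_assoc, ← Finset.mul_sum]
    congr 1
  · intro x _ hx; simp [hx]
  · simp
  · intro x _ hx; simp [hx.symm]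
  · simp

theorem atSite_mul_metricPower (g : Matrix (Fin N) (Fin N) K) {A B : Mat2 K N}
    (h : A * (g ⊗ₖ g) = (g ⊗ₖ g) * B) (l m : ℕ) (hm : m + 1 < l) :
    atSite A m hm * metricPower g l = metricPower g l * atSite B m hm := by
  revert l m
  refine site_induction ?_ ?_ ?_
  · ext i j
    have h' := congrFun (congrFun h (i 0, i 1)) (j 0, j 1)
    rw [Matrix.mul_apply, Matrix.mul_apply, Fintype.sum_prod_type, Fintype.sum_prod_type] at h'
    rw [Matrix.mul_apply, Matrix.mul_apply, sum_tuple_two, sum_tuple_two]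
    simpa [atSite_two, metricPower, Matrix.kroneckerMap_apply] using h'
  · intro l m hm ih
    rw [← tensorOne_atSite _ _ hm, ← tensorOne_atSite _ _ hm]
    exact tensorOne_mul_metricPower g ih
  · intro l m hm ih
    rw [← oneTensor_atSite _ _ hm, ← oneTensor_atSite _ _ hm]
    exact oneTensor_mul_metricPower g ih

theorem chainProj_mul_intertwiner (C : Coeffs K) {l : ℕ} {G : TMat K N l}
    {σ e σ' e' : ℕ → TMat K N l} (j : ℕ) (hσ : ∀ i < j, σ i * G = G * σ' i)
    (he : ∀ i < j, e i * G = G * e' i) : chainProj C σ e j * G = G * chainProj C σ' e' j := by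
  induction j with
  | zero => rw [chainProj_zero, chainProj_zero, one_mul, mul_one]
  | succ j ih =>
    have h := ih (fun i hi => hσ i (by omega)) (fun i hi => he i (by omega))
    have hf : C.factor (j + 1) (σ j) (e j) * G = G * C.factor (j + 1) (σ' j) (e' j) := by
      simp only [Coeffs.factor, add_mul, mul_add, smul_mul_assoc, mul_smul_comm, one_mul, mul_one,
        hσ j (by omega), he j (by omega)]
    rw [chainProj_succ, chainProj_succ, mul_assoc, h, ← mul_assoc, mul_assoc _ _ G, hf,
      ← mul_assoc, h, mul_assoc, mul_assoc, mul_assoc]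

/-- Moving $g\otimes\cdots\otimes g$ through a site turns it into the reversal of the mirrored site.
Hence the projector turns into the reversal of the mirrored projector, which is the same projector
by `chainProj_rev`. -/
theorem BMWPair.tensorProj_metric (h : BMWPair k t R E) (hC : C.Generic k t c)
    (g : Matrix (Fin N) (Fin N) K) (hR : R * (g ⊗ₖ g) = (g ⊗ₖ g) * flip R)
    (hE : E * (g ⊗ₖ g) = (g ⊗ₖ g) * flip E) (l : ℕ) :
    MetricCompatible g (tensorProj C R E l) := by
  rw [metricCompatible_iff]
  conv_rhs => rw [← h.chainProj_rev hC]
  have key : ∀ A : Mat2 K N, A * (g ⊗ₖ g) = (g ⊗ₖ g) * flip A → ∀ i < l - 1,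
      site l A i * metricPower g l =
        metricPower g l * reverseHom K N l (site l A (l - 2 - i)) := by
    intro A hA i hi
    rw [site_eq A (by omega : i + 1 < l), site_eq A (by omega : l - 2 - i + 1 < l),
      reverseHom_atSite, atSite_mul_metricPower g hA]
    congr 2
    omega
  rw [chainProj_map (reverseHom K N l) C _ (fun i _ => rfl) (fun i _ => rfl)]
  exact chainProj_mul_intertwiner C _ (key R hR) (key E hE)

end Sites

end QProj

namespace QProj

/-! ### Uniqueness -/

section Idempotents
variable {K : Type*} [Field K] {n : Type*} [Fintype n] [DecidableEq n]

/-- The trace of a projection is its rank. -/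
theorem exists_trace_eq_natCast {P : Matrix n n K} (h : P * P = P) :
    ∃ d : ℕ, P.trace = (d : K) := by
  have hf : IsIdempotentElem (Matrix.toLin' P) := by
    change Matrix.toLin' P ∘ₗ Matrix.toLin' P = Matrix.toLin' P
    rw [← Matrix.toLin'_mul, h]
  exact ⟨_, by rw [← Matrix.trace_toLin'_eq, (LinearMap.IsIdempotentElem.isProj_range _ hf).trace]⟩

theorem eq_zero_of_idem_of_trace [CharZero K] {P : Matrix n n K} (h : P * P = P)
    (ht : P.trace = 0) : P = 0 := by
  have hf : IsIdempotentElem (Matrix.toLin' P) := by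
    change Matrix.toLin' P ∘ₗ Matrix.toLin' P = Matrix.toLin' P
    rw [← Matrix.toLin'_mul, h]
  have := LinearMap.IsIdempotentElem.eq_zero_of_trace_eq_zero hf
    (by rw [Matrix.trace_toLin'_eq, ht])
  simpa using this

/-- The hypotheses make $P-Q$ an idempotent of trace $0$. -/
theorem idem_eq_of_trace_eq [CharZero K] {P Q : Matrix n n K} (hP : P * P = P) (hQ : Q * Q = Q)
    (h1 : P * Q = Q) (h2 : Q * P = Q) (ht : P.trace = Q.trace) : P = Q := by
  refine sub_eq_zero.mp (eq_zero_of_idem_of_trace ?_ ?_)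
  · rw [sub_mul, mul_sub, mul_sub, hP, hQ, h1, h2, sub_self, sub_zero]
  · rw [Matrix.trace_sub, ht, sub_self]

end Idempotents

/-! ### From the defining relations to eigenvalue equations for $\hat R$ and $E$. -/

section Characterization
variable {K : Type*} [Field K] {N : ℕ} {ι : Type*} [Fintype ι] [DecidableEq ι]
  {k t c : K} {R E : Mat2 K N} {C : Coeffs K}

/-- The matrices `p π` have the same linear span as `1`, `R` and `E`, and the value of `p π` at
`R = c`, `E = 0` is `1` if `π = ε` and `0` otherwise. -/
structure SpectralFamily (c : K) (R E : Mat2 K N) (p : ι → Mat2 K N) (ε : ι) : Prop where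
  value : ∀ π, ∃ x y z : K, p π = x • (1 : Mat2 K N) + y • R + z • E ∧
    x + y * c = if π = ε then 1 else 0
  expand_R : ∃ r : ι → K, R = ∑ π, r π • p π ∧ r ε = c
  expand_E : ∃ r : ι → K, E = ∑ π, r π • p π ∧ r ε = 0

theorem atSite_sum {ι : Type*} [Fintype ι] {l : ℕ} (f : ι → Mat2 K N) (m : ℕ) (h : m + 1 < l) :
    atSite (∑ π, f π) m h = ∑ π, atSite (f π) m h := by
  let φ : Mat2 K N →+ TMat K N l :=
    { toFun := fun A => atSite A m h
      map_zero' := atSite_zero m h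
      map_add' := fun A B => atSite_add A B m h }
  exact map_sum φ f Finset.univ

theorem BMWPair.isCompleteProjector (h : BMWPair k t R E) (hC : C.Generic k t c)
    {p : ι → Mat2 K N} {ε : ι} (hp : SpectralFamily c R E p ε) {d l : ℕ}
    (hd : (tensorProj C R E l).trace = (d : K)) :
    IsCompleteProjector p ε d l (tensorProj C R E l) where
  mul_right π m hm := by
    obtain ⟨x, y, z, hπ, hv⟩ := hp.value π
    rw [hπ, atSite_add, atSite_add, atSite_smul, atSite_smul, atSite_smul, atSite_one,
      ← site_eq R hm, ← site_eq E hm, mul_add, mul_add, mul_smul_comm, mul_smul_comm,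
      mul_smul_comm, h.tensorProj_mul_R hC hm, h.tensorProj_mul_E hC hm, mul_one, smul_zero,
      add_zero, smul_smul, ← add_smul, hv]
    split_ifs <;> simp
  mul_left π m hm := by
    obtain ⟨x, y, z, hπ, hv⟩ := hp.value π
    rw [hπ, atSite_add, atSite_add, atSite_smul, atSite_smul, atSite_smul, atSite_one,
      ← site_eq R hm, ← site_eq E hm, add_mul, add_mul, smul_mul_assoc, smul_mul_assoc,
      smul_mul_assoc, h.R_mul_tensorProj hC hm, h.E_mul_tensorProj hC hm, one_mul, smul_zero,
      add_zero, smul_smul, ← add_smul, hv]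
    split_ifs <;> simp
  idem := by rw [pow_two, h.tensorProj_idem hC]
  trace := hd

/-- Expanding $\hat R$ and $E$ in the `p π`, the defining relations force the eigenvalues $c$ and
$0$ on both sides of `P`. So `P` is absorbed by the constructed projector from both sides, and
equality of traces does the rest. -/
theorem BMWPair.eq_tensorProj [CharZero K] (h : BMWPair k t R E) (hC : C.Generic k t c)
    {p : ι → Mat2 K N} {ε : ι} (hp : SpectralFamily c R E p ε) {d l : ℕ}
    (hd : (tensorProj C R E l).trace = (d : K)) {P : TMat K N l}
    (hP : IsCompleteProjector p ε d l P) : P = tensorProj C R E l := by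
  have left : ∀ (A : Mat2 K N) (r : ι → K), A = ∑ π, r π • p π → ∀ m, m + 1 < l →
      site l A m * P = r ε • P := by
    intro A r hA m hm
    rw [site_eq A hm, hA, atSite_sum, Finset.sum_mul]
    simp only [atSite_smul, smul_mul_assoc, hP.mul_left, smul_ite, smul_zero, Finset.sum_ite_eq',
      Finset.mem_univ, if_true]
  have right : ∀ (A : Mat2 K N) (r : ι → K), A = ∑ π, r π • p π → ∀ m, m + 1 < l →
      P * site l A m = r ε • P := by
    intro A r hA m hm
    rw [site_eq A hm, hA, atSite_sum, Finset.mul_sum]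
    simp only [atSite_smul, mul_smul_comm, hP.mul_right, smul_ite, smul_zero, Finset.sum_ite_eq',
      Finset.mem_univ, if_true]
  obtain ⟨r, hr, hrc⟩ := hp.expand_R
  obtain ⟨r', hr', hrc'⟩ := hp.expand_E
  have h1 : tensorProj C R E l * P = P :=
    tensorProj_mul hC (fun m hm => by rw [left R r hr m hm, hrc])
      (fun m hm => by rw [left E r' hr' m hm, hrc', zero_smul])
  have h2 : P * tensorProj C R E l = P :=
    h.mul_tensorProj hC (fun m hm => by rw [right R r hr m hm, hrc])
      (fun m hm => by rw [right E r' hr' m hm, hrc', zero_smul])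
  exact (idem_eq_of_trace_eq (h.tensorProj_idem hC l) (by rw [← pow_two, hP.idem]) h1 h2
    (by rw [hd, hP.trace])).symm

end Characterization

/-! ### Partial traces -/

section PartialTrace
variable {K : Type*} [Field K] {N : ℕ}

/-- Take the trace over the last tensor factor first: there `P ⊗ 1` is the identity and `M`
contributes only its partial trace, the scalar `κ`. -/
theorem trace_tensorOne_mul_atSite {l : ℕ} (P : TMat K N (l + 1)) (M : Mat2 K N) (κ : K)
    (hM : ∀ a b, ∑ x, M (a, x) (b, x) = if a = b then κ else 0) :
    (tensorOne P * atSite M l (by omega : l + 1 < l + 1 + 1)).trace = κ * P.trace := by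
  have entry : ∀ i j : Fin (l + 1) → Fin N,
      ∑ x : Fin N, atSite M l (by omega : l + 1 < l + 1 + 1) (Fin.snoc j x) (Fin.snoc i x) =
        if j = i then κ else 0 := by
    intro i j
    have hcond : ∀ x : Fin N, (∀ r : Fin (l + 1 + 1), (r : ℕ) ≠ l → (r : ℕ) ≠ l + 1 →
        (Fin.snoc j x : Fin (l + 1 + 1) → Fin N) r = (Fin.snoc i x : Fin (l + 1 + 1) → Fin N) r) ↔
        Fin.init j = Fin.init i := by
      intro x
      rw [funext_iff, Fin.forall_fin_succ', Fin.forall_fin_succ']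
      simp only [Fin.val_last, Fin.val_castSucc, Fin.snoc_castSucc, Fin.init]
      constructor
      · rintro ⟨⟨h, -⟩, -⟩ r
        exact h r (by omega) (by omega)
      · intro h
        exact ⟨⟨fun r _ _ => h r, fun h => absurd rfl h⟩, fun _ h => absurd rfl h⟩
    have e1 : ∀ (f : Fin (l + 1) → Fin N) (x : Fin N),
        (Fin.snoc f x : Fin (l + 1 + 1) → Fin N) ⟨l, by omega⟩ = f (Fin.last l) :=
      fun f x => Fin.snoc_castSucc (α := fun _ => Fin N) x f (Fin.last l)
    have e2 : ∀ (f : Fin (l + 1) → Fin N) (x : Fin N),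
        (Fin.snoc f x : Fin (l + 1 + 1) → Fin N) ⟨l + 1, by omega⟩ = x :=
      fun f x => Fin.snoc_last (α := fun _ => Fin N) x f
    simp only [atSite_apply, hcond, e1, e2, init_eq_iff j i]
    by_cases h : Fin.init j = Fin.init i
    · simp only [h, if_true, true_and, hM]
    · simp [h]
  change ∑ i, (tensorOne P * atSite M l (by omega : l + 1 < l + 1 + 1) :
    TMat K N (l + 1 + 1)) i i = κ * ∑ i, P i i
  rw [sum_tuple_snoc, Finset.sum_comm, Finset.mul_sum]
  refine Finset.sum_congr rfl fun i _ => ?_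
  have hx : ∀ x : Fin N, (tensorOne P * atSite M l (by omega : l + 1 < l + 1 + 1) :
      TMat K N (l + 1 + 1)) (Fin.snoc i x) (Fin.snoc i x) = ∑ j : Fin (l + 1) → Fin N, P i j *
        atSite M l (by omega : l + 1 < l + 1 + 1) (Fin.snoc j x) (Fin.snoc i x) := by
    intro x
    rw [Matrix.mul_apply, sum_tuple_snoc]
    simp only [tensorOne_apply, Fin.snoc_last, Fin.init_snoc, ite_mul, zero_mul,
      Finset.sum_ite_irrel, Finset.sum_const_zero, Finset.sum_ite_eq, Finset.mem_univ, if_true]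
  simp only [hx]
  rw [Finset.sum_comm]
  simp only [← Finset.mul_sum, entry, mul_ite, mul_zero, Finset.sum_ite_eq', Finset.mem_univ,
    if_true, mul_comm]

/-- Cyclicity of the trace brings the two outer projectors together and idempotence leaves one of
them. The hypothesis on partial traces is met at $q=1$; in general the ordinary partial trace of a
braid matrix is not scalar. -/
theorem trace_tensorProj_succ {C : Coeffs K} {R E : Mat2 K N} {l : ℕ} (hl : 1 ≤ l)
    (hidem : tensorProj C R E l * tensorProj C R E l = tensorProj C R E l) (κ : K)
    (hM : ∀ a b, ∑ x, C.factor l R E (a, x) (b, x) = if a = b then κ else 0) :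
    (tensorProj C R E (l + 1)).trace = κ * (tensorProj C R E l).trace := by
  rw [tensorProj_succ C R E hl, Matrix.trace_mul_comm, ← mul_assoc]
  have h1 : tensorOne (tensorProj C R E l) * tensorOne (tensorProj C R E l) =
      tensorOne (tensorProj C R E l) := by
    rw [← tensorOneHom_apply, ← map_mul, hidem]
  rw [h1]
  obtain ⟨m, rfl⟩ : ∃ m, l = m + 1 := ⟨l - 1, by omega⟩
  exact trace_tensorOne_mul_atSite _ _ κ hM

end PartialTrace

/-! ### Specialization -/

section Specialization

/-- A subring of a product of fields is the graph of a partial function which is defined at `x⁻¹`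
whenever it is defined at `x` and nonzero there. -/
structure IsSpecialization {F K : Type*} [Field F] [Field K] (S : Subring (F × K)) : Prop where
  zero : ∀ v : K, (0, v) ∈ S → v = 0
  inv : ∀ (x : F) (v : K), (x, v) ∈ S → v ≠ 0 → (x⁻¹, v⁻¹) ∈ S

variable {F K : Type*} [Field F] [Field K] {S : Subring (F × K)}

theorem IsSpecialization.eq (hS : IsSpecialization S) {x : F} {v w : K} (h1 : (x, v) ∈ S)
    (h2 : (x, w) ∈ S) : v = w := by
  have := S.sub_mem h1 h2
  rw [Prod.mk_sub_mk, sub_self] at this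
  exact sub_eq_zero.mp (hS.zero _ this)

theorem IsSpecialization.div (hS : IsSpecialization S) {x y : F} {v w : K} (h1 : (x, v) ∈ S)
    (h2 : (y, w) ∈ S) (hw : w ≠ 0) : (x / y, v / w) ∈ S := by
  rw [div_eq_mul_inv, div_eq_mul_inv]
  exact S.mul_mem h1 (hS.inv _ _ h2 hw)

theorem IsSpecialization.zpow (hS : IsSpecialization S) {x : F} {v : K} (h : (x, v) ∈ S)
    (hv : v ≠ 0) (n : ℤ) : (x ^ n, v ^ n) ∈ S := by
  cases n with
  | ofNat n =>
    simp only [Int.ofNat_eq_natCast, zpow_natCast]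
    exact S.pow_mem h n
  | negSucc n =>
    simp only [zpow_negSucc]
    exact hS.inv _ _ (S.pow_mem h _) (pow_ne_zero _ hv)

/-- The matrix `B` is the specialization of the matrix `A`. -/
def SpecMat {n : Type*} (S : Subring (F × K)) (A : Matrix n n F) (B : Matrix n n K) : Prop :=
  ∀ i j, (A i j, B i j) ∈ S

variable {n : Type*}

theorem SpecMat.add {A A' : Matrix n n F} {B B' : Matrix n n K} (h : SpecMat S A B)
    (h' : SpecMat S A' B') : SpecMat S (A + A') (B + B') :=
  fun i j => S.add_mem (h i j) (h' i j)

theorem SpecMat.smul {A : Matrix n n F} {B : Matrix n n K} (h : SpecMat S A B) {x : F} {v : K}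
    (hx : (x, v) ∈ S) : SpecMat S (x • A) (v • B) :=
  fun i j => S.mul_mem hx (h i j)

theorem specMat_zero : SpecMat S (0 : Matrix n n F) (0 : Matrix n n K) :=
  fun _ _ => S.zero_mem

theorem SpecMat.one [DecidableEq n] : SpecMat S (1 : Matrix n n F) (1 : Matrix n n K) := by
  intro i j
  simp only [Matrix.one_apply]
  split_ifs
  · exact S.one_mem
  · exact S.zero_mem

theorem spec_sum {ι : Type*} (s : Finset ι) {f : ι → F} {g : ι → K}
    (h : ∀ i ∈ s, (f i, g i) ∈ S) : (∑ i ∈ s, f i, ∑ i ∈ s, g i) ∈ S := by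
  have := S.sum_mem h
  rwa [show ∑ i ∈ s, (f i, g i) = (∑ i ∈ s, f i, ∑ i ∈ s, g i) from
    Prod.ext (by rw [Prod.fst_sum]) (by rw [Prod.snd_sum])] at this

theorem SpecMat.mul [Fintype n] {A A' : Matrix n n F} {B B' : Matrix n n K} (h : SpecMat S A B)
    (h' : SpecMat S A' B') : SpecMat S (A * A') (B * B') :=
  fun i j => spec_sum _ fun x _ => S.mul_mem (h i x) (h' x j)

theorem SpecMat.trace [Fintype n] {A : Matrix n n F} {B : Matrix n n K} (h : SpecMat S A B) :
    (A.trace, B.trace) ∈ S :=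
  spec_sum _ fun x _ => h x x

theorem SpecMat.eq (hS : IsSpecialization S) {A : Matrix n n F} {B B' : Matrix n n K}
    (h : SpecMat S A B) (h' : SpecMat S A B') : B = B' := by
  ext i j
  exact hS.eq (h i j) (h' i j)

variable {N : ℕ}

theorem SpecMat.site {A : Mat2 F N} {B : Mat2 K N} (h : SpecMat S A B) (l m : ℕ) :
    SpecMat S (site l A m) (site l B m) := by
  unfold QProj.site
  split_ifs with hm
  · intro i j
    rw [atSite_apply, atSite_apply]
    split_ifs
    · exact h _ _
    · exact S.zero_mem
  · exact specMat_zero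

/-- Specialization of coefficients. -/
def SpecCoeffs (S : Subring (F × K)) (C : Coeffs F) (C' : Coeffs K) : Prop :=
  ∀ l, 1 ≤ l → (C.α l, C'.α l) ∈ S ∧ (C.β l, C'.β l) ∈ S ∧ (C.γ l, C'.γ l) ∈ S

theorem SpecMat.tensorProj {C : Coeffs F} {C' : Coeffs K} (hC : SpecCoeffs S C C')
    {R E : Mat2 F N} {R' E' : Mat2 K N} (hR : SpecMat S R R') (hE : SpecMat S E E') (l : ℕ) :
    SpecMat S (tensorProj C R E l) (tensorProj C' R' E' l) := by
  have key : ∀ j, SpecMat S (chainProj C (QProj.site l R) (QProj.site l E) j)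
      (chainProj C' (QProj.site l R') (QProj.site l E') j) := by
    intro j
    induction j with
    | zero => exact SpecMat.one
    | succ j ih =>
      -- The recursion uses only coefficients with index at least $1$, so a vanishing denominator at
      -- index $0$ is harmless.
      obtain ⟨h1, h2, h3⟩ := hC (j + 1) (by omega)
      exact (ih.mul (((SpecMat.one.smul h1).add ((hR.site l j).smul h2)).add
        ((hE.site l j).smul h3))).mul ih
  exact key _

/-- The trace of an idempotent matrix does not change under specialization. -/
theorem SpecMat.trace_eq [Fintype n] [DecidableEq n] (hS : IsSpecialization S) {A : Matrix n n F}
    {B : Matrix n n K} (h : SpecMat S A B) {d : ℕ} (hd : A.trace = (d : F)) :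
    B.trace = (d : K) := by
  have h1 := h.trace
  rw [hd] at h1
  exact hS.eq h1 (natCast_mem S d)

open Polynomial in
/-- Pairs of a rational function defined at `a` and its value at `a`. -/
def evalRing (a : K) : Subring (FractionRing K[X] × K) where
  carrier := {z | ∃ p d : K[X], d.eval a ≠ 0 ∧
    z.1 * algebraMap K[X] (FractionRing K[X]) d = algebraMap K[X] (FractionRing K[X]) p ∧
    z.2 * d.eval a = p.eval a}
  mul_mem' := by
    rintro ⟨x, v⟩ ⟨y, w⟩ ⟨p, d, h1, h2, h3⟩ ⟨p', d', h1', h2', h3'⟩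
    refine ⟨p * p', d * d', ?_, ?_, ?_⟩
    · rw [eval_mul]; exact mul_ne_zero h1 h1'
    · simp only [Prod.fst_mul, map_mul] at *; rw [← h2, ← h2']; ring
    · simp only [Prod.snd_mul, eval_mul] at *; rw [← h3, ← h3']; ring
  one_mem' := ⟨1, 1, by simp, by simp, by simp⟩
  add_mem' := by
    rintro ⟨x, v⟩ ⟨y, w⟩ ⟨p, d, h1, h2, h3⟩ ⟨p', d', h1', h2', h3'⟩
    refine ⟨p * d' + p' * d, d * d', ?_, ?_, ?_⟩
    · rw [eval_mul]; exact mul_ne_zero h1 h1'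
    · simp only [Prod.fst_add, map_mul, map_add] at *; rw [← h2, ← h2']; ring
    · simp only [Prod.snd_add, eval_mul, eval_add] at *; rw [← h3, ← h3']; ring
  zero_mem' := ⟨0, 1, by simp, by simp, by simp⟩
  neg_mem' := by
    rintro ⟨x, v⟩ ⟨p, d, h1, h2, h3⟩
    refine ⟨-p, d, h1, ?_, ?_⟩
    · simp only [Prod.fst_neg, map_neg] at *; rw [← h2]; ring
    · simp only [Prod.snd_neg, eval_neg] at *; rw [← h3]; ring

open Polynomial in
-- Since the denominators do not vanish at `a`, the value is determined by the function; if the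
-- value is nonzero, numerator and denominator may be exchanged.
theorem evalRing_isSpecialization (a : K) : IsSpecialization (evalRing a) where
  zero := by
    rintro v ⟨p, d, h1, h2, h3⟩
    simp only [zero_mul] at h2 h3
    have hp : p = 0 := by
      apply IsFractionRing.injective K[X] (FractionRing K[X])
      rw [← h2, map_zero]
    rw [hp, eval_zero] at h3
    exact (mul_eq_zero.mp h3).resolve_right h1
  inv := by
    rintro x v ⟨p, d, h1, h2, h3⟩ hv
    simp only at h2 h3
    have hp : p.eval a ≠ 0 := by rw [← h3]; exact mul_ne_zero hv h1
    have hp0 : algebraMap K[X] (FractionRing K[X]) p ≠ 0 := by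
      intro h
      have : p = 0 := by
        apply IsFractionRing.injective K[X] (FractionRing K[X])
        rw [h, map_zero]
      rw [this, eval_zero] at hp
      exact hp rfl
    have hx : x ≠ 0 := by
      rintro rfl
      rw [zero_mul] at h2
      exact hp0 h2.symm
    refine ⟨d, p, hp, ?_, ?_⟩
    · simp only; rw [← h2]; field_simp
    · simp only; rw [← h3]; field_simp

open Polynomial in
/-- The variable of the field of rational functions. -/
noncomputable def fracX (K : Type*) [Field K] : FractionRing K[X] :=
  algebraMap K[X] (FractionRing K[X]) X

open Polynomial in
theorem fracX_mem (a : K) : (fracX K, a) ∈ evalRing a :=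
  ⟨X, 1, by simp, by simp [fracX], by simp⟩

open Polynomial in
theorem fracX_pow_ne_one {n : ℕ} (hn : 0 < n) : fracX K ^ n ≠ 1 := by
  rw [fracX, ← map_pow, ← map_one (algebraMap K[X] (FractionRing K[X]))]
  intro h
  have := IsFractionRing.injective K[X] (FractionRing K[X]) h
  have h2 := congrArg natDegree this
  simp at h2
  omega

open Polynomial in
theorem fracX_ne_zero : fracX K ≠ 0 := by
  intro h
  rw [fracX, ← map_zero (algebraMap K[X] (FractionRing K[X]))] at h
  exact X_ne_zero (IsFractionRing.injective K[X] (FractionRing K[X]) h)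

end Specialization

end QProj

namespace QProj

/-! ### Coefficients of the recursion -/

section Coefficients
variable {K : Type*} [Field K]

/-- Both signs are treated together: $e=\pm1$ and $u=q^{\pm1}$, so that $k=e(u-u^{-1})$, $c=eu$, and
$q$-numbers may be computed from $u$. The identities reduce to $n_{l+1}=u\,n_l+u^{-l}$ and
$d_{a+1}+u(u^2-1)=u^2d_a$. -/
theorem qnum_good {u e t : K} (he : e = 1 ∨ e = -1) (hu : u ≠ 0) (ht : t ≠ 0) (hu2 : u ^ 2 - 1 ≠ 0)
    {n d α β γ : ℕ → K} (hn : ∀ l, n l = (u ^ l - (u ^ l)⁻¹) / (u - u⁻¹))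
    (hd : ∀ l, d l = u - e * (t⁻¹ * (u ^ l) ^ 2)) (hn0 : ∀ l, 1 ≤ l → n l ≠ 0)
    (hd0 : ∀ l, 1 ≤ l → d l ≠ 0) (hα : ∀ l, α l = (n (l + 1))⁻¹ * (u ^ l)⁻¹)
    (hβ : ∀ l, β l = (n (l + 1))⁻¹ * (e * n l))
    (hγ : ∀ l, γ l = (n (l + 1))⁻¹ * ((u ^ 2 - 1) * n l / d l)) :
    Coeffs.Good ⟨α, β, γ⟩ (e * (u - u⁻¹)) t (e * u) := by
  have he2 : e * e = 1 := by rcases he with rfl | rfl <;> ring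
  have hk : u - u⁻¹ ≠ 0 := by
    intro h
    apply hu2
    field_simp at h
    rw [h, mul_zero]
  have hn00 : n 0 = 0 := by rw [hn]; simp
  have hn01 : n 1 = 1 := by rw [hn, pow_one, div_self hk]
  have hstep : ∀ l, n (l + 1) = u * n l + (u ^ l)⁻¹ := by
    intro l
    have h3 : u ^ l ≠ 0 := pow_ne_zero l hu
    rw [hn, hn, pow_succ]
    generalize u ^ l = U at *
    field_simp
    ring
  have hkn : ∀ l, (u - u⁻¹) * n l = u ^ l - (u ^ l)⁻¹ := by
    intro l
    rw [hn, mul_div_cancel₀ _ hk]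
  refine ⟨fun l => ?_, fun a => ?_, fun a => ?_, fun a => ?_, ?_, ?_⟩ <;> simp only
  · have h1 := hn0 (l + 1) (by omega)
    rw [hα, hβ]
    calc _ = (n (l + 1))⁻¹ * (u * n l + (u ^ l)⁻¹) := by
          linear_combination (n (l + 1))⁻¹ * u * n l * he2
      _ = 1 := by rw [← hstep, inv_mul_cancel₀ h1]
  · have h1 := hn0 (a + 1) (by omega)
    have h2 := hn0 (a + 1 + 1) (by omega)
    rw [hα, hα, hβ, pow_succ]
    field_simp
  -- Index $0$ is separate because `d 0` may vanish (it does for the sign $+$ and $N=2$); both sides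
  -- are zero there since `n 0 = 0`.
  · rcases Nat.eq_zero_or_pos a with rfl | ha
    · rw [hγ 0, hβ 0, hn00]
      simp
    · have h0 := hn0 a ha
      have h1 := hn0 (a + 1) (by omega)
      have h2 := hn0 (a + 1 + 1) (by omega)
      have g0 := hd0 a ha
      have g1 := hd0 (a + 1) (by omega)
      rw [hγ a, hγ (a + 1), hβ, hβ]
      have hdd := hd a
      have hdd' := hd (a + 1)
      rw [pow_succ u a] at hdd'
      generalize d a = d0 at *
      generalize d (a + 1) = d1 at *
      field_simp
      have : d1 + u * (u ^ 2 - 1) = u ^ 2 * d0 := by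
        rw [hdd, hdd']
        ring
      linear_combination e * this - e * u ^ 2 * d0 * he2
  · have h1 := hn0 (a + 1) (by omega)
    have h2 := hn0 (a + 1 + 1) (by omega)
    have g1 := hd0 (a + 1) (by omega)
    have h3 : u ^ a ≠ 0 := pow_ne_zero a hu
    rw [hγ (a + 1), hβ, hβ, hα]
    have hdd' := hd (a + 1)
    have hkna := hkn a
    rw [pow_succ u a] at hdd'
    generalize d (a + 1) = d1 at *
    generalize n a = n0 at *
    generalize u ^ a = U at *
    have hn0' : n0 = (U - U⁻¹) / (u - u⁻¹) := by
      rw [← hkna, mul_div_cancel_left₀ _ hk]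
    rw [hn0']
    field_simp
    rw [hdd']
    field_simp
    rcases he with rfl | rfl <;> ring
  · rw [hα, zero_add, hn01]; simp
  · rw [hβ, hn00]; simp

/-- The coefficients of `1`, `R` and `Q_N P^t` in the matrices `M^{±,l+1}`. -/
def recCoeffs (N : ℕ) (q : K) (ε : PM) : Coeffs K where
  α l := (qnum q (l + 1))⁻¹ * q ^ (-(ε.sgn * l))
  β l := (qnum q (l + 1))⁻¹ * ((ε.sgn : K) * qnum q l)
  γ l := (qnum q (l + 1))⁻¹ * ((q ^ (2 * ε.sgn) - 1) * qnum q l /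
    (q ^ ε.sgn - (ε.sgn : K) * q ^ ((N : ℤ) - 1 + 2 * ε.sgn * l)))

/-- The eigenvalue of the braid matrix on (anti)symmetric tensors. -/
def eigenvalue (q : K) (ε : PM) : K := (ε.sgn : K) * q ^ ε.sgn

theorem sgn_cases (ε : PM) : (ε.sgn : K) = 1 ∨ (ε.sgn : K) = -1 := by
  cases ε <;> simp [PM.sgn]

theorem qnum_eq {q : K} (ε : PM) (l : ℕ) :
    qnum q l = ((q ^ ε.sgn) ^ l - ((q ^ ε.sgn) ^ l)⁻¹) / (q ^ ε.sgn - (q ^ ε.sgn)⁻¹) := by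
  cases ε
  · simp [qnum, PM.sgn]
  · simp only [qnum, PM.sgn, zpow_neg, zpow_one, zpow_natCast, inv_pow, inv_inv]
    rw [← neg_sub (q ^ l), ← neg_sub q, neg_div_neg_eq]

theorem zpow_ne_one_of_generic {q : K} (hq : ∀ n : ℕ, 0 < n → q ^ n ≠ 1) {n : ℤ} (hn : n ≠ 0) :
    q ^ n ≠ 1 := by
  rcases Int.lt_or_gt_of_ne hn with h | h
  · intro h1
    refine hq (-n).toNat (by omega) ?_
    rw [← zpow_natCast, Int.toNat_of_nonneg (by omega), zpow_neg, h1, inv_one]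
  · intro h1
    refine hq n.toNat (by omega) ?_
    rw [← zpow_natCast, Int.toNat_of_nonneg (by omega), h1]

theorem zpow_ne_neg_one_of_generic [CharZero K] {q : K} (hq : ∀ n : ℕ, 0 < n → q ^ n ≠ 1)
    (n : ℤ) : q ^ n ≠ -1 := by
  intro h
  rcases eq_or_ne n 0 with rfl | hn
  · rw [zpow_zero] at h
    norm_num at h
  · refine zpow_ne_one_of_generic hq (n := 2 * n) (by omega) ?_
    rw [mul_comm, zpow_mul, h]
    norm_num

theorem sub_inv_ne_zero_of_generic {q : K} (hq0 : q ≠ 0) (hq : ∀ n : ℕ, 0 < n → q ^ n ≠ 1) :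
    q - q⁻¹ ≠ 0 := by
  intro h
  refine hq 2 (by omega) ?_
  rw [pow_two]
  nth_rw 2 [sub_eq_zero.mp h]
  exact mul_inv_cancel₀ hq0

theorem add_inv_ne_zero_of_generic [CharZero K] {q : K} (hq0 : q ≠ 0)
    (hq : ∀ n : ℕ, 0 < n → q ^ n ≠ 1) : q + q⁻¹ ≠ 0 := by
  intro h
  refine zpow_ne_neg_one_of_generic hq 2 ?_
  field_simp at h
  rw [zpow_ofNat]
  linear_combination h

theorem qnum_ne_zero_of_generic {q : K} (hq0 : q ≠ 0) (hq : ∀ n : ℕ, 0 < n → q ^ n ≠ 1)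
    {l : ℕ} (hl : 1 ≤ l) : qnum q l ≠ 0 := by
  refine div_ne_zero ?_ (sub_inv_ne_zero_of_generic hq0 hq)
  intro h
  refine zpow_ne_one_of_generic hq (n := 2 * l) (by omega) ?_
  rw [two_mul, zpow_add₀ hq0]
  nth_rw 2 [sub_eq_zero.mp h]
  rw [← zpow_add₀ hq0, add_neg_cancel, zpow_zero]

/-- A zero would mean $q^{N-2+2l}=1$ for the sign $+$, with positive exponent, and that a power of
$q$ equals $-1$ for the sign $-$; neither is possible when $q$ is not a root of unity. -/
theorem denominator_ne_zero [CharZero K] {q : K} (hq0 : q ≠ 0) (hq : ∀ n : ℕ, 0 < n → q ^ n ≠ 1)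
    {N : ℕ} (hN : 0 < N) (ε : PM) {l : ℕ} (hl : 1 ≤ l) :
    q ^ ε.sgn - (ε.sgn : K) * q ^ ((N : ℤ) - 1 + 2 * ε.sgn * l) ≠ 0 := by
  intro h
  have h1 : q ^ ε.sgn ≠ 0 := zpow_ne_zero _ hq0
  have h2 : (ε.sgn : K) * q ^ ((N : ℤ) - 1 + 2 * ε.sgn * l - ε.sgn) = 1 := by
    rw [zpow_sub₀ hq0, ← mul_div_assoc, div_eq_one_iff_eq h1]
    exact (sub_eq_zero.mp h).symm
  cases ε
  · simp only [PM.sgn, Int.cast_one, one_mul] at h2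
    exact zpow_ne_one_of_generic hq (by omega) h2
  · simp only [PM.sgn, Int.cast_neg, Int.cast_one, neg_mul, one_mul] at h2
    exact zpow_ne_neg_one_of_generic hq _ (by rw [← h2, neg_neg])

theorem recCoeffs_generic [CharZero K] {q : K} (hq0 : q ≠ 0) (hq : ∀ n : ℕ, 0 < n → q ^ n ≠ 1)
    {N : ℕ} (hN : 0 < N) (ε : PM) :
    (recCoeffs N q ε).Generic (q - q⁻¹) (q ^ (1 - (N : ℤ))) (eigenvalue q ε) := by
  have hu : q ^ ε.sgn ≠ 0 := zpow_ne_zero _ hq0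
  have ht : q ^ (1 - (N : ℤ)) ≠ 0 := zpow_ne_zero _ hq0
  have hu2 : (q ^ ε.sgn) ^ 2 - 1 ≠ 0 := by
    rw [sub_ne_zero, ← zpow_natCast, ← zpow_mul]
    exact zpow_ne_one_of_generic hq (by cases ε <;> decide)
  have hk : q - q⁻¹ = (ε.sgn : K) * (q ^ ε.sgn - (q ^ ε.sgn)⁻¹) := by
    cases ε <;> simp [PM.sgn]
  have hgood : (recCoeffs N q ε).Good (q - q⁻¹) (q ^ (1 - (N : ℤ))) (eigenvalue q ε) := by
    rw [hk]
    refine qnum_good (n := fun l => qnum q l)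
      (d := fun l => q ^ ε.sgn - (ε.sgn : K) * q ^ ((N : ℤ) - 1 + 2 * ε.sgn * l))
      (sgn_cases ε) hu ht hu2 (qnum_eq ε) ?_ (fun l hl => qnum_ne_zero_of_generic hq0 hq hl)
      (fun l hl => denominator_ne_zero hq0 hq hN ε hl) ?_ ?_ ?_
    · intro l
      rw [← zpow_neg, ← pow_mul, ← zpow_natCast, ← zpow_mul, ← zpow_add₀ hq0]
      congr 3
      push_cast
      ring
    · intro l
      simp only [Nat.cast_add, Nat.cast_one]
      rw [zpow_neg, zpow_mul, zpow_natCast]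
    · intro l
      simp only [Nat.cast_add, Nat.cast_one]
    · intro l
      simp only [Nat.cast_add, Nat.cast_one]
      rw [mul_comm (2 : ℤ) ε.sgn, zpow_mul q ε.sgn 2, zpow_ofNat]
  refine ⟨hgood, sub_inv_ne_zero_of_generic hq0 hq, ht, ?_, ?_⟩
  · refine mul_ne_zero ?_ hu
    rcases sgn_cases (K := K) ε with h | h <;> rw [h] <;> norm_num
  · cases ε
    · simp only [eigenvalue, PM.sgn]
      field_simp
      simp only [Int.cast_one, one_pow]
      ring
    · simp only [eigenvalue, PM.sgn]
      simp only [Int.cast_neg, Int.cast_one, zpow_neg, zpow_one]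
      field_simp
      ring

end Coefficients

end QProj

namespace QProj

/-! ### Traces of the projectors -/

section Traces
variable {F K : Type*} [Field F] [Field K] {S : Subring (F × K)}

/-- The coefficients of the recursion at `q = 1`. -/
def classicalCoeffs (K : Type*) [Field K] (N : ℕ) (ε : PM) : Coeffs K where
  α l := ((l : K) + 1)⁻¹ * 1
  β l := ((l : K) + 1)⁻¹ * ((ε.sgn : K) * l)
  γ l := ((l : K) + 1)⁻¹ * match ε with
    | .plus => -(2 * l) / ((N : K) - 2 + 2 * l)
    | .minus => 0

theorem spec_intCast (n : ℤ) : ((n : F), (n : K)) ∈ S := intCast_mem S n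

theorem spec_one : ((1 : F), (1 : K)) ∈ S := S.one_mem

theorem IsSpecialization.spec_recCoeffs [CharZero F] [CharZero K] (hS : IsSpecialization S) {N : ℕ}
    (hN : 0 < N) (ε : PM) {q : F} {v : K} (h : (q, v) ∈ S) (hv0 : v ≠ 0)
    (hv : ∀ n : ℕ, 0 < n → v ^ n ≠ 1) :
    SpecCoeffs S (recCoeffs N q ε) (recCoeffs N v ε) := by
  have hnum : ∀ l : ℤ, (qnum q l, qnum v l) ∈ S := fun l =>
    hS.div (S.sub_mem (hS.zpow h hv0 _) (hS.zpow h hv0 _)) (S.sub_mem h (hS.inv _ _ h hv0))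
      (sub_inv_ne_zero_of_generic hv0 hv)
  intro l hl
  have hinv : ((qnum q (l + 1))⁻¹, (qnum v (l + 1))⁻¹) ∈ S :=
    hS.inv _ _ (hnum _) (by
      have := qnum_ne_zero_of_generic hv0 hv (l := l + 1) (by omega)
      rwa [Nat.cast_add, Nat.cast_one] at this)
  refine ⟨S.mul_mem hinv (hS.zpow h hv0 _), S.mul_mem hinv (S.mul_mem (spec_intCast _) (hnum _)),
    S.mul_mem hinv (hS.div (S.mul_mem (S.sub_mem (hS.zpow h hv0 _) spec_one) (hnum _)) ?_
      (denominator_ne_zero hv0 hv hN ε hl))⟩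
  exact S.sub_mem (hS.zpow h hv0 _) (S.mul_mem (spec_intCast _) (hS.zpow h hv0 _))

/-- The value at $q=1$ cannot be taken term by term, since the $q$-numbers, and $\gamma$ for the
sign $+$, are quotients of the form $0/0$; the common factor has to be cancelled first. -/
theorem IsSpecialization.spec_classicalCoeffs [CharZero K] (hS : IsSpecialization S)
    {N : ℕ} (hN : 0 < N) (ε : PM) {q : F} (hq0 : q ≠ 0) (hq : ∀ n : ℕ, 0 < n → q ^ n ≠ 1)
    (h : (q, (1 : K)) ∈ S) : SpecCoeffs S (recCoeffs N q ε) (classicalCoeffs K N ε) := by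
  have hz : ∀ n : ℤ, (q ^ n, (1 : K)) ∈ S := fun n => by
    have := hS.zpow h one_ne_zero n
    rwa [one_zpow] at this
  have hk := sub_inv_ne_zero_of_generic hq0 hq
  -- This recursion has no denominator, so it shows by induction that $[l]_q$ is defined at $q=1$
  -- with value $l$.
  have hstep : ∀ l : ℕ, qnum q (l + 1) = q * qnum q l + q ^ (-(l : ℤ)) := by
    intro l
    simp only [qnum, neg_add, zpow_add₀ hq0, zpow_neg, zpow_natCast, zpow_one]
    have : q ^ l ≠ 0 := pow_ne_zero l hq0
    have hq2 : q ^ 2 - 1 ≠ 0 := sub_ne_zero.mpr (hq 2 two_pos)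
    field_simp
    ring
  have hnum : ∀ l : ℕ, (qnum q l, (l : K)) ∈ S := by
    intro l
    induction l with
    | zero =>
      have h0 : qnum q ((0 : ℕ) : ℤ) = 0 := by simp [qnum]
      rw [h0, Nat.cast_zero]
      exact S.zero_mem
    | succ l ih =>
      rw [Nat.cast_add, Nat.cast_one, hstep]
      have := S.add_mem (S.mul_mem h ih) (hz (-(l : ℤ)))
      rwa [Prod.mk_mul_mk, Prod.mk_add_mk, one_mul, ← Nat.cast_one (R := K), ← Nat.cast_add] at this
  intro l hl
  have hl1 : (l : K) + 1 ≠ 0 := by exact_mod_cast Nat.succ_ne_zero l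
  have hinv : ((qnum q (l + 1))⁻¹, ((l : K) + 1)⁻¹) ∈ S := by
    refine hS.inv _ _ ?_ hl1
    have := hnum (l + 1)
    rwa [Nat.cast_add, Nat.cast_one, Nat.cast_add, Nat.cast_one] at this
  refine ⟨S.mul_mem hinv (hz _), S.mul_mem hinv (S.mul_mem (spec_intCast _) (hnum _)), ?_⟩
  have hmul : ∀ {x y : F} {v w : K}, (x, v) ∈ S → (y, w) ∈ S → (x * y, v * w) ∈ S :=
    fun h1 h2 => S.mul_mem h1 h2
  cases ε <;> refine hmul hinv ?_
  -- With $m=N-2+2l$ the denominator is $q-q^{m+1}=-q(q-1)(1+q+\dots+q^{m-1})$. Its factor $q-1$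
  -- cancels against $q^2-1$, and the geometric sum has value $m\ne0$ at $q=1$.
  · obtain ⟨m, hm⟩ : ∃ m : ℕ, N + 2 * l = m + 2 := ⟨N + 2 * l - 2, by omega⟩
    have hmK : (N : K) - 2 + 2 * l = m := by
      have : ((N + 2 * l : ℕ) : K) = ((m + 2 : ℕ) : K) := by rw [hm]
      push_cast at this
      linear_combination this
    have hm0 : (m : K) ≠ 0 := by
      have : m ≠ 0 := by omega
      exact_mod_cast this
    have hq1 : q - 1 ≠ 0 := sub_ne_zero.mpr (by simpa using hq 1 one_pos)
    have hg := geom_sum_mul q m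
    set g := ∑ i ∈ Finset.range m, q ^ i with hgdef
    have hgS : (g, (m : K)) ∈ S := by
      have := spec_sum (S := S) (Finset.range m) (f := fun i => q ^ i) (g := fun _ => (1 : K))
        (fun i _ => by have := hz i; rwa [zpow_natCast] at this)
      simpa using this
    have hg0 : g ≠ 0 := by
      intro h0
      rw [h0, zero_mul] at hg
      exact hq m (by omega) (sub_eq_zero.mp hg.symm)
    have hexp : q ^ ((N : ℤ) - 1 + 2 * PM.plus.sgn * l) = q ^ m * q := by
      rw [← pow_succ, ← zpow_natCast]
      congr 1
      simp only [PM.sgn]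
      push_cast
      omega
    have key : (q ^ (2 * PM.plus.sgn) - 1) * qnum q l /
        (q ^ PM.plus.sgn - (PM.plus.sgn : F) * q ^ ((N : ℤ) - 1 + 2 * PM.plus.sgn * l)) =
        -((q + 1) * qnum q l) / (q * g) := by
      rw [hexp]
      simp only [PM.sgn, Int.cast_one, one_mul, zpow_one, mul_one]
      have hden : q - q ^ m * q = -(q * (g * (q - 1))) := by rw [hg]; ring
      rw [hden, zpow_ofNat]
      field_simp
      ring
    rw [key]
    simp only [hmK]
    refine hS.div ?_ ?_ hm0
    · have := S.neg_mem (S.mul_mem (S.add_mem h spec_one) (hnum l))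
      rw [Prod.mk_add_mk, one_add_one_eq_two] at this
      exact this
    · have := S.mul_mem h hgS
      rwa [Prod.mk_mul_mk, one_mul] at this
  -- For the sign $-$ nothing needs cancelling: the numerator tends to $0$ and the denominator to
  -- $2$.
  · have h1 : ((q ^ (2 * PM.minus.sgn) - 1) * qnum q l, (0 : K)) ∈ S := by
      have := S.mul_mem (S.sub_mem (hz (2 * PM.minus.sgn)) spec_one) (hnum l)
      rwa [Prod.mk_sub_mk, Prod.mk_mul_mk, sub_self, zero_mul] at this
    have h2 : (q ^ PM.minus.sgn - (PM.minus.sgn : F) *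
        q ^ ((N : ℤ) - 1 + 2 * PM.minus.sgn * l), (2 : K)) ∈ S := by
      have := S.sub_mem (hz PM.minus.sgn) (S.mul_mem (spec_intCast PM.minus.sgn)
        (hz ((N : ℤ) - 1 + 2 * PM.minus.sgn * l)))
      rwa [Prod.mk_mul_mk, Prod.mk_sub_mk, show (1 : K) - (PM.minus.sgn : K) * 1 = 2 by
        simp only [PM.sgn]; norm_num] at this
    have := hS.div h1 h2 two_ne_zero
    rwa [zero_div] at this

/-- The interchange of two tensor factors. -/
def flipMat (K : Type*) [Field K] (N : ℕ) : Mat2 K N :=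
  Matrix.of fun a b => if a.1 = b.2 ∧ a.2 = b.1 then 1 else 0

theorem sum_flipMat {N : ℕ} (a b : Fin N) :
    ∑ x, flipMat K N (a, x) (b, x) = if a = b then 1 else 0 := by
  simp only [flipMat, Matrix.of_apply, ite_and, Finset.sum_ite_eq, Finset.mem_univ, if_true,
    eq_comm]

theorem sum_factor {N : ℕ} (C : Coeffs K) {E : Mat2 K N} {η : K}
    (hE : ∀ a b, ∑ x, E (a, x) (b, x) = if a = b then η else 0) (l : ℕ) (a b : Fin N) :
    ∑ x, C.factor l (flipMat K N) E (a, x) (b, x) =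
      if a = b then C.α l * N + C.β l + C.γ l * η else 0 := by
  have hone : ∑ x : Fin N, (1 : Mat2 K N) (a, x) (b, x) = if a = b then (N : K) else 0 := by
    simp [Matrix.one_apply]
  simp only [Coeffs.factor, Matrix.add_apply, Matrix.smul_apply, smul_eq_mul,
    Finset.sum_add_distrib, ← Finset.mul_sum, hone, sum_flipMat, hE]
  split_ifs <;> ring

/-- The trace of the projector is found by specialization at `q = 1`. -/
theorem BMWPair.trace_tensorProj_of_spec [CharZero F] [CharZero K] (hS : IsSpecialization S)
    {N : ℕ} (hN : 0 < N) (ε : PM) {q : F} (hq0 : q ≠ 0) (hq : ∀ n : ℕ, 0 < n → q ^ n ≠ 1)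
    (h1 : (q, (1 : K)) ∈ S) {R E : Mat2 F N} {E' : Mat2 K N}
    (hRE : BMWPair (q - q⁻¹) (q ^ (1 - (N : ℤ))) R E) (hR : SpecMat S R (flipMat K N))
    (hE : SpecMat S E E') {η : K} (hη : ∀ a b, ∑ x, E' (a, x) (b, x) = if a = b then η else 0)
    {d : ℕ → ℕ} (hd1 : d 1 = N) (hd : ∀ l, 1 ≤ l → (d (l + 1) : K) =
      ((classicalCoeffs K N ε).α l * N + (classicalCoeffs K N ε).β l +
        (classicalCoeffs K N ε).γ l * η) * d l) {l : ℕ} (hl : 1 ≤ l) :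
    (tensorProj (recCoeffs N q ε) R E l).trace = (d l : F) := by
  have hC := recCoeffs_generic hq0 hq hN ε
  have hspec := fun l => SpecMat.tensorProj (hS.spec_classicalCoeffs hN ε hq0 hq h1) hR hE l
  have hcl : ∀ l, 1 ≤ l →
      (tensorProj (classicalCoeffs K N ε) (flipMat K N) E' l).trace = (d l : K) := by
    intro l hl
    induction l, hl using Nat.le_induction with
    | base =>
      rw [tensorProj_one, Matrix.trace_one, hd1]
      simp
    | succ l hl ih =>
      -- At $q=1$ one has $k=0$, so the construction by eigenvalues is not available; idempotence is
      -- inherited from the generic projector.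
      have hidem : tensorProj (classicalCoeffs K N ε) (flipMat K N) E' l *
          tensorProj (classicalCoeffs K N ε) (flipMat K N) E' l =
          tensorProj (classicalCoeffs K N ε) (flipMat K N) E' l := by
        have h2 := (hspec l).mul (hspec l)
        rw [hRE.tensorProj_idem hC l] at h2
        exact h2.eq hS (hspec l)
      rw [trace_tensorProj_succ hl hidem _ (sum_factor _ hη l), ih, hd l hl]
  -- The generic trace is some natural number `n`, which specializes to itself; comparison in
  -- characteristic $0$ gives `n = d l`.
  obtain ⟨n, hn⟩ := exists_trace_eq_natCast (hRE.tensorProj_idem hC l)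
  have h2 := (hspec l).trace_eq hS hn
  rw [hcl l hl] at h2
  rw [hn, Nat.cast_inj.mp h2]

end Traces

/-! ### The classical dimensions satisfy the recursion of the traces at $q=1$. -/

section Dimensions
variable {K : Type*} [Field K] [CharZero K]

theorem choose_succ_mul_cast (n l : ℕ) :
    ((n + l + 1).choose n : K) * (l + 1) = (n + l).choose n * (n + l + 1) := by
  have h := Nat.choose_mul_succ_eq (n + l) n
  rw [show n + l + 1 - n = l + 1 by omega] at h
  exact_mod_cast h.symm

theorem choose_cast_succ (N l : ℕ) :
    (N.choose (l + 1) : K) * (l + 1) = N.choose l * (N - l) := by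
  rcases Nat.lt_or_ge N l with h | h
  · rw [Nat.choose_eq_zero_of_lt h, Nat.choose_eq_zero_of_lt (by omega)]
    simp
  · have := Nat.choose_succ_right_eq N l
    have h2 := congrArg (Nat.cast (R := K)) this
    push_cast [Nat.cast_sub h] at h2
    exact h2

theorem natCast_add_one_ne_zero (l : ℕ) : (l : K) + 1 ≠ 0 := by
  exact_mod_cast Nat.succ_ne_zero l

theorem glDim_one {N : ℕ} (hN : 0 < N) (ε : PM) : glDim N ε 1 = N := by
  cases ε
  · obtain ⟨n, rfl⟩ : ∃ n, N = n + 1 := ⟨N - 1, by omega⟩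
    simp [glDim]
  · simp [glDim]

theorem glDim_succ {N : ℕ} (hN : 0 < N) (ε : PM) (l : ℕ) : (glDim N ε (l + 1) : K) =
    ((classicalCoeffs K N ε).α l * N + (classicalCoeffs K N ε).β l +
      (classicalCoeffs K N ε).γ l * 0) * glDim N ε l := by
  have hl := natCast_add_one_ne_zero (K := K) l
  cases ε
  · obtain ⟨n, rfl⟩ : ∃ n, N = n + 1 := ⟨N - 1, by omega⟩
    simp only [glDim, classicalCoeffs, PM.sgn, Nat.add_sub_cancel]
    have := choose_succ_mul_cast (K := K) n l
    rw [← add_assoc]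
    push_cast
    field_simp
    linear_combination this
  · simp only [glDim, classicalCoeffs, PM.sgn]
    have := choose_cast_succ (K := K) N l
    push_cast
    field_simp
    linear_combination this

theorem soDim_one {N : ℕ} (hN : 0 < N) (ε : PM) : soDim N ε 1 = N := by
  cases ε
  · obtain ⟨n, rfl⟩ : ∃ n, N = n + 1 := ⟨N - 1, by omega⟩
    simp [soDim]
  · simp [soDim]

theorem soDim_plus_cast {K : Type*} [Field K] (n l : ℕ) : (soDim (n + 1) .plus (l + 2) : K) =
    ((n + l + 2).choose n : K) - (n + l).choose n := by
  simp only [soDim, Nat.add_sub_cancel]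
  rw [if_pos (by omega), show n + 1 + (l + 2) - 3 = n + l by omega, ← add_assoc,
    Nat.cast_sub (Nat.choose_le_choose n (by omega))]

/-- For the sign $+$ and $l\ge2$ the dimension is a difference of two binomials; each is expressed
through those of lower degree by `choose_succ_mul_cast`, and a rational identity remains. -/
theorem soDim_succ {N : ℕ} (hN : 0 < N) (ε : PM) {l : ℕ} (hl : 1 ≤ l) :
    (soDim N ε (l + 1) : K) =
    ((classicalCoeffs K N ε).α l * N + (classicalCoeffs K N ε).β l +
      (classicalCoeffs K N ε).γ l * 1) * soDim N ε l := by
  obtain ⟨n, rfl⟩ : ∃ n, N = n + 1 := ⟨N - 1, by omega⟩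
  cases ε
  · obtain ⟨l, rfl⟩ : ∃ m, l = m + 1 := ⟨l - 1, by omega⟩
    have e1 := natCast_add_one_ne_zero (K := K) (l + 1)
    have e2 := natCast_add_one_ne_zero (K := K) (n + 2 * l)
    have c1 := choose_succ_mul_cast (K := K) n l
    have c2 := choose_succ_mul_cast (K := K) n (l + 1)
    rw [show l + 1 + 1 = l + 2 by omega, soDim_plus_cast n l]
    rw [show n + (l + 1) + 1 = n + l + 2 by omega, show n + (l + 1) = n + l + 1 by omega] at c2
    simp only [classicalCoeffs, PM.sgn]
    have e3 : (((n + 1 : ℕ) : K) - 2 + 2 * ((l + 1 : ℕ) : K)) ≠ 0 := by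
      have h : ((n + 1 : ℕ) : K) - 2 + 2 * ((l + 1 : ℕ) : K) = ((n + 2 * l : ℕ) : K) + 1 := by
        push_cast
        ring
      rwa [h]
    -- After the shift of `l` the case `zero` is degree $1$, where no binomial is subtracted, so it
    -- needs its own computation.
    cases l with
    | zero =>
      rw [soDim_one hN]
      simp only [Nat.choose_self, add_zero] at *
      have e4 : (n : K) + 1 ≠ 0 := natCast_add_one_ne_zero n
      push_cast at *
      rw [← eq_div_iff (by norm_num)] at c1 c2
      rw [c2, c1]
      field_simp
      ring
    | succ l =>
      rw [soDim_plus_cast n l]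
      have e4 := natCast_add_one_ne_zero (K := K) l
      have c3 := choose_succ_mul_cast (K := K) n l
      rw [← eq_div_iff e4] at c3
      rw [show n + (l + 1) + 1 = n + l + 2 by omega, show n + (l + 1) = n + l + 1 by omega] at c1
      rw [show n + (l + 1) + 2 = n + l + 3 by omega, show n + (l + 1) = n + l + 1 by omega]
      rw [show n + (l + 1) + 2 = n + l + 3 by omega,
        show n + (l + 1) + 1 = n + l + 2 by omega] at c2
      have e5 := natCast_add_one_ne_zero (K := K) (l + 1)
      rw [← eq_div_iff e5] at c1
      rw [← eq_div_iff e1] at c2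
      rw [c2, c1, c3]
      push_cast at *
      obtain ⟨D, hD⟩ : ∃ D : K, D = (n : K) + 1 - 2 + 2 * (l + 1 + 1) := ⟨_, rfl⟩
      rw [← hD] at e3 ⊢
      field_simp
      rw [hD]
      ring
  · simp only [soDim, classicalCoeffs, PM.sgn]
    have hl := natCast_add_one_ne_zero (K := K) l
    have := choose_cast_succ (K := K) (n + 1) l
    push_cast at *
    field_simp
    linear_combination this

end Dimensions

end QProj

namespace QProj

/-! ### Action on basis vectors -/

section Columns
variable {K : Type*} [Field K] {N : ℕ} {V : Type*} [AddCommGroup V] [Module K V]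

/-- The image of the basis vector `(a, b)` under `A`, expressed in the family `f`. -/
def columnSum (A : Mat2 K N) (a b : Fin N) (f : Fin N → Fin N → V) : V :=
  ∑ p : Fin N × Fin N, A p (a, b) • f p.1 p.2

theorem columnSum_add (A A' : Mat2 K N) (a b : Fin N) (f : Fin N → Fin N → V) :
    columnSum (A + A') a b f = columnSum A a b f + columnSum A' a b f := by
  simp only [columnSum, Matrix.add_apply, add_smul, Finset.sum_add_distrib]

theorem columnSum_sub (A A' : Mat2 K N) (a b : Fin N) (f : Fin N → Fin N → V) :
    columnSum (A - A') a b f = columnSum A a b f - columnSum A' a b f := by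
  simp only [columnSum, Matrix.sub_apply, sub_smul, Finset.sum_sub_distrib]

theorem columnSum_smul (r : K) (A : Mat2 K N) (a b : Fin N) (f : Fin N → Fin N → V) :
    columnSum (r • A) a b f = r • columnSum A a b f := by
  simp only [columnSum, Matrix.smul_apply, smul_assoc, Finset.smul_sum]

theorem columnSum_sum {ι : Type*} (s : Finset ι) (A : ι → Mat2 K N) (a b : Fin N)
    (f : Fin N → Fin N → V) :
    columnSum (∑ i ∈ s, A i) a b f = ∑ i ∈ s, columnSum (A i) a b f := by
  classical
  induction s using Finset.induction_on with
  | empty => simp [columnSum]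
  | insert i s hi ih => rw [Finset.sum_insert hi, Finset.sum_insert hi, columnSum_add, ih]

theorem columnSum_kron (i j i' j' a b : Fin N) (f : Fin N → Fin N → V) :
    columnSum ((e i j : Matrix (Fin N) (Fin N) K) ⊗ₖ e i' j') a b f =
      if i = a ∧ i' = b then f j j' else 0 := by
  simp only [columnSum, Fintype.sum_prod_type, Matrix.kroneckerMap_apply, e, Matrix.single_apply]
  by_cases h : i = a <;> by_cases h' : i' = b <;> simp [h, h']

theorem entry_eq_columnSum (A : Mat2 K N) (a b c d : Fin N) :
    A (a, b) (c, d) = columnSum A c d fun u v => if a = u ∧ b = v then (1 : K) else 0 := by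
  simp [columnSum, Fintype.sum_prod_type, ite_and]

theorem mat2_ext {A A' : Mat2 K N}
    (h : ∀ (a b : Fin N) (f : Fin N → Fin N → K), columnSum A a b f = columnSum A' a b f) :
    A = A' := by
  ext ⟨a, b⟩ ⟨c, d⟩
  exact (entry_eq_columnSum A a b c d).trans ((h c d _).trans (entry_eq_columnSum A' a b c d).symm)

/-- This is what the arbitrary family `f` is for: a product is evaluated by substituting the action
of one matrix into that of the other, without expanding any entries. -/
theorem columnSum_mul (A A' : Mat2 K N) (a b : Fin N) (f : Fin N → Fin N → V) :
    columnSum (A * A') a b f = columnSum A' a b fun u v => columnSum A u v f := by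
  simp only [columnSum, Matrix.mul_apply, Finset.sum_smul, Finset.smul_sum, smul_smul]
  rw [Finset.sum_comm]
  refine Finset.sum_congr rfl fun r _ => Finset.sum_congr rfl fun p _ => ?_
  rw [mul_comm]

theorem columnSum_one (a b : Fin N) (f : Fin N → Fin N → V) :
    columnSum (1 : Mat2 K N) a b f = f a b := by
  simp [columnSum, Matrix.one_apply]

/-- The basis vectors of the space of 3-tensors. -/
def basis3 (K : Type*) [Field K] {N : ℕ} (a b c : Fin N) : (Fin 3 → Fin N) → K :=
  Pi.single ![a, b, c] 1

theorem tuple_three_eta (i : Fin 3 → Fin N) : ![i 0, i 1, i 2] = i := by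
  ext r
  fin_cases r <;> rfl

theorem atSite_mulVec_left (A : Mat2 K N) (a b c : Fin N) :
    Matrix.mulVec (atSite A 0 (by omega : 0 + 1 < 3)) (basis3 K a b c) =
      columnSum A a b fun u v => basis3 K u v c := by
  ext i
  rw [basis3, Matrix.mulVec_single_one, Matrix.col_apply, atSite_apply]
  simp only [columnSum, basis3, Finset.sum_apply, Pi.smul_apply, Pi.single_apply]
  rw [Finset.sum_eq_single (i 0, i 1)]
  · have h1 : (i = ![i 0, i 1, c]) ↔ i 2 = c := by
      simp [funext_iff, Fin.forall_fin_succ]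
    have h2 : (∀ r : Fin 3, (r : ℕ) ≠ 0 → (r : ℕ) ≠ 0 + 1 → i r = ![a, b, c] r) ↔ i 2 = c := by
      simp [Fin.forall_fin_succ]
    simp only [h1, h2, smul_eq_mul, mul_ite, mul_one, mul_zero]
    rfl
  · rintro ⟨u, v⟩ _ huv
    rw [if_neg, smul_zero]
    intro h
    apply huv
    rw [h]
    rfl
  · simp

theorem atSite_mulVec_right (A : Mat2 K N) (a b c : Fin N) :
    Matrix.mulVec (atSite A 1 (by omega : 1 + 1 < 3)) (basis3 K a b c) =
      columnSum A b c fun u v => basis3 K a u v := by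
  ext i
  rw [basis3, Matrix.mulVec_single_one, Matrix.col_apply, atSite_apply]
  simp only [columnSum, basis3, Finset.sum_apply, Pi.smul_apply, Pi.single_apply]
  rw [Finset.sum_eq_single (i 1, i 2)]
  · have h1 : (i = ![a, i 1, i 2]) ↔ i 0 = a := by
      simp [funext_iff, Fin.forall_fin_succ]
    have h2 : (∀ r : Fin 3, (r : ℕ) ≠ 1 → (r : ℕ) ≠ 1 + 1 → i r = ![a, b, c] r) ↔ i 0 = a := by
      simp [Fin.forall_fin_succ]
    simp only [h1, h2, smul_eq_mul, mul_ite, mul_one, mul_zero]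
    rfl
  · rintro ⟨u, v⟩ _ huv
    rw [if_neg, smul_zero]
    intro h
    apply huv
    rw [h]
    rfl
  · simp

theorem tmat3_ext {X Y : TMat K N 3}
    (h : ∀ a b c, Matrix.mulVec X (basis3 K a b c) = Matrix.mulVec Y (basis3 K a b c)) :
    X = Y := by
  refine Matrix.ext_of_mulVec_single fun i => ?_
  have := h (i 0) (i 1) (i 2)
  rwa [basis3, tuple_three_eta] at this

end Columns

/-! ### The braid relation for operators of type $gl$. -/

section Hecke
variable {K : Type*} [Field K] {N : ℕ} {V : Type*} [AddCommGroup V] [Module K V]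

/-- The braid relation for operators that act on the basis vectors of a family closed under
permutations of the indices as the braid matrix of `U_q gl(N)`. -/
theorem hecke_braid {q : K} (hq0 : q ≠ 0) {B : Fin N → Fin N → Fin N → V}
    {σ₁ σ₂ : V →ₗ[K] V} {p : Fin N → Fin N → Fin N → Prop}
    (h₁ : ∀ a b c, p a b c → p b a c ∧ σ₁ (B a b c) =
      (if a = b then q else 1) • B b a c + (if a < b then q - q⁻¹ else 0) • B a b c)
    (h₂ : ∀ a b c, p a b c → p a c b ∧ σ₂ (B a b c) =
      (if b = c then q else 1) • B a c b + (if b < c then q - q⁻¹ else 0) • B a b c)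
    {a b c : Fin N} (h : p a b c) :
    σ₂ (σ₁ (σ₂ (B a b c))) = σ₁ (σ₂ (σ₁ (B a b c))) := by
  have habc := h
  have hbac := (h₁ _ _ _ habc).1
  have hacb := (h₂ _ _ _ habc).1
  have hbca := (h₂ _ _ _ hbac).1
  have hcab := (h₁ _ _ _ hacb).1
  simp only [(h₁ _ _ _ habc).2, (h₂ _ _ _ habc).2, (h₁ _ _ _ hbac).2, (h₂ _ _ _ hbac).2,
    (h₁ _ _ _ hacb).2, (h₂ _ _ _ hacb).2, (h₁ _ _ _ hbca).2,
    (h₂ _ _ _ hcab).2, map_add, map_smul]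
  clear h₁ h₂ h habc hbac hacb hbca hcab
  -- The coefficients depend only on the relative order of the three indices; the inconsistent
  -- combinations are discarded by `order`.
  rcases lt_trichotomy a b with hab | hab | hab <;>
    rcases lt_trichotomy b c with hbc | hbc | hbc <;>
    rcases lt_trichotomy a c with hac | hac | hac <;>
    first
    | (exfalso; order)
    | (subst_vars
       simp only [lt_irrefl, *, not_lt_of_gt, if_true, if_false, ne_of_lt, ne_of_gt] <;>
       match_scalars <;> field_simp <;> ring)

end Hecke

end QProj

namespace QProj

/-! ### The braid matrix of `U_q gl(N)` -/

section GeneralLinear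
variable {K : Type*} [Field K] {N : ℕ} {V : Type*} [AddCommGroup V] [Module K V]

theorem sum_pair_filter (p : Fin N → Fin N → Prop) [∀ i j, Decidable (p i j)] (a b : Fin N)
    (g : Fin N → Fin N → V) :
    ∑ i, ∑ j with p i j, (if i = a ∧ j = b then g i j else 0) = if p a b then g a b else 0 := by
  rw [Finset.sum_eq_single a]
  · rw [Finset.sum_filter, Finset.sum_eq_single b] <;> simp +contextual
  · intro i _ hi
    simp [hi]
  · simp

theorem sum_diag (a b : Fin N) (g : Fin N → V) :
    ∑ i, (if i = a ∧ i = b then g i else 0) = if a = b then g a else 0 := by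
  rw [Finset.sum_eq_single a] <;> simp +contextual

theorem glR_columnSum (q : K) (a b : Fin N) (f : Fin N → Fin N → V) :
    columnSum (glR q) a b f =
      (if a = b then q else 1) • f b a + (if a < b then q - q⁻¹ else 0) • f a b := by
  simp only [glR, columnSum_add, columnSum_smul, columnSum_sum, columnSum_kron, sum_pair_filter,
    sum_diag]
  by_cases h : a = b
  · subst h
    simp
  · by_cases h' : a < b <;> simp [h, h']

theorem glR_apply (q : K) (a b c d : Fin N) :
    glR q (a, b) (c, d) = (if a = d ∧ b = c then if a = b then q else 1 else 0) +
      if a = c ∧ b = d ∧ a < b then q - q⁻¹ else 0 := by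
  refine (entry_eq_columnSum _ _ _ _ _).trans ?_
  rw [glR_columnSum]
  simp only [smul_eq_mul, mul_ite, mul_one, mul_zero]
  grind

theorem glR_transpose (q : K) : (glR q : Mat2 K N).transpose = glR q := by
  ext ⟨a, b⟩ ⟨c, d⟩
  rw [Matrix.transpose_apply, glR_apply, glR_apply]
  grind

theorem glR_triple {q : K} (hq0 : q ≠ 0) :
    TripleRel (atSite (glR q : Mat2 K N) 0 (by omega : 0 + 1 < 3))
      (atSite (0 : Mat2 K N) 0 (by omega : 0 + 1 < 3))
      (atSite (glR q : Mat2 K N) 1 (by omega : 1 + 1 < 3))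
      (atSite (0 : Mat2 K N) 1 (by omega : 1 + 1 < 3)) := by
  constructor
  · refine tmat3_ext fun a b c => ?_
    rw [← Matrix.mulVec_mulVec, ← Matrix.mulVec_mulVec, ← Matrix.mulVec_mulVec,
      ← Matrix.mulVec_mulVec]
    refine hecke_braid hq0 (B := basis3 K) (p := fun _ _ _ => True)
      (σ₁ := (atSite (glR q : Mat2 K N) 0 (by omega : 0 + 1 < 3)).mulVecLin)
      (σ₂ := (atSite (glR q : Mat2 K N) 1 (by omega : 1 + 1 < 3)).mulVecLin)
      (fun a b c _ => ⟨trivial, ?_⟩) (fun a b c _ => ⟨trivial, ?_⟩) trivial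
    · rw [Matrix.mulVecLin_apply, atSite_mulVec_left, glR_columnSum]
    · rw [Matrix.mulVecLin_apply, atSite_mulVec_right, glR_columnSum]
  all_goals simp only [atSite_zero, mul_zero, zero_mul]

/-- For $gl$ the skein relation is the Hecke relation. With $E=0$ the parameter `t` is free, which
lets $gl$ share the coefficients and the value $q^{1-N}$ with $so$. -/
theorem glR_bmwPair {q : K} (hq0 : q ≠ 0) (t : K) : BMWPair (q - q⁻¹) t (glR q : Mat2 K N) 0 where
  skein := by
    rw [smul_zero, sub_zero]
    refine mat2_ext fun a b f => ?_
    simp only [columnSum_mul, columnSum_add, columnSum_smul, columnSum_one, glR_columnSum]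
    rcases lt_trichotomy a b with h | h | h
    · simp only [h, not_lt_of_gt h, if_true, if_false, ne_of_lt h, ne_of_gt h]
      match_scalars <;> ring
    · subst h
      simp only [lt_irrefl, if_true, if_false]
      match_scalars
      field_simp
      ring
    · simp only [h, not_lt_of_gt h, if_true, if_false, ne_of_lt h, ne_of_gt h]
      match_scalars <;> ring
  twist := by rw [mul_zero, smul_zero]
  symm_R := glR_transpose q
  symm_E := Matrix.transpose_zero
  triple := glR_triple hq0

instance : Fintype PM := ⟨{.plus, .minus}, fun ε => by cases ε <;> simp⟩

theorem sum_pm {M : Type*} [AddCommMonoid M] (f : PM → M) : ∑ ε, f ε = f .plus + f .minus := by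
  change ∑ ε ∈ {PM.plus, PM.minus}, f ε = _
  rw [Finset.sum_pair (by decide)]

theorem sq_add_one_ne_zero_of_generic [CharZero K] {q : K} (hq : ∀ n : ℕ, 0 < n → q ^ n ≠ 1) :
    q ^ 2 + 1 ≠ 0 := by
  intro h
  refine zpow_ne_neg_one_of_generic hq 2 ?_
  rw [zpow_ofNat]
  linear_combination h

/-- The expansion behind it is $\hat R=q\mathcal P^+-q^{-1}\mathcal P^-$. -/
theorem glP_spectralFamily [CharZero K] {q : K} (hq0 : q ≠ 0) (hq : ∀ n : ℕ, 0 < n → q ^ n ≠ 1)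
    (ε : PM) : SpectralFamily (eigenvalue q ε) (glR q : Mat2 K N) 0 (glP q) ε where
  value π := by
    have hadd := add_inv_ne_zero_of_generic hq0 hq
    have h2 := sq_add_one_ne_zero_of_generic hq
    refine ⟨(q + q⁻¹)⁻¹ * q ^ (-π.sgn), (q + q⁻¹)⁻¹ * π.sgn, 0, ?_, ?_⟩
    · rw [glP, smul_add, smul_smul, smul_smul, zero_smul, add_zero]
    · cases π <;> cases ε <;> simp [PM.sgn, eigenvalue] <;> field_simp <;> ring
  expand_R := by
    have hadd := add_inv_ne_zero_of_generic hq0 hq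
    refine ⟨eigenvalue q, ?_, rfl⟩
    rw [sum_pm]
    simp only [glP, eigenvalue, PM.sgn]
    have h2 := sq_add_one_ne_zero_of_generic hq
    match_scalars <;> simp <;> field_simp <;> ring
  expand_E := ⟨0, by simp, rfl⟩

variable {F : Type*} [Field F] {S : Subring (F × K)}

theorem specMat_kron (i j i' j' : Fin N) :
    SpecMat S ((e i j : Matrix (Fin N) (Fin N) F) ⊗ₖ e i' j') (e i j ⊗ₖ e i' j') := by
  intro a b
  simp only [Matrix.kroneckerMap_apply, e, Matrix.single_apply]
  split_ifs <;> simp [S.zero_mem, S.one_mem, ← Prod.one_eq_mk, ← Prod.zero_eq_mk]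

theorem SpecMat.sum {n ι : Type*} (s : Finset ι) {A : ι → Matrix n n F} {B : ι → Matrix n n K}
    (h : ∀ i ∈ s, SpecMat S (A i) (B i)) : SpecMat S (∑ i ∈ s, A i) (∑ i ∈ s, B i) := by
  intro a b
  rw [Matrix.sum_apply, Matrix.sum_apply]
  exact spec_sum s fun i hi => h i hi a b

theorem SpecMat.sub {n : Type*} {A A' : Matrix n n F} {B B' : Matrix n n K} (h : SpecMat S A B)
    (h' : SpecMat S A' B') : SpecMat S (A - A') (B - B') :=
  fun i j => S.sub_mem (h i j) (h' i j)

theorem IsSpecialization.glR (hS : IsSpecialization S) {q : F} {v : K} (h : (q, v) ∈ S)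
    (hv : v ≠ 0) : SpecMat S (glR q : Mat2 F N) (glR v) :=
  (((SpecMat.sum _ fun _ _ => specMat_kron _ _ _ _).smul h).add
    (SpecMat.sum _ fun _ _ => SpecMat.sum _ fun _ _ => specMat_kron _ _ _ _)).add
    ((SpecMat.sum _ fun _ _ => SpecMat.sum _ fun _ _ => specMat_kron _ _ _ _).smul
      (S.sub_mem h (hS.inv _ _ h hv)))

theorem glR_one : (QProj.glR 1 : Mat2 K N) = flipMat K N := by
  ext ⟨a, b⟩ ⟨c, d⟩
  rw [glR_apply]
  simp [flipMat]

/-- Two specializations of the projector over $K(X)$: $X=1$ determines its trace, $X=q$ carries the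
value to the given parameter. -/
theorem gl_trace [CharZero K] (hN : 0 < N) {q : K} (hq0 : q ≠ 0)
    (hq : ∀ n : ℕ, 0 < n → q ^ n ≠ 1) (ε : PM) {l : ℕ} (hl : 1 ≤ l) :
    (tensorProj (recCoeffs N q ε) (QProj.glR q : Mat2 K N) 0 l).trace = (glDim N ε l : K) := by
  have h := (glR_bmwPair (N := N) (fracX_ne_zero (K := K))
    (fracX K ^ (1 - (N : ℤ)))).trace_tensorProj_of_spec (evalRing_isSpecialization (1 : K)) hN ε
    fracX_ne_zero (fun n hn => fracX_pow_ne_one hn) (fracX_mem 1)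
    (by
      rw [← glR_one]
      exact (evalRing_isSpecialization (1 : K)).glR (fracX_mem 1) one_ne_zero)
    specMat_zero (η := 0) (by simp) (d := glDim N ε) (glDim_one hN ε)
    (fun l _ => glDim_succ hN ε l) hl
  have hS := evalRing_isSpecialization q
  exact (SpecMat.tensorProj (hS.spec_recCoeffs hN ε (fracX_mem q) hq0 hq)
    (hS.glR (fracX_mem q) hq0) specMat_zero l).trace_eq hS h

theorem glM_eq (q : K) (ε : PM) (l : ℕ) :
    (glM q ε l : Mat2 K N) = (recCoeffs N q ε).factor l (QProj.glR q) 0 := by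
  simp only [glM, Coeffs.factor, recCoeffs, smul_add, smul_smul, smul_zero, add_zero]

theorem gl_projectors [CharZero K] (hN : 0 < N) {q : K} (hq0 : q ≠ 0)
    (hq : ∀ n : ℕ, 0 < n → q ^ n ≠ 1) (ε : PM) :
    (∀ l : ℕ, 1 ≤ l → ∃! P : TMat K N l, IsGlProjector q ε l P) ∧
    (∀ P : TMat K N 1, IsGlProjector q ε 1 P → P = 1) ∧
    (∀ (l : ℕ) (hl : 1 ≤ l) (P : TMat K N l) (P' : TMat K N (l + 1)),
      IsGlProjector q ε l P → IsGlProjector q ε (l + 1) P' →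
        P' = tensorOne P * atSite (glM q ε l) (l - 1) (last_site_lt hl) * tensorOne P ∧
        P' = oneTensor P * atSite (glM q ε l) 0 (first_site_lt hl) * oneTensor P) ∧
    (∀ l : ℕ, 1 ≤ l → ∀ P : TMat K N l, IsGlProjector q ε l P →
      P ∈ braidPolynomials (QProj.glR q) l ∧ P.transpose = P) := by
  have hRE := glR_bmwPair (N := N) hq0 (q ^ (1 - (N : ℤ)))
  have hC := recCoeffs_generic hq0 hq hN ε
  have hp := glP_spectralFamily (N := N) hq0 hq ε
  have key : ∀ l, 1 ≤ l → ∀ P : TMat K N l, IsGlProjector q ε l P →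
      P = tensorProj (recCoeffs N q ε) (QProj.glR q) 0 l := fun l hl P hP =>
    hRE.eq_tensorProj hC hp (gl_trace hN hq0 hq ε hl) hP
  refine ⟨fun l hl => ⟨_, hRE.isCompleteProjector hC hp (gl_trace hN hq0 hq ε hl), key l hl⟩,
    fun P hP => key 1 le_rfl P hP, fun l hl P P' hP hP' => ?_, fun l hl P hP => ?_⟩
  · rw [key l hl P hP, key (l + 1) (by omega) P' hP', glM_eq]
    exact ⟨tensorProj_succ _ _ _ hl, hRE.tensorProj_succ' hC hl⟩
  · rw [key l hl P hP]
    exact ⟨hRE.tensorProj_mem hC l, hRE.tensorProj_transpose _ l⟩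

end GeneralLinear

end QProj

namespace QProj

/-! ### The braid matrix of `U_q so(N)` -/

section Orthogonal
variable {K : Type*} [Field K] {N : ℕ} {V : Type*} [AddCommGroup V] [Module K V]

theorem rev_eq_iff_eq_rev {a b : Fin N} : a.rev = b ↔ a = b.rev := by
  rw [← Fin.rev_inj, Fin.rev_rev]

theorem rev_lt_iff_rev_lt {a b : Fin N} : a.rev < b ↔ b.rev < a := by
  rw [← Fin.rev_lt_rev, Fin.rev_rev]

theorem lt_rev_iff_lt_rev {a b : Fin N} : a < b.rev ↔ b < a.rev := by
  rw [← Fin.rev_lt_rev, Fin.rev_rev]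

/-- `q` to the inner product of the weights of two basis vectors. -/
def wt (q : K) (a b : Fin N) : K :=
  if b = a then if a = a.rev then 1 else q else if b = a.rev then q⁻¹ else 1

/-- `q^{-ρ_a}`. -/
def xρ (s : K) (a : Fin N) : K := s ^ (-twoRho a)

theorem twoRho_rev (a : Fin N) : twoRho a.rev = -twoRho a := by
  unfold twoRho
  rw [Fin.rev_rev]
  rcases lt_trichotomy a a.rev with h | h | h
  · rw [if_neg (not_lt_of_gt h), if_neg (ne_of_gt h), if_pos h, Fin.val_rev]
    omega
  · rw [← h]
    simp
  · rw [if_pos h, if_neg (not_lt_of_gt h), if_neg (ne_of_gt h), Fin.val_rev]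
    omega

theorem xρ_rev (s : K) (a : Fin N) : xρ s a.rev = (xρ s a)⁻¹ := by
  rw [xρ, xρ, twoRho_rev, zpow_neg, zpow_neg]

theorem xρ_ne_zero {s : K} (hs : s ≠ 0) (a : Fin N) : xρ s a ≠ 0 := zpow_ne_zero _ hs

theorem wt_comm (q : K) (a b : Fin N) : wt q a b = wt q b a := by
  unfold wt
  have : b = a.rev ↔ a = b.rev := by rw [eq_comm, rev_eq_iff_eq_rev]
  by_cases h : b = a
  · subst h; rfl
  · simp only [h, Ne.symm h, if_false, this]

theorem wt_rev_left (q : K) (a b : Fin N) : wt q a.rev b = (wt q a b)⁻¹ := by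
  unfold wt
  rw [Fin.rev_rev]
  by_cases h : b = a <;> by_cases h' : b = a.rev
  · have h2 : a = a.rev := h ▸ h'
    simp [h, ← h2]
  · have h2 : ¬ a = a.rev := h ▸ h'
    simp [h, h2]
  · have h2 : ¬ a.rev = a := fun h2 => h (h'.trans h2)
    simp [h', h2]
  · simp [h, h']

theorem wt_rev_rev (q : K) (a b : Fin N) : wt q a.rev b.rev = wt q a b := by
  rw [wt_rev_left, wt_comm, wt_rev_left, inv_inv, wt_comm]

theorem wt_of_ne {q : K} {a b : Fin N} (h : b ≠ a) (h' : b ≠ a.rev) : wt q a b = 1 := by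
  rw [wt, if_neg h, if_neg h']

theorem wt_self_of_ne {q : K} {a : Fin N} (h : a ≠ a.rev) : wt q a a = q := by
  rw [wt, if_pos rfl, if_neg h]

/-- The matrix `Q_N P^t`. -/
def soE (s : K) : Mat2 K N := Matrix.of fun a b => soG s a.1 a.2 * soG s b.1 b.2

theorem soG_apply (s : K) (a b : Fin N) : soG s a b = if b = a.rev then xρ s a else 0 := by
  simp only [soG, Matrix.of_apply, xρ]
  by_cases h : b = a.rev
  · subst h
    simp [twoRho_rev]
  · rw [if_neg h, if_neg (Ne.symm h)]

theorem soE_columnSum (s : K) (a b : Fin N) (f : Fin N → Fin N → V) :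
    columnSum (soE s) a b f =
      if b = a.rev then ∑ u, (xρ s a * xρ s u) • f u u.rev else 0 := by
  simp only [columnSum, soE, Matrix.of_apply, soG_apply, Fintype.sum_prod_type]
  split_ifs with h
  · refine Finset.sum_congr rfl fun u _ => ?_
    rw [Finset.sum_eq_single u.rev] <;> simp +contextual [mul_comm]
  · simp

/-- Off the pairs $(a,-a)$ the action is that of $gl$; on such a pair the extra term spreads over
all $(u,-u)$ with $u<-a$. -/
theorem soR_columnSum {s : K} (hs : s ≠ 0) (a b : Fin N) (f : Fin N → Fin N → V) :
    columnSum (soR s) a b f = wt (s ^ 2) a b • f b a +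
      (if a < b then s ^ 2 - (s ^ 2)⁻¹ else 0) • f a b -
      if b = a.rev then ∑ u, (if u < a.rev then
        (s ^ 2 - (s ^ 2)⁻¹) * (xρ s a * xρ s u) else 0) • f u u.rev else 0 := by
  have hlast : columnSum (∑ i : Fin N, ∑ j : Fin N with i < j,
      s ^ (-twoRho i + twoRho j) • ((e i j.rev : Matrix (Fin N) (Fin N) K) ⊗ₖ e i.rev j)) a b f =
      if b = a.rev then ∑ u, (if u < a.rev then xρ s a * xρ s u else 0) • f u u.rev else 0 := by
    simp only [columnSum_sum, columnSum_smul, columnSum_kron]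
    rw [Finset.sum_eq_single a]
    · by_cases h : b = a.rev
      · subst h
        simp only [true_and, if_true]
        -- Substitution $u=-j$, which turns the condition $a<j$ into $u<-a$ and $q^{\rho_j}$ into
        -- $q^{-\rho_u}$.
        rw [Finset.sum_filter, ← Equiv.sum_comp Fin.revPerm]
        refine Finset.sum_congr rfl fun u _ => ?_
        simp only [Fin.revPerm_apply, Fin.rev_rev, lt_rev_iff_lt_rev (a := a), twoRho_rev]
        split_ifs with h
        · rw [zpow_add₀ hs]
          rfl
        · rw [zero_smul]
      · rw [if_neg h]
        exact Finset.sum_eq_zero fun j _ => by rw [if_neg (fun h' => h h'.2.symm), smul_zero]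
    · intro i _ hi
      exact Finset.sum_eq_zero fun j _ => by rw [if_neg (fun h' => hi h'.1), smul_zero]
    · simp
  have hanti : columnSum (∑ i : Fin N with i ≠ i.rev,
      ((e i i.rev : Matrix (Fin N) (Fin N) K) ⊗ₖ e i.rev i)) a b f =
      if b = a.rev ∧ a ≠ a.rev then f b a else 0 := by
    simp only [columnSum_sum, columnSum_kron]
    rw [Finset.sum_filter, Finset.sum_eq_single a]
    · by_cases h : b = a.rev
      · subst h; simp
      · simp [h, Ne.symm h]
    · intro i _ hi
      simp [hi]
    · simp
  have hdiag : columnSum (∑ i : Fin N with i ≠ i.rev,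
      ((e i i : Matrix (Fin N) (Fin N) K) ⊗ₖ e i i)) a b f =
      if b = a ∧ a ≠ a.rev then f b a else 0 := by
    simp only [columnSum_sum, columnSum_kron]
    rw [Finset.sum_filter, Finset.sum_eq_single a]
    · by_cases h : b = a
      · subst h; simp
      · simp [h, Ne.symm h]
    · intro i _ hi
      simp [hi]
    · simp
  simp only [soR, columnSum_add, columnSum_sub, columnSum_smul, hlast, hanti, hdiag]
  simp only [columnSum_sum, columnSum_kron, sum_pair_filter]
  have e1 : a = b.rev ↔ b = a.rev := by rw [← rev_eq_iff_eq_rev, eq_comm]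
  have e2 : (s ^ 2 - (s ^ 2)⁻¹) • (if b = a.rev then
      ∑ u, (if u < a.rev then xρ s a * xρ s u else 0) • f u u.rev else 0) =
      if b = a.rev then ∑ u, (if u < a.rev then
        (s ^ 2 - (s ^ 2)⁻¹) * (xρ s a * xρ s u) else 0) • f u u.rev else 0 := by
    rw [smul_ite, smul_zero, Finset.smul_sum]
    simp only [smul_smul, mul_ite, mul_zero]
  have e3 : (s ^ 2 - (s ^ 2)⁻¹) • (if a < b then f a b else 0) =
      (if a < b then s ^ 2 - (s ^ 2)⁻¹ else 0) • f a b := by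
    split_ifs <;> simp
  rw [smul_sub, e2, e3, ← add_sub_assoc]
  congr 2
  simp only [wt]
  by_cases h : b = a
  · subst h
    by_cases h' : b = b.rev
    · simp [← h']
    · simp [h']
  · by_cases h' : b = a.rev
    · have h2 : a ≠ a.rev := fun h2 => h (h'.trans h2.symm)
      simp [h', h2, h2.symm]
    · have h2 : ¬ a = b.rev := fun h2 => h' (e1.mp h2)
      simp [h, Ne.symm h, h', h2]

theorem soR_apply {s : K} (hs : s ≠ 0) (a b c d : Fin N) :
    soR s (a, b) (c, d) = (if a = d ∧ b = c then wt (s ^ 2) a b else 0) +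
      (if a = c ∧ b = d ∧ a < b then s ^ 2 - (s ^ 2)⁻¹ else 0) -
      if b = a.rev ∧ d = c.rev ∧ a < c.rev then
        (s ^ 2 - (s ^ 2)⁻¹) * (xρ s a * xρ s c) else 0 := by
  refine (entry_eq_columnSum _ _ _ _ _).trans ?_
  rw [soR_columnSum hs]
  simp only [smul_eq_mul, mul_ite, mul_one, mul_zero]
  congr 1
  · congr 1
    · by_cases h : a = d ∧ b = c
      · rw [if_pos h, if_pos h, h.1, h.2, wt_comm]
      · rw [if_neg h, if_neg h]
    · grind
  · by_cases h : d = c.rev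
    · rw [if_pos h, Finset.sum_eq_single a]
      · simp only [true_and, h, mul_comm (xρ s c)]
        split_ifs <;> simp_all
      · intro u _ hu
        rw [if_neg (fun h' => hu h'.1.symm)]
      · simp
    · rw [if_neg h, if_neg (fun h' => h h'.2.1)]

theorem soE_apply (s : K) (a b c d : Fin N) : soE s (a, b) (c, d) =
    if b = a.rev ∧ d = c.rev then xρ s a * xρ s c else 0 := by
  simp only [soE, Matrix.of_apply, soG_apply]
  split_ifs <;> simp_all

theorem soR_transpose {s : K} (hs : s ≠ 0) : (soR s : Mat2 K N).transpose = soR s := by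
  ext ⟨a, b⟩ ⟨c, d⟩
  rw [Matrix.transpose_apply, soR_apply hs, soR_apply hs, mul_comm (xρ s c)]
  have h1 := wt_comm (s ^ 2) a b
  have h2 : c < a.rev ↔ a < c.rev := lt_rev_iff_lt_rev
  grind

theorem soE_transpose (s : K) : (soE s : Mat2 K N).transpose = soE s := by
  ext ⟨a, b⟩ ⟨c, d⟩
  rw [Matrix.transpose_apply, soE_apply, soE_apply]
  grind

/-! #### The loop sum -/

theorem xρ_sq (s : K) (a : Fin N) : xρ s a ^ 2 = (s ^ 2) ^ (-twoRho a) := by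
  rw [xρ, ← zpow_natCast, ← zpow_mul, ← zpow_natCast s, ← zpow_mul, mul_comm]

theorem twoRho_eq (a : Fin N) : twoRho a = if 2 * (a : ℕ) + 1 < N then (N : ℤ) - 2 - 2 * (a : ℕ)
    else if 2 * (a : ℕ) + 1 = N then 0 else (N : ℤ) - 2 * (a : ℕ) := by
  unfold twoRho
  have h1 : a < a.rev ↔ 2 * (a : ℕ) + 1 < N := by
    rw [Fin.lt_def, Fin.val_rev]; omega
  have h2 : a = a.rev ↔ 2 * (a : ℕ) + 1 = N := by
    rw [Fin.ext_iff, Fin.val_rev]; omega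
  simp only [h1, h2]

/-- A telescoping sum, by induction on the position of `z`. It evaluates the truncated sums that
arise when $\hat R$ acts twice on pairs of opposite indices. The step is split according to whether
the added index lies before, at or after the middle, where $\rho$ does not drop by $1$. -/
theorem loopSum {s : K} (hs : s ≠ 0) (z : Fin N) :
    (s ^ 2 - (s ^ 2)⁻¹) * ∑ u, (if u < z then xρ s u ^ 2 else 0) =
      wt (s ^ 2) z z.rev * xρ s z ^ 2 + (if z.rev < z then s ^ 2 - (s ^ 2)⁻¹ else 0) -
        (s ^ 2) ^ (1 - (N : ℤ)) := by
  have hq : s ^ 2 ≠ 0 := pow_ne_zero 2 hs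
  simp only [xρ_sq]
  generalize s ^ 2 = q at *
  have hrev : ∀ z : Fin N, z.rev < z ↔ N < 2 * (z : ℕ) + 1 := fun z => by
    rw [Fin.lt_def, Fin.val_rev]; omega
  have heq : ∀ z : Fin N, z = z.rev ↔ 2 * (z : ℕ) + 1 = N := fun z => by
    rw [Fin.ext_iff, Fin.val_rev]; omega
  have hw : ∀ z : Fin N, wt q z z.rev * q ^ (-twoRho z) + (if z.rev < z then q - q⁻¹ else 0) =
      if 2 * (z : ℕ) + 1 = N then 1 else
        q ^ (-twoRho z - 1) + if N < 2 * (z : ℕ) + 1 then q - q⁻¹ else 0 := by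
    intro z
    by_cases h : z = z.rev
    · have h2 := (heq z).mp h
      have h3 : twoRho z = 0 := by rw [twoRho_eq, if_neg (by omega), if_pos h2]
      rw [if_pos h2, h3, ← h]
      simp [wt, ← h]
    · have h2 : ¬ 2 * (z : ℕ) + 1 = N := fun h' => h ((heq z).mpr h')
      simp only [wt, if_neg (Ne.symm h), if_true, if_neg h2, hrev, zpow_sub_one₀ hq]
      ring
  rw [hw]
  obtain ⟨m, hm⟩ := z
  simp only [twoRho_eq, Fin.lt_def]
  induction m with
  | zero =>
    simp only [not_lt_zero, if_false, Finset.sum_const_zero, mul_zero, zero_add]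
    rcases Nat.lt_or_ge 1 N with h | h
    · rw [if_neg (by omega), if_pos h, if_neg (by omega), add_zero]
      rw [eq_comm, sub_eq_zero]
      congr 1
      push_cast
      ring
    · obtain rfl : N = 1 := by omega
      simp
  | succ m ih =>
    have ih := ih (by omega)
    have hsum : ∑ u : Fin N, (if (u : ℕ) < m + 1 then q ^ (-(if 2 * (u : ℕ) + 1 < N then
        (N : ℤ) - 2 - 2 * (u : ℕ) else if 2 * (u : ℕ) + 1 = N then 0 else
        (N : ℤ) - 2 * (u : ℕ))) else 0) =
        ∑ u : Fin N, (if (u : ℕ) < m then q ^ (-(if 2 * (u : ℕ) + 1 < N then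
        (N : ℤ) - 2 - 2 * (u : ℕ) else if 2 * (u : ℕ) + 1 = N then 0 else
        (N : ℤ) - 2 * (u : ℕ))) else 0) + q ^ (-(if 2 * m + 1 < N then
        (N : ℤ) - 2 - 2 * (m : ℕ) else if 2 * m + 1 = N then 0 else
        (N : ℤ) - 2 * (m : ℕ))) := by
      have h1 : ∀ u : Fin N, ∀ x : K, (if (u : ℕ) < m + 1 then x else 0) =
          (if (u : ℕ) < m then x else 0) + if u = ⟨m, by omega⟩ then x else 0 := by
        intro u x
        simp only [Fin.ext_iff]
        split_ifs <;> first | omega | simp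
      simp only [h1, Finset.sum_add_distrib, Finset.sum_ite_eq', Finset.mem_univ, if_true]
    -- The telescoping step: $(q-q^{-1})q^n=q^{n+1}-q^{n-1}$.
    have hpow : ∀ n : ℤ, q ^ (n - 1) + (q - q⁻¹) * q ^ n = q ^ (n + 1) := by
      intro n
      rw [zpow_sub_one₀ hq, zpow_add_one₀ hq]
      ring
    rw [hsum, mul_add, ih]
    have hcast : ((m + 1 : ℕ) : ℤ) = m + 1 := by push_cast; rfl
    rcases lt_trichotomy (2 * m + 1) N with h1 | h1 | h1
    · rw [if_neg (by omega), if_pos h1, if_neg (by omega), add_zero, sub_add_eq_add_sub, hpow]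
      congr 1
      rcases lt_trichotomy (2 * (m + 1) + 1) N with h2 | h2 | h2
      · rw [if_neg (by omega), if_pos h2, if_neg (by omega), add_zero, hcast]
        congr 1
        ring
      · rw [if_pos h2, show -((N : ℤ) - 2 - 2 * (m : ℕ)) + 1 = 0 by omega, zpow_zero]
      · rw [if_neg (by omega), if_neg (by omega), if_neg (by omega), if_pos h2, hcast,
          show -((N : ℤ) - 2 - 2 * (m : ℕ)) + 1 = 1 by omega,
          show -((N : ℤ) - 2 * ((m : ℤ) + 1)) - 1 = -1 by omega, zpow_neg_one, zpow_one]
        ring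
    · rw [if_pos h1, if_neg (by omega), if_pos h1, if_neg (by omega), if_neg (by omega),
        if_neg (by omega), if_pos (by omega), hcast,
        show -((N : ℤ) - 2 * ((m : ℤ) + 1)) - 1 = 0 by omega]
      simp only [neg_zero, zpow_zero]
      ring
    · rw [if_neg (by omega), if_neg (by omega), if_neg (by omega), if_pos h1, if_neg (by omega),
        if_neg (by omega), if_neg (by omega), if_pos (by omega), hcast,
        show -((N : ℤ) - 2 * ((m : ℤ) + 1)) - 1 = -((N : ℤ) - 2 * (m : ℕ)) + 1 by omega, ← hpow]
      ring

end Orthogonal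

end QProj

namespace QProj

/-! ### Skein and twist relations for `U_q so(N)` -/

section OrthogonalSkein
variable {K : Type*} [Field K] {N : ℕ} {V : Type*} [AddCommGroup V] [Module K V]

/-- The entries of the braid matrix of `U_q so(N)` between the basis vectors `(z, -z)` and
`(v, -v)`. -/
def soT (s : K) (v z : Fin N) : K :=
  (if v = z.rev then wt (s ^ 2) z z.rev else 0) +
    (if v = z ∧ z < z.rev then s ^ 2 - (s ^ 2)⁻¹ else 0) -
    if v < z.rev then (s ^ 2 - (s ^ 2)⁻¹) * (xρ s z * xρ s v) else 0

theorem soR_columnSum_rev {s : K} (hs : s ≠ 0) (z : Fin N) (f : Fin N → Fin N → V) :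
    columnSum (soR s) z z.rev f = ∑ v, soT s v z • f v v.rev := by
  rw [soR_columnSum hs, if_pos rfl]
  simp only [soT, sub_smul, add_smul, Finset.sum_sub_distrib, Finset.sum_add_distrib]
  congr 2
  · simp [ite_smul]
  · rw [Finset.sum_eq_single z] <;> simp +contextual

theorem wt_rev_self (q : K) (z : Fin N) : wt q z.rev z = wt q z z.rev := wt_comm _ _ _

theorem soT_comm (s : K) (v z : Fin N) : soT s v z = soT s z v := by
  have h1 : v < z.rev ↔ z < v.rev := lt_rev_iff_lt_rev
  have h2 : v = z.rev ↔ z = v.rev := by rw [eq_comm, rev_eq_iff_eq_rev]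
  unfold soT
  rw [mul_comm (xρ s v)]
  simp only [h1]
  congr 2
  · by_cases h : z = v.rev
    · rw [if_pos h, if_pos (h2.mpr h), h, Fin.rev_rev, wt_comm]
    · rw [if_neg h, if_neg (fun h' => h (h2.mp h'))]
  · by_cases h : v = z
    · subst h; rfl
    · simp [h, Ne.symm h]

theorem soT_sum (s : K) (v : Fin N) (c : Fin N → K) :
    ∑ u, soT s v u * c u = wt (s ^ 2) v v.rev * c v.rev +
      (if v < v.rev then s ^ 2 - (s ^ 2)⁻¹ else 0) * c v -
      (s ^ 2 - (s ^ 2)⁻¹) * xρ s v * ∑ u, if u < v.rev then xρ s u * c u else 0 := by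
  have h : ∀ u, soT s v u * c u =
      (if u = v.rev then wt (s ^ 2) v v.rev * c u else 0) +
      (if u = v then (if v < v.rev then s ^ 2 - (s ^ 2)⁻¹ else 0) * c u else 0) -
      (s ^ 2 - (s ^ 2)⁻¹) * xρ s v * if u < v.rev then xρ s u * c u else 0 := by
    intro u
    rw [soT_comm, soT]
    split_ifs <;> first | (exfalso; tauto) | ring
  simp only [h, Finset.sum_sub_distrib, Finset.sum_add_distrib, Finset.sum_ite_eq',
    Finset.mem_univ, if_true, ← Finset.mul_sum]

theorem loopSum_rev {s : K} (hs : s ≠ 0) (z : Fin N) :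
    (s ^ 2 - (s ^ 2)⁻¹) * ∑ u, (if u < z.rev then xρ s u * xρ s u else 0) =
      wt (s ^ 2) z z.rev * (xρ s z)⁻¹ ^ 2 + (if z < z.rev then s ^ 2 - (s ^ 2)⁻¹ else 0) -
        (s ^ 2) ^ (1 - (N : ℤ)) := by
  have h := loopSum hs z.rev
  rw [Fin.rev_rev, xρ_rev, wt_rev_self] at h
  rw [← h]
  simp only [pow_two]

theorem soT_twist {s : K} (hs : s ≠ 0) (v : Fin N) :
    ∑ u, soT s v u * xρ s u = (s ^ 2) ^ (1 - (N : ℤ)) * xρ s v := by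
  have hx := xρ_ne_zero hs v
  rw [soT_sum, mul_right_comm, loopSum_rev hs, xρ_rev]
  field_simp
  ring

/-- For $v\le z$ the condition $u<-z$ implies $u<-v$, so the product of the two truncated sums
collapses to one truncated at $-z$, which `loopSum_rev` evaluates. The symmetry of `soT` covers the
other order. -/
theorem soT_sq_of_le {s : K} (hs : s ≠ 0) {v z : Fin N} (hvz : v ≤ z) :
    ∑ u, soT s v u * soT s u z = (if v = z then 1 else 0) +
      (s ^ 2 - (s ^ 2)⁻¹) * soT s v z -
        (s ^ 2 - (s ^ 2)⁻¹) * (s ^ 2) ^ (1 - (N : ℤ)) * (xρ s v * xρ s z) := by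
  have hxv := xρ_ne_zero hs v
  have hxz := xρ_ne_zero hs z
  have hinner : ∑ u, (if u < v.rev then xρ s u * soT s u z else 0) =
      (if v < z then (xρ s z)⁻¹ * wt (s ^ 2) z z.rev else 0) +
      (if z < v.rev ∧ z < z.rev then (s ^ 2 - (s ^ 2)⁻¹) * xρ s z else 0) -
      xρ s z * ((s ^ 2 - (s ^ 2)⁻¹) * ∑ u, if u < z.rev then xρ s u * xρ s u else 0) := by
    have h1 : ∀ u, (if u < v.rev then xρ s u * soT s u z else 0) =
        (if u = z.rev then (if u < v.rev then xρ s u * wt (s ^ 2) z z.rev else 0) else 0) +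
        (if u = z then (if u < v.rev ∧ z < z.rev then xρ s u * (s ^ 2 - (s ^ 2)⁻¹) else 0)
          else 0) -
        xρ s z * ((s ^ 2 - (s ^ 2)⁻¹) * if u < z.rev then xρ s u * xρ s u else 0) := by
      intro u
      have h2 : u < z.rev → u < v.rev := fun h => lt_of_lt_of_le h (Fin.rev_le_rev.mpr hvz)
      unfold soT
      split_ifs <;> first | (exfalso; tauto) | ring
    simp only [h1, Finset.sum_sub_distrib, Finset.sum_add_distrib, Finset.sum_ite_eq',
      Finset.mem_univ, if_true, Finset.mul_sum, Fin.rev_lt_rev, xρ_rev]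
    congr 2
    rw [mul_comm (xρ s z)]
  rw [soT_sum, hinner, loopSum_rev hs]
  have hq : s ^ 2 ≠ 0 := pow_ne_zero 2 hs
  have hzv : ¬ v.rev < z.rev := by rw [Fin.rev_lt_rev]; exact not_lt_of_ge hvz
  rcases hvz.lt_or_eq with h | rfl
  · have e1 : ¬ (v.rev = z ∧ z < z.rev) := by
      rintro ⟨rfl, h'⟩
      rw [Fin.rev_rev] at h'
      order
    have e2 : ¬ v.rev = z.rev := fun h' => h.ne (Fin.rev_inj.mp h')
    have e3 : z < z.rev → z < v.rev := fun h' => h'.trans (Fin.rev_lt_rev.mpr h)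
    by_cases hv : v < v.rev
    · have e4 : (z < v.rev ∧ z < z.rev) ↔ z < z.rev := ⟨fun h => h.2, fun h => ⟨e3 h, h⟩⟩
      have e5 : soT s v.rev z = 0 := by
        rw [soT, if_neg e1, if_neg e2, if_neg hzv]; ring
      rw [e5, if_pos hv, if_pos h, if_neg h.ne]
      simp only [e4]
      generalize soT s v z = T
      by_cases hz : z < z.rev <;> simp only [hz, if_true, if_false] <;> field_simp <;> ring
    · have hz : ¬ z < z.rev := fun h' => hv (h.trans (e3 h'))
      have hrev : z.rev < v := by
        have := Fin.rev_lt_rev.mpr h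
        order
      have e5 : soT s v.rev z = 0 := by
        rw [soT, if_neg e1, if_neg e2, if_neg hzv]; ring
      have e6 : soT s v z = 0 := by
        rw [soT, if_neg hrev.ne', if_neg (fun h' => hz h'.2), if_neg (not_lt_of_gt hrev)]; ring
      rw [e5, e6, if_neg hv, if_pos h, if_neg h.ne, if_neg hz, if_neg (fun h' => hz h'.2)]
      field_simp
      ring
  · have e5 : soT s v.rev v = wt (s ^ 2) v v.rev := by
      rw [soT, if_pos rfl, if_neg (fun h' => h'.2.ne h'.1.symm), if_neg (lt_irrefl _)]; ring
    rw [e5, if_neg (lt_irrefl v), if_pos rfl]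
    rcases lt_trichotomy v v.rev with h | h | h
    · have hw : wt (s ^ 2) v v.rev = (s ^ 2)⁻¹ := by
        rw [wt, if_neg h.ne', if_pos rfl]
      simp only [hw, h, and_self, if_true]
      generalize soT s v v = T
      field_simp
      ring
    · have hw : wt (s ^ 2) v v.rev = 1 := by
        rw [← h, wt, if_pos rfl, if_pos h]
      have e6 : soT s v v = 1 := by
        rw [soT, if_pos h, hw, ← h, if_neg (fun h' => lt_irrefl _ h'.2), if_neg (lt_irrefl _)]
        ring
      simp only [hw, e6, h.not_lt, and_self, if_false]
      field_simp
      ring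
    · have hw : wt (s ^ 2) v v.rev = (s ^ 2)⁻¹ := by
        rw [wt, if_neg h.ne, if_pos rfl]
      have e6 : soT s v v = 0 := by
        rw [soT, if_neg h.ne', if_neg (fun h' => not_lt_of_gt h h'.2), if_neg (not_lt_of_gt h)]
        ring
      simp only [hw, e6, not_lt_of_gt h, and_self, if_false]
      field_simp
      ring

theorem soT_sq {s : K} (hs : s ≠ 0) (v z : Fin N) :
    ∑ u, soT s v u * soT s u z = (if v = z then 1 else 0) +
      (s ^ 2 - (s ^ 2)⁻¹) * soT s v z -
        (s ^ 2 - (s ^ 2)⁻¹) * (s ^ 2) ^ (1 - (N : ℤ)) * (xρ s v * xρ s z) := by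
  rcases le_total v z with h | h
  · exact soT_sq_of_le hs h
  · have := soT_sq_of_le hs h
    rw [soT_comm s v z, mul_comm (xρ s v)]
    simp only [eq_comm (a := v)]
    rw [← this]
    refine Finset.sum_congr rfl fun u _ => ?_
    rw [soT_comm s v, soT_comm s u z, mul_comm]

theorem wt_of_ne_rev {q : K} {a b : Fin N} (h : b ≠ a.rev) : wt q a b = if a = b then q else 1 := by
  by_cases hab : a = b
  · subst hab
    rw [wt_self_of_ne h, if_pos rfl]
  · rw [wt_of_ne (Ne.symm hab) h, if_neg hab]

theorem ne_rev_symm {a b : Fin N} (h : b ≠ a.rev) : a ≠ b.rev :=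
  fun h' => h (rev_eq_iff_eq_rev.mpr h').symm

theorem soR_columnSum_of_ne {s : K} (hs : s ≠ 0) {a b : Fin N} (h : b ≠ a.rev)
    (f : Fin N → Fin N → V) : columnSum (soR s) a b f =
      (if a = b then s ^ 2 else 1) • f b a + (if a < b then s ^ 2 - (s ^ 2)⁻¹ else 0) • f a b := by
  rw [soR_columnSum hs, if_neg h, sub_zero, wt_of_ne_rev h]

/-- On $(a,-a)$ this is `soT_sq`; elsewhere $E$ vanishes and the Hecke relation holds. -/
theorem soR_skein {s : K} (hs : s ≠ 0) : (soR s * soR s : Mat2 K N) =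
    1 + (s ^ 2 - (s ^ 2)⁻¹) • soR s -
      ((s ^ 2 - (s ^ 2)⁻¹) * (s ^ 2) ^ (1 - (N : ℤ))) • soE s := by
  have hq : s ^ 2 ≠ 0 := pow_ne_zero 2 hs
  refine mat2_ext fun a b f => ?_
  simp only [columnSum_mul, columnSum_add, columnSum_sub, columnSum_smul, columnSum_one]
  by_cases h : b = a.rev
  · subst h
    rw [soR_columnSum_rev hs, soR_columnSum_rev hs, soE_columnSum, if_pos rfl]
    simp only [soR_columnSum_rev hs, Finset.smul_sum, smul_smul]
    rw [Finset.sum_comm]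
    simp only [mul_comm (soT s _ a), ← Finset.sum_smul, soT_sq hs, sub_smul, add_smul,
      Finset.sum_sub_distrib, Finset.sum_add_distrib, ite_smul, one_smul, zero_smul,
      Finset.sum_ite_eq', Finset.mem_univ, if_true, mul_comm (xρ s a)]
  · rw [soE_columnSum, if_neg h, soR_columnSum_of_ne hs h, soR_columnSum_of_ne hs h,
      soR_columnSum_of_ne hs (ne_rev_symm h)]
    rcases lt_trichotomy a b with h | h | h
    · simp only [h, not_lt_of_gt h, if_true, if_false, ne_of_lt h, ne_of_gt h]
      match_scalars <;> ring
    · subst h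
      simp only [lt_irrefl, if_true, if_false]
      match_scalars
      field_simp
      ring
    · simp only [h, not_lt_of_gt h, if_true, if_false, ne_of_lt h, ne_of_gt h]
      match_scalars <;> ring

theorem soR_twist {s : K} (hs : s ≠ 0) :
    (soR s * soE s : Mat2 K N) = (s ^ 2) ^ (1 - (N : ℤ)) • soE s := by
  refine mat2_ext fun a b f => ?_
  simp only [columnSum_mul, columnSum_smul, soE_columnSum]
  split_ifs with h
  · simp only [soR_columnSum_rev hs, Finset.smul_sum, smul_smul]
    rw [Finset.sum_comm]
    refine Finset.sum_congr rfl fun v _ => ?_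
    rw [← Finset.sum_smul]
    congr 1
    rw [mul_left_comm, ← soT_twist hs, Finset.mul_sum]
    exact Finset.sum_congr rfl fun u _ => by ring
  · rw [smul_zero]

end OrthogonalSkein

end QProj

namespace QProj

/-! ### Relations on three tensor factors for `U_q so(N)` -/

section OrthogonalTriple
variable {K : Type*} [Field K] {N : ℕ} {s : K}

/-- `A_{12}` on 3-tensors. -/
abbrev onFirst (A : Mat2 K N) : TMat K N 3 := atSite A 0 (by omega)

/-- `A_{23}` on 3-tensors. -/
abbrev onLast (A : Mat2 K N) : TMat K N 3 := atSite A 1 (by omega)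

/-- A matrix of 2-tensors acting on the first two factors of 3-tensors. -/
def actLeft (A : Mat2 K N) : ((Fin 3 → Fin N) → K) →ₗ[K] (Fin 3 → Fin N) → K :=
  (onFirst A).mulVecLin

/-- A matrix of 2-tensors acting on the last two factors of 3-tensors. -/
def actRight (A : Mat2 K N) : ((Fin 3 → Fin N) → K) →ₗ[K] (Fin 3 → Fin N) → K :=
  (onLast A).mulVecLin

theorem actLeft_basis3 (A : Mat2 K N) (a b c : Fin N) :
    actLeft A (basis3 K a b c) = columnSum A a b fun u v => basis3 K u v c :=
  atSite_mulVec_left A a b c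

theorem actRight_basis3 (A : Mat2 K N) (a b c : Fin N) :
    actRight A (basis3 K a b c) = columnSum A b c fun u v => basis3 K a u v :=
  atSite_mulVec_right A a b c

/-- The vectors spanning the image of `E_{12}`. -/
def cupLeft (s : K) (y : Fin N) : (Fin 3 → Fin N) → K := ∑ u : Fin N, xρ s u • basis3 K u u.rev y

/-- The vectors spanning the image of `E_{23}`. -/
def cupRight (s : K) (y : Fin N) : (Fin 3 → Fin N) → K := ∑ u : Fin N, xρ s u • basis3 K y u u.rev

theorem actLeft_soE_basis3 (s : K) (a b c : Fin N) : actLeft (soE s) (basis3 K a b c) =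
    if b = a.rev then xρ s a • cupLeft s c else 0 := by
  rw [actLeft_basis3, soE_columnSum, cupLeft, Finset.smul_sum]
  simp only [smul_smul]

theorem actRight_soE_basis3 (s : K) (a b c : Fin N) : actRight (soE s) (basis3 K a b c) =
    if c = b.rev then xρ s b • cupRight s a else 0 := by
  rw [actRight_basis3, soE_columnSum, cupRight, Finset.smul_sum]
  simp only [smul_smul]

theorem actRight_soE_cupLeft (hs : s ≠ 0) (y : Fin N) :
    actRight (soE s) (cupLeft s y) = cupRight s y := by
  simp only [cupLeft, map_sum, map_smul, actRight_soE_basis3, Fin.rev_rev, smul_ite, smul_zero,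
    Finset.sum_ite_eq, Finset.mem_univ, if_true, xρ_rev, smul_smul]
  rw [mul_inv_cancel₀ (xρ_ne_zero hs y), one_smul]

theorem actLeft_soE_cupRight (hs : s ≠ 0) (y : Fin N) :
    actLeft (soE s) (cupRight s y) = cupLeft s y := by
  simp only [cupRight, map_sum, map_smul, actLeft_soE_basis3, smul_ite, smul_zero,
    Finset.sum_ite_eq', Finset.mem_univ, if_true, xρ_rev, smul_smul]
  rw [inv_mul_cancel₀ (xρ_ne_zero hs y), one_smul, Fin.rev_rev]

theorem actLeft_soR_basis3 (hs : s ≠ 0) (y u : Fin N) :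
    actLeft (soR s) (basis3 K y u u.rev) = wt (s ^ 2) y u • basis3 K u y u.rev +
      (if y < u then s ^ 2 - (s ^ 2)⁻¹ else 0) • basis3 K y u u.rev -
      if u = y.rev then ∑ v, (if v < y.rev then (s ^ 2 - (s ^ 2)⁻¹) * (xρ s y * xρ s v) else 0) •
        basis3 K v v.rev y else 0 := by
  rw [actLeft_basis3, soR_columnSum hs]
  by_cases h : u = y.rev
  · subst h; simp only [if_true, Fin.rev_rev]
  · simp only [if_neg h]

theorem actRight_soR_basis3 (hs : s ≠ 0) (y u : Fin N) :
    actRight (soR s) (basis3 K u u.rev y) = wt (s ^ 2) u.rev y • basis3 K u y u.rev +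
      (if u.rev < y then s ^ 2 - (s ^ 2)⁻¹ else 0) • basis3 K u u.rev y -
      if u = y then ∑ v, (if v < y then (s ^ 2 - (s ^ 2)⁻¹) * (xρ s y.rev * xρ s v) else 0) •
        basis3 K y v v.rev else 0 := by
  rw [actRight_basis3, soR_columnSum hs, Fin.rev_rev]
  by_cases h : u = y
  · subst h; simp only [if_true]
  · simp only [if_neg h, if_neg (Ne.symm h)]

/-- The slide relation made linear in $\hat R$. The coefficients of the vectors indexed by $u$ are
compared one $u$ at a time; the sums produced by the pair $u=\pm y$ have been redistributed over all
$u$ beforehand. -/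
theorem soR_slide_cup (hs : s ≠ 0) (y : Fin N) :
    actRight (soR s) (cupLeft s y) + (s ^ 2 - (s ^ 2)⁻¹) • cupRight s y =
      actLeft (soR s) (cupRight s y) + (s ^ 2 - (s ^ 2)⁻¹) • cupLeft s y := by
  have hx := xρ_ne_zero hs y
  have h1 : actRight (soR s) (cupLeft s y) = ∑ u, xρ s u •
      (wt (s ^ 2) u.rev y • basis3 K u y u.rev +
      (if u.rev < y then s ^ 2 - (s ^ 2)⁻¹ else 0) • basis3 K u u.rev y -
      (if u < y then s ^ 2 - (s ^ 2)⁻¹ else 0) • basis3 K y u u.rev) := by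
    simp only [cupLeft, map_sum, map_smul, actRight_soR_basis3 hs, smul_sub,
      Finset.sum_sub_distrib, smul_ite, smul_zero, Finset.sum_ite_eq', Finset.mem_univ, if_true]
    congr 1
    rw [Finset.smul_sum]
    refine Finset.sum_congr rfl fun v _ => ?_
    rw [smul_smul, smul_smul, xρ_rev]
    congr 1
    split_ifs
    · field_simp
    · simp
  have h2 : actLeft (soR s) (cupRight s y) = ∑ u, xρ s u •
      (wt (s ^ 2) y u • basis3 K u y u.rev +
      (if y < u then s ^ 2 - (s ^ 2)⁻¹ else 0) • basis3 K y u u.rev -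
      (if u < y.rev then s ^ 2 - (s ^ 2)⁻¹ else 0) • basis3 K u u.rev y) := by
    simp only [cupRight, map_sum, map_smul, actLeft_soR_basis3 hs, smul_sub,
      Finset.sum_sub_distrib, smul_ite, smul_zero, Finset.sum_ite_eq', Finset.mem_univ, if_true]
    congr 1
    rw [Finset.smul_sum]
    refine Finset.sum_congr rfl fun v _ => ?_
    rw [smul_smul, smul_smul, xρ_rev]
    congr 1
    split_ifs
    · field_simp
    · simp
  rw [h1, h2, cupRight, cupLeft, Finset.smul_sum, Finset.smul_sum, ← Finset.sum_add_distrib,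
    ← Finset.sum_add_distrib]
  refine Finset.sum_congr rfl fun u _ => ?_
  rw [smul_comm _ (xρ s u), smul_comm _ (xρ s u), ← smul_add, ← smul_add]
  congr 1
  rw [wt_rev_left, wt_comm _ y u]
  simp only [rev_lt_iff_rev_lt (a := u)]
  by_cases hy : u = y <;> by_cases hy' : u = y.rev
  · subst hy
    simp only [← hy', lt_irrefl, if_false]
    rw [wt, if_pos rfl, if_pos hy']
    module
  · subst hy
    rw [wt_self_of_ne hy']
    rcases lt_or_gt_of_ne hy' with h | h <;>
      simp only [lt_irrefl, h, not_lt_of_gt h, if_true, if_false] <;> module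
  · subst hy'
    rw [wt, Fin.rev_rev, if_neg (Ne.symm hy), if_pos rfl]
    rcases lt_or_gt_of_ne hy with h | h <;>
      simp only [lt_irrefl, h, not_lt_of_gt h, if_true, if_false, inv_inv] <;> module
  · rw [wt_of_ne (Ne.symm hy) (fun h => hy' (rev_eq_iff_eq_rev.mp h.symm)), inv_one]
    rcases lt_or_gt_of_ne hy with h | h <;> rcases lt_or_gt_of_ne hy' with h' | h' <;>
      simp only [h, not_lt_of_gt h, h', not_lt_of_gt h', if_true, if_false] <;> module

/-- The slide relation follows from a linearized form of it. -/
theorem slide_of_linear {𝒜 : Type*} [Ring 𝒜] [Algebra K 𝒜] {k t : K} {σ e σ' e' : 𝒜}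
    (hskein : σ * σ = 1 + k • σ - (k * t) • e) (htwist : σ * e = t • e)
    (hlin : σ' * e + k • (e' * e) = σ * (e' * e) + k • e) (hzig : e * e' * e = e) :
    σ * σ' * e = e' * e := by
  -- By skein and twist, $\sigma-k+ke$ is a right inverse of $\sigma$; with the zigzag relation,
  -- `h1` reads $\sigma'e=(\sigma-k+ke)\,e'e$, and multiplication by $\sigma$ gives the claim.
  have h1 : σ' * e = σ * (e' * e) + k • e - k • (e' * e) := by rw [← hlin, add_sub_cancel_right]
  rw [mul_assoc, h1, mul_sub, mul_add, ← mul_assoc, hskein, mul_smul_comm, mul_smul_comm, htwist,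
    sub_mul, add_mul, one_mul, smul_mul_assoc, smul_mul_assoc, ← mul_assoc e, hzig]
  module

/-- The defect of the braid relation is quasi-central. -/
theorem braidDefect_mul {𝒜 : Type*} [Ring 𝒜] [Algebra K 𝒜] {k t : K} {σ e σ' e' : 𝒜}
    (hskein : σ * σ = 1 + k • σ - (k * t) • e) (hskein' : σ' * σ' = 1 + k • σ' - (k * t) • e')
    (hslide : σ * σ' * e = e' * e) (hslide' : e' * σ * σ' = e' * e) :
    (σ * σ' * σ - σ' * σ * σ') * σ =
      k • (σ * σ' * σ - σ' * σ * σ') - σ' * (σ * σ' * σ - σ' * σ * σ') := by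
  have h1 : σ * σ' * σ * σ = σ * σ' + k • (σ * σ' * σ) - (k * t) • (e' * e) := by
    rw [mul_assoc _ σ σ, hskein, mul_sub, mul_add, mul_one, mul_smul_comm, mul_smul_comm, hslide]
  have h2 : σ' * (σ' * σ * σ') = σ * σ' + k • (σ' * σ * σ') - (k * t) • (e' * e) := by
    rw [← mul_assoc, ← mul_assoc, hskein', ← hslide']
    simp only [sub_mul, add_mul, one_mul, smul_mul_assoc]
  rw [sub_mul, mul_sub, h1, h2, mul_assoc σ', mul_assoc σ']
  module

theorem actLeft_mulVec (A : Mat2 K N) (X : TMat K N 3) (v : (Fin 3 → Fin N) → K) :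
    (onFirst A * X).mulVec v = actLeft A (X.mulVec v) := (Matrix.mulVec_mulVec _ _ _).symm

theorem actRight_mulVec (A : Mat2 K N) (X : TMat K N 3) (v : (Fin 3 → Fin N) → K) :
    (onLast A * X).mulVec v = actRight A (X.mulVec v) := (Matrix.mulVec_mulVec _ _ _).symm

theorem onFirst_mulVec (A : Mat2 K N) (v : (Fin 3 → Fin N) → K) :
    (onFirst A).mulVec v = actLeft A v := rfl

theorem onLast_mulVec (A : Mat2 K N) (v : (Fin 3 → Fin N) → K) :
    (onLast A).mulVec v = actRight A v := rfl

theorem soE_zigzag_first (hs : s ≠ 0) : onFirst (soE s) * (onLast (soE s) * onFirst (soE s)) =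
    (onFirst (soE s) : TMat K N 3) := by
  refine tmat3_ext fun a b c => ?_
  rw [actLeft_mulVec, actRight_mulVec, onFirst_mulVec, actLeft_soE_basis3]
  split_ifs
  · rw [map_smul, map_smul, actRight_soE_cupLeft hs, actLeft_soE_cupRight hs]
  · rw [map_zero, map_zero]

theorem soE_zigzag_last (hs : s ≠ 0) : onLast (soE s) * (onFirst (soE s) * onLast (soE s)) =
    (onLast (soE s) : TMat K N 3) := by
  refine tmat3_ext fun a b c => ?_
  rw [actRight_mulVec, actLeft_mulVec, onLast_mulVec, actRight_soE_basis3]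
  split_ifs
  · rw [map_smul, map_smul, actLeft_soE_cupRight hs, actRight_soE_cupLeft hs]
  · rw [map_zero, map_zero]

theorem soR_linear_slide_first (hs : s ≠ 0) : onLast (soR s) * onFirst (soE s) +
    (s ^ 2 - (s ^ 2)⁻¹) • (onLast (soE s) * onFirst (soE s)) =
      onFirst (soR s) * (onLast (soE s) * onFirst (soE s)) +
        (s ^ 2 - (s ^ 2)⁻¹) • (onFirst (soE s) : TMat K N 3) := by
  refine tmat3_ext fun a b c => ?_
  rw [Matrix.add_mulVec, Matrix.add_mulVec, Matrix.smul_mulVec, Matrix.smul_mulVec, actLeft_mulVec,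
    actRight_mulVec, actRight_mulVec, onFirst_mulVec, actLeft_soE_basis3]
  split_ifs
  · simp only [map_smul, actRight_soE_cupLeft hs]
    rw [smul_comm _ (xρ s a), smul_comm _ (xρ s a), ← smul_add, ← smul_add, soR_slide_cup hs]
  · simp only [map_zero]

theorem soR_linear_slide_last (hs : s ≠ 0) : onFirst (soR s) * onLast (soE s) +
    (s ^ 2 - (s ^ 2)⁻¹) • (onFirst (soE s) * onLast (soE s)) =
      onLast (soR s) * (onFirst (soE s) * onLast (soE s)) +
        (s ^ 2 - (s ^ 2)⁻¹) • (onLast (soE s) : TMat K N 3) := by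
  refine tmat3_ext fun a b c => ?_
  rw [Matrix.add_mulVec, Matrix.add_mulVec, Matrix.smul_mulVec, Matrix.smul_mulVec,
    actRight_mulVec, actLeft_mulVec, actLeft_mulVec, onLast_mulVec, actRight_soE_basis3]
  split_ifs
  · simp only [map_smul, actLeft_soE_cupRight hs]
    rw [smul_comm _ (xρ s b), smul_comm _ (xρ s b), ← smul_add, ← smul_add, soR_slide_cup hs]
  · simp only [map_zero]

theorem soR_skein_atSite (hs : s ≠ 0) {l m : ℕ} (h : m + 1 < l) :
    (atSite (soR s) m h * atSite (soR s) m h : TMat K N l) =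
      1 + (s ^ 2 - (s ^ 2)⁻¹) • atSite (soR s) m h -
        ((s ^ 2 - (s ^ 2)⁻¹) * (s ^ 2) ^ (1 - (N : ℤ))) • atSite (soE s) m h := by
  rw [← atSite_mul, soR_skein hs, atSite_sub, atSite_add, atSite_smul, atSite_smul, atSite_one]

theorem soR_twist_atSite (hs : s ≠ 0) {l m : ℕ} (h : m + 1 < l) :
    (atSite (soR s) m h * atSite (soE s) m h : TMat K N l) =
      (s ^ 2) ^ (1 - (N : ℤ)) • atSite (soE s) m h := by
  rw [← atSite_mul, soR_twist hs, atSite_smul]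

theorem soR_slide_first (hs : s ≠ 0) :
    onFirst (soR s) * onLast (soR s) * onFirst (soE s) =
      onLast (soE s) * (onFirst (soE s) : TMat K N 3) :=
  slide_of_linear (soR_skein_atSite hs _) (soR_twist_atSite hs _) (soR_linear_slide_first hs)
    (by rw [mul_assoc, soE_zigzag_first hs])

theorem soR_slide_last (hs : s ≠ 0) :
    onLast (soR s) * onFirst (soR s) * onLast (soE s) =
      onFirst (soE s) * (onLast (soE s) : TMat K N 3) :=
  slide_of_linear (soR_skein_atSite hs _) (soR_twist_atSite hs _) (soR_linear_slide_last hs)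
    (by rw [mul_assoc, soE_zigzag_last hs])

theorem soR_atSite_transpose (hs : s ≠ 0) {l m : ℕ} (h : m + 1 < l) :
    (atSite (soR s) m h : TMat K N l).transpose = atSite (soR s) m h := by
  rw [atSite_transpose, soR_transpose hs]

theorem soE_atSite_transpose {l m : ℕ} (h : m + 1 < l) :
    (atSite (soE s) m h : TMat K N l).transpose = atSite (soE s) m h := by
  rw [atSite_transpose, soE_transpose]

theorem soR_slide_first_right (hs : s ≠ 0) :
    onFirst (soE s) * onLast (soR s) * onFirst (soR s) =
      onFirst (soE s) * (onLast (soE s) : TMat K N 3) := by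
  have := congrArg Matrix.transpose (soR_slide_first (N := N) hs)
  simpa only [Matrix.transpose_mul, soR_atSite_transpose hs, soE_atSite_transpose,
    ← mul_assoc] using this

theorem soR_slide_last_right (hs : s ≠ 0) :
    onLast (soE s) * onFirst (soR s) * onLast (soR s) =
      onLast (soE s) * (onFirst (soE s) : TMat K N 3) := by
  have := congrArg Matrix.transpose (soR_slide_last (N := N) hs)
  simpa only [Matrix.transpose_mul, soR_atSite_transpose hs, soE_atSite_transpose,
    ← mul_assoc] using this

end OrthogonalTriple

end QProj

namespace QProj

/-! ### The braid relation for `U_q so(N)` -/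

section OrthogonalBraid
variable {K : Type*} [Field K] {N : ℕ} {s : K}

/-- Triples without opposite indices are permuted among themselves, and on them $\hat R$ acts as for
$gl$. -/
theorem soR_braid_of_distinct (hs : s ≠ 0) {a b c : Fin N} (hab : b ≠ a.rev) (hbc : c ≠ b.rev)
    (hac : c ≠ a.rev) :
    actRight (soR s) (actLeft (soR s) (actRight (soR s) (basis3 K a b c))) =
      actLeft (soR s) (actRight (soR s) (actLeft (soR s) (basis3 K a b c))) := by
  refine hecke_braid (pow_ne_zero 2 hs) (B := basis3 K)
    (p := fun a b c => b ≠ a.rev ∧ c ≠ b.rev ∧ c ≠ a.rev) ?_ ?_ ⟨hab, hbc, hac⟩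
  · rintro a b c ⟨hab, hbc, hac⟩
    exact ⟨⟨ne_rev_symm hab, hac, hbc⟩, by rw [actLeft_basis3, soR_columnSum_of_ne hs hab]⟩
  · rintro a b c ⟨hab, hbc, hac⟩
    exact ⟨⟨hac, ne_rev_symm hbc, hab⟩, by rw [actRight_basis3, soR_columnSum_of_ne hs hbc]⟩

theorem actLeft_soR_mid (hs : s ≠ 0) {y z : Fin N} (h : z ≠ y) (h' : z ≠ y.rev) :
    actLeft (soR s) (basis3 K z y z.rev) = basis3 K y z z.rev +
      (if z < y then s ^ 2 - (s ^ 2)⁻¹ else 0) • basis3 K z y z.rev := by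
  rw [actLeft_basis3, soR_columnSum_of_ne hs (fun h'' => h' (rev_eq_iff_eq_rev.mp h''.symm)),
    if_neg h, one_smul]

theorem actRight_soR_mid (hs : s ≠ 0) {y z : Fin N} (h : z ≠ y) (h' : z ≠ y.rev) :
    actRight (soR s) (basis3 K z y z.rev) = basis3 K z z.rev y +
      (if y < z.rev then s ^ 2 - (s ^ 2)⁻¹ else 0) • basis3 K z y z.rev := by
  rw [actRight_basis3, soR_columnSum_of_ne hs (fun h'' => h (Fin.rev_inj.mp h'')),
    if_neg (fun h'' => h' (rev_eq_iff_eq_rev.mp h''.symm)), one_smul]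

/-- The contribution of one $v$ to `hcoef` in `soR_braid_mid`, with the common scalar
$(q-q^{-1})q^{-\rho_z-\rho_v}$ removed. -/
theorem braid_coefficient (hs : s ≠ 0) {y z : Fin N} (h : z ≠ y) (h' : z ≠ y.rev) (v : Fin N) :
    -((if v < z.rev then (1 : K) else 0) • (wt (s ^ 2) y v • basis3 K v y v.rev +
        (if y < v then s ^ 2 - (s ^ 2)⁻¹ else 0) • basis3 K y v v.rev) -
        (if y.rev < z.rev ∧ v < y.rev then s ^ 2 - (s ^ 2)⁻¹ else 0) • basis3 K v v.rev y) -
      (if z < y ∧ v < z.rev then s ^ 2 - (s ^ 2)⁻¹ else 0) • basis3 K v v.rev y =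
    -((if v < z.rev then (1 : K) else 0) • (wt (s ^ 2) v.rev y • basis3 K v y v.rev +
        (if v.rev < y then s ^ 2 - (s ^ 2)⁻¹ else 0) • basis3 K v v.rev y) -
        (if y < z.rev ∧ v < y then s ^ 2 - (s ^ 2)⁻¹ else 0) • basis3 K y v v.rev) -
      (if y < z.rev ∧ v < z.rev then s ^ 2 - (s ^ 2)⁻¹ else 0) • basis3 K y v v.rev := by
  have hq : s ^ 2 ≠ 0 := pow_ne_zero 2 hs
  have hzy : z < y ↔ y.rev < z.rev := Fin.rev_lt_rev.symm
  have hvy : v.rev < y ↔ y.rev < v := rev_lt_iff_rev_lt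
  have h1 : z.rev ≠ y.rev := fun h'' => h (Fin.rev_inj.mp h'')
  have h2 : z.rev ≠ y := fun h'' => h' (rev_eq_iff_eq_rev.mp h'')
  rw [wt_rev_left, wt_comm _ v y]
  simp only [hzy, hvy]
  generalize z.rev = w at *
  clear hzy hvy h h'
  by_cases hy : v = y
  · subst hy
    by_cases hy' : v = v.rev
    · rw [wt, if_pos rfl, if_pos hy', ← hy']
      simp only [lt_irrefl, and_false, if_false]
      by_cases hw : v < w <;> simp only [hw, and_self, if_true, if_false] <;> module
    · rw [wt_self_of_ne hy']
      rcases lt_or_gt_of_ne hy' with e | e <;> rcases lt_or_gt_of_ne h1 with e1 | e1 <;>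
        rcases lt_or_gt_of_ne h2 with e2 | e2 <;>
        first
        | (exfalso; order)
        | (simp only [lt_irrefl, e, e1, e2, not_lt_of_gt e, not_lt_of_gt e1, not_lt_of_gt e2,
            and_true, and_false, and_self, if_true, if_false]
           module)
  · by_cases hy' : v = y.rev
    · subst hy'
      rw [wt, if_neg hy, if_pos rfl, Fin.rev_rev, inv_inv]
      rcases lt_or_gt_of_ne hy with e | e <;> rcases lt_or_gt_of_ne h1 with e1 | e1 <;>
        rcases lt_or_gt_of_ne h2 with e2 | e2 <;>
        first
        | (exfalso; order)
        | (simp only [lt_irrefl, e, e1, e2, not_lt_of_gt e, not_lt_of_gt e1, not_lt_of_gt e2,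
            and_true, and_false, and_self, if_true, if_false]
           module)
    · rw [wt_of_ne hy hy', inv_one]
      rcases lt_or_gt_of_ne h1 with e1 | e1 <;> rcases lt_or_gt_of_ne h2 with e2 | e2 <;>
        rcases lt_or_gt_of_ne hy with e | e <;> rcases lt_or_gt_of_ne hy' with e' | e' <;>
        by_cases hw : v < w <;>
        first
        | (exfalso; order)
        | (simp only [e, e', e1, e2, hw, not_lt_of_gt e, not_lt_of_gt e',
            not_lt_of_gt e1, not_lt_of_gt e2, and_true, and_false, and_self, if_true, if_false]
           module)

/-- With $y$ between $z$ and $-z$ no neighbours are opposite, so the first generator on either side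
yields just two terms; opposite neighbours enter only afterwards. -/
theorem soR_braid_mid (hs : s ≠ 0) {y z : Fin N} (h : z ≠ y) (h' : z ≠ y.rev) :
    actRight (soR s) (actLeft (soR s) (actRight (soR s) (basis3 K z y z.rev))) =
      actLeft (soR s) (actRight (soR s) (actLeft (soR s) (basis3 K z y z.rev))) := by
  have hq : s ^ 2 ≠ 0 := pow_ne_zero 2 hs
  have hx := xρ_ne_zero hs y
  have h1 : z.rev ≠ y.rev := fun h'' => h (Fin.rev_inj.mp h'')
  have h2 : z.rev ≠ y := fun h'' => h' (rev_eq_iff_eq_rev.mp h'')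
  have hRγ : actRight (soR s) (basis3 K y z z.rev) = wt (s ^ 2) z z.rev • basis3 K y z.rev z +
      (if z < z.rev then s ^ 2 - (s ^ 2)⁻¹ else 0) • basis3 K y z z.rev -
      ∑ v, (if v < z.rev then (s ^ 2 - (s ^ 2)⁻¹) * (xρ s z * xρ s v) else 0) •
        basis3 K y v v.rev := by
    rw [actRight_basis3, soR_columnSum hs, if_pos rfl]
  have hLα : actLeft (soR s) (basis3 K z z.rev y) = wt (s ^ 2) z z.rev • basis3 K z.rev z y +
      (if z < z.rev then s ^ 2 - (s ^ 2)⁻¹ else 0) • basis3 K z z.rev y -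
      ∑ v, (if v < z.rev then (s ^ 2 - (s ^ 2)⁻¹) * (xρ s z * xρ s v) else 0) •
        basis3 K v v.rev y := by
    rw [actLeft_basis3, soR_columnSum hs, if_pos rfl]
  have hLγ : actLeft (soR s) (basis3 K y z z.rev) = basis3 K z y z.rev +
      (if y < z then s ^ 2 - (s ^ 2)⁻¹ else 0) • basis3 K y z z.rev := by
    rw [actLeft_soR_basis3 hs, if_neg h', wt_of_ne h h', one_smul, sub_zero]
  have hLγ' : actLeft (soR s) (basis3 K y z.rev z) = basis3 K z.rev y z +
      (if y < z.rev then s ^ 2 - (s ^ 2)⁻¹ else 0) • basis3 K y z.rev z := by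
    have := actLeft_soR_basis3 hs y z.rev
    rwa [if_neg h1, wt_of_ne h2 h1, one_smul, sub_zero, Fin.rev_rev] at this
  have hRα : actRight (soR s) (basis3 K z z.rev y) = basis3 K z y z.rev +
      (if z.rev < y then s ^ 2 - (s ^ 2)⁻¹ else 0) • basis3 K z z.rev y := by
    rw [actRight_soR_basis3 hs, if_neg h, wt_comm, wt_of_ne h2 h1, one_smul, sub_zero]
  have hRα' : actRight (soR s) (basis3 K z.rev z y) = basis3 K z.rev y z +
      (if z < y then s ^ 2 - (s ^ 2)⁻¹ else 0) • basis3 K z.rev z y := by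
    have := actRight_soR_basis3 hs y z.rev
    rwa [if_neg h2, Fin.rev_rev, wt_comm, wt_of_ne h h', one_smul, sub_zero] at this
  have hLsum : actLeft (soR s) (∑ v, (if v < z.rev then
      (s ^ 2 - (s ^ 2)⁻¹) * (xρ s z * xρ s v) else 0) • basis3 K y v v.rev) =
      ∑ v, ((s ^ 2 - (s ^ 2)⁻¹) * (xρ s z * xρ s v)) •
        ((if v < z.rev then (1 : K) else 0) • (wt (s ^ 2) y v • basis3 K v y v.rev +
        (if y < v then s ^ 2 - (s ^ 2)⁻¹ else 0) • basis3 K y v v.rev) -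
        (if y.rev < z.rev ∧ v < y.rev then s ^ 2 - (s ^ 2)⁻¹ else 0) • basis3 K v v.rev y) := by
    simp only [map_sum, map_smul, actLeft_soR_basis3 hs, smul_sub, Finset.sum_sub_distrib,
      smul_ite, smul_zero, Finset.sum_ite_eq', Finset.mem_univ, if_true]
    congr 1
    · refine Finset.sum_congr rfl fun v _ => ?_
      split_ifs <;> simp
    · rw [Finset.smul_sum]
      refine Finset.sum_congr rfl fun v _ => ?_
      rw [smul_smul, smul_smul, xρ_rev]
      congr 1
      split_ifs <;> first | (exfalso; tauto) | (field_simp; done) | simp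
  have hRsum : actRight (soR s) (∑ v, (if v < z.rev then
      (s ^ 2 - (s ^ 2)⁻¹) * (xρ s z * xρ s v) else 0) • basis3 K v v.rev y) =
      ∑ v, ((s ^ 2 - (s ^ 2)⁻¹) * (xρ s z * xρ s v)) •
        ((if v < z.rev then (1 : K) else 0) • (wt (s ^ 2) v.rev y • basis3 K v y v.rev +
        (if v.rev < y then s ^ 2 - (s ^ 2)⁻¹ else 0) • basis3 K v v.rev y) -
        (if y < z.rev ∧ v < y then s ^ 2 - (s ^ 2)⁻¹ else 0) • basis3 K y v v.rev) := by
    simp only [map_sum, map_smul, actRight_soR_basis3 hs, smul_sub, Finset.sum_sub_distrib,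
      smul_ite, smul_zero, Finset.sum_ite_eq', Finset.mem_univ, if_true]
    congr 1
    · refine Finset.sum_congr rfl fun v _ => ?_
      split_ifs <;> simp
    · rw [Finset.smul_sum]
      refine Finset.sum_congr rfl fun v _ => ?_
      rw [smul_smul, smul_smul, xρ_rev]
      congr 1
      split_ifs <;> first | (exfalso; tauto) | (field_simp; done) | simp
  have hθ : ∀ (p : Prop) [Decidable p] (f : Fin N → (Fin 3 → Fin N) → K),
      (if p then s ^ 2 - (s ^ 2)⁻¹ else 0) •
        ∑ v, (if v < z.rev then (s ^ 2 - (s ^ 2)⁻¹) * (xρ s z * xρ s v) else 0) • f v =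
      ∑ v, ((s ^ 2 - (s ^ 2)⁻¹) * (xρ s z * xρ s v)) •
        (if p ∧ v < z.rev then s ^ 2 - (s ^ 2)⁻¹ else 0) • f v := by
    intro p _ f
    rw [Finset.smul_sum]
    refine Finset.sum_congr rfl fun v _ => ?_
    by_cases hp : p <;> by_cases hv : v < z.rev <;> simp [hp, hv, smul_smul, mul_comm]
  -- The only relation needed between the sums over $v$ on the two sides; everything else is an
  -- identity between finitely many vectors, with the sums and their images treated as unknowns.
  have hcoef : -actLeft (soR s) (∑ v, (if v < z.rev then
      (s ^ 2 - (s ^ 2)⁻¹) * (xρ s z * xρ s v) else 0) • basis3 K y v v.rev) -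
      (if z < y then s ^ 2 - (s ^ 2)⁻¹ else 0) • ∑ v, (if v < z.rev then
        (s ^ 2 - (s ^ 2)⁻¹) * (xρ s z * xρ s v) else 0) • basis3 K v v.rev y =
      -actRight (soR s) (∑ v, (if v < z.rev then
      (s ^ 2 - (s ^ 2)⁻¹) * (xρ s z * xρ s v) else 0) • basis3 K v v.rev y) -
      (if y < z.rev then s ^ 2 - (s ^ 2)⁻¹ else 0) • ∑ v, (if v < z.rev then
        (s ^ 2 - (s ^ 2)⁻¹) * (xρ s z * xρ s v) else 0) • basis3 K y v v.rev := by
    rw [hLsum, hRsum, hθ, hθ, ← Finset.sum_neg_distrib, ← Finset.sum_neg_distrib,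
      ← Finset.sum_sub_distrib, ← Finset.sum_sub_distrib]
    refine Finset.sum_congr rfl fun v _ => ?_
    rw [← smul_neg, ← smul_neg, ← smul_sub, ← smul_sub, braid_coefficient hs h h']
  clear hLsum hRsum hθ
  simp only [actRight_soR_mid hs h h', actLeft_soR_mid hs h h', map_add, map_smul, hRγ, hLα,
    map_sub, hLγ, hLγ', hRα, hRα']
  generalize (∑ v, (if v < z.rev then (s ^ 2 - (s ^ 2)⁻¹) * (xρ s z * xρ s v) else 0) •
    basis3 K y v v.rev) = Sγ at *
  generalize (∑ v, (if v < z.rev then (s ^ 2 - (s ^ 2)⁻¹) * (xρ s z * xρ s v) else 0) •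
    basis3 K v v.rev y) = Sα at *
  clear hRγ hLα hLγ hLγ' hRα hRα'
  generalize actLeft (soR s) Sγ = LS at *
  generalize actRight (soR s) Sα = RS at *
  by_cases e : z < z.rev <;> rcases lt_or_gt_of_ne h with e1 | e1 <;>
    rcases lt_or_gt_of_ne h2 with e2 | e2 <;>
    first
    | (exfalso; order)
    | (simp only [e, e1, e2, not_lt_of_gt e1, not_lt_of_gt e2, if_true, if_false] at hcoef ⊢
       linear_combination (norm := module) -hcoef)

end OrthogonalBraid

end QProj

namespace QProj

/-! ### The defect of the braid relation for $so$ vanishes. -/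

section OrthogonalDefect
variable {K : Type*} [Field K] {N : ℕ} {s : K}

/-- The defect of the braid relation. -/
def braidDefect (A : Mat2 K N) : TMat K N 3 :=
  onFirst A * onLast A * onFirst A - onLast A * onFirst A * onLast A

theorem braidDefect_mul_onFirst (hs : s ≠ 0) : braidDefect (soR s : Mat2 K N) * onFirst (soR s) =
    (s ^ 2 - (s ^ 2)⁻¹) • braidDefect (soR s) - onLast (soR s) * braidDefect (soR s) :=
  braidDefect_mul (soR_skein_atSite hs _) (soR_skein_atSite hs _) (soR_slide_first hs)
    (soR_slide_last_right hs)

theorem braidDefect_mul_onLast (hs : s ≠ 0) : braidDefect (soR s : Mat2 K N) * onLast (soR s) =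
    (s ^ 2 - (s ^ 2)⁻¹) • braidDefect (soR s) - onFirst (soR s) * braidDefect (soR s) := by
  have h := braidDefect_mul (soR_skein_atSite (N := N) hs (by omega : 1 + 1 < 3))
    (soR_skein_atSite hs (by omega : 0 + 1 < 3)) (soR_slide_last hs) (soR_slide_first_right hs)
  have h' : onLast (soR s) * onFirst (soR s) * onLast (soR s) -
      onFirst (soR s) * onLast (soR s) * onFirst (soR s) = -braidDefect (soR s : Mat2 K N) := by
    rw [braidDefect, neg_sub]
  rw [h', neg_mul, smul_neg, mul_neg, sub_neg_eq_add] at h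
  rw [← neg_inj, h]
  abel

theorem braidDefect_mul_soE_first (hs : s ≠ 0) :
    braidDefect (soR s : Mat2 K N) * onFirst (soE s) = 0 := by
  rw [braidDefect, sub_mul, mul_assoc _ (onFirst (soR s)) (onFirst (soE s)),
    soR_twist_atSite hs, mul_smul_comm, soR_slide_first hs, mul_assoc (onLast (soR s)),
    mul_assoc (onLast (soR s)), soR_slide_first hs, ← mul_assoc, soR_twist_atSite hs,
    smul_mul_assoc, sub_self]

theorem braidDefect_mul_soE_last (hs : s ≠ 0) :
    braidDefect (soR s : Mat2 K N) * onLast (soE s) = 0 := by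
  rw [braidDefect, sub_mul, mul_assoc _ (onLast (soR s)) (onLast (soE s)),
    soR_twist_atSite hs, mul_smul_comm, soR_slide_last hs, mul_assoc (onFirst (soR s)),
    mul_assoc (onFirst (soR s)), soR_slide_last hs, ← mul_assoc, soR_twist_atSite hs,
    smul_mul_assoc, sub_self]

theorem braidDefect_transpose (hs : s ≠ 0) :
    (braidDefect (soR s : Mat2 K N)).transpose = braidDefect (soR s) := by
  simp only [braidDefect, Matrix.transpose_sub, Matrix.transpose_mul, soR_atSite_transpose hs,
    mul_assoc]

theorem braidDefect_actLeft (hs : s ≠ 0) {v : (Fin 3 → Fin N) → K}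
    (hv : (braidDefect (soR s)).mulVec v = 0) :
    (braidDefect (soR s)).mulVec (actLeft (soR s) v) = 0 := by
  have := congrArg (Matrix.mulVec · v) (braidDefect_mul_onFirst (N := N) hs)
  simp only [Matrix.sub_mulVec, Matrix.smul_mulVec, ← Matrix.mulVec_mulVec, hv, smul_zero,
    Matrix.mulVec_zero, sub_zero] at this
  exact this

theorem braidDefect_actRight (hs : s ≠ 0) {v : (Fin 3 → Fin N) → K}
    (hv : (braidDefect (soR s)).mulVec v = 0) :
    (braidDefect (soR s)).mulVec (actRight (soR s) v) = 0 := by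
  have := congrArg (Matrix.mulVec · v) (braidDefect_mul_onLast (N := N) hs)
  simp only [Matrix.sub_mulVec, Matrix.smul_mulVec, ← Matrix.mulVec_mulVec, hv, smul_zero,
    Matrix.mulVec_zero, sub_zero] at this
  exact this

theorem braidDefect_cupLeft (hs : s ≠ 0) (y : Fin N) :
    (braidDefect (soR s)).mulVec (cupLeft s y) = 0 := by
  have := congrArg (Matrix.mulVec · (basis3 K y y.rev y)) (braidDefect_mul_soE_first (N := N) hs)
  simp only [← Matrix.mulVec_mulVec, Matrix.zero_mulVec, onFirst_mulVec, actLeft_soE_basis3,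
    if_true, Matrix.mulVec_smul] at this
  exact (smul_eq_zero.mp this).resolve_left (xρ_ne_zero hs y)

theorem braidDefect_cupRight (hs : s ≠ 0) (y : Fin N) :
    (braidDefect (soR s)).mulVec (cupRight s y) = 0 := by
  have := congrArg (Matrix.mulVec · (basis3 K y y y.rev)) (braidDefect_mul_soE_last (N := N) hs)
  simp only [← Matrix.mulVec_mulVec, Matrix.zero_mulVec, onLast_mulVec, actRight_soE_basis3,
    if_true, Matrix.mulVec_smul] at this
  exact (smul_eq_zero.mp this).resolve_left (xρ_ne_zero hs y)

theorem braidDefect_mulVec (A : Mat2 K N) (v : (Fin 3 → Fin N) → K) :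
    (braidDefect A).mulVec v =
      actLeft A (actRight A (actLeft A v)) - actRight A (actLeft A (actRight A v)) := by
  simp only [braidDefect, Matrix.sub_mulVec, ← Matrix.mulVec_mulVec, onFirst_mulVec, onLast_mulVec]

theorem braidDefect_mid (hs : s ≠ 0) {y z : Fin N} (h : z ≠ y) (h' : z ≠ y.rev) :
    (braidDefect (soR s)).mulVec (basis3 K z y z.rev) = 0 := by
  rw [braidDefect_mulVec, soR_braid_mid hs h h', sub_self]

/-- The kernel of the defect is stable under $\hat R_{23}$, which sends $(z,y,-z)$ to $(z,-z,y)$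
plus a multiple of itself. -/
theorem braidDefect_left (hs : s ≠ 0) {y z : Fin N} (h : z ≠ y) (h' : z ≠ y.rev) :
    (braidDefect (soR s)).mulVec (basis3 K z z.rev y) = 0 := by
  have h0 := braidDefect_mid hs h h'
  have h1 := braidDefect_actRight hs h0
  rwa [actRight_soR_mid hs h h', Matrix.mulVec_add, Matrix.mulVec_smul, h0, smul_zero,
    add_zero] at h1

theorem braidDefect_right (hs : s ≠ 0) {y z : Fin N} (h : z ≠ y) (h' : z ≠ y.rev) :
    (braidDefect (soR s)).mulVec (basis3 K y z z.rev) = 0 := by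
  have h0 := braidDefect_mid hs h h'
  have h1 := braidDefect_actLeft hs h0
  rwa [actLeft_soR_mid hs h h', Matrix.mulVec_add, Matrix.mulVec_smul, h0, smul_zero,
    add_zero] at h1

/-- In the defect of $\sum_u q^{-\rho_u}(y,u,-u)$, which is zero, only the terms $u=\pm y$ survive.
-/
theorem braidDefect_pair (hs : s ≠ 0) {y : Fin N} (hy : y ≠ y.rev) :
    (braidDefect (soR s)).mulVec (basis3 K y y.rev y) =
      -(xρ s y ^ 2) • (braidDefect (soR s)).mulVec (basis3 K y y y.rev) := by
  have hx := xρ_ne_zero hs y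
  have h := braidDefect_cupRight hs y
  rw [cupRight, Matrix.mulVec_sum, ← Finset.add_sum_erase _ _ (Finset.mem_univ y),
    ← Finset.add_sum_erase _ _ (Finset.mem_erase.mpr ⟨Ne.symm hy, Finset.mem_univ y.rev⟩),
    Finset.sum_eq_zero, add_zero, Matrix.mulVec_smul, Matrix.mulVec_smul, xρ_rev,
    Fin.rev_rev] at h
  · linear_combination (norm := skip) (xρ s y) • h
    match_scalars <;> field_simp <;> ring
  · intro z hz
    rw [Finset.mem_erase, Finset.mem_erase] at hz
    rw [Matrix.mulVec_smul, braidDefect_right hs hz.2.1 hz.1, smul_zero]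

theorem braidDefect_pair' (hs : s ≠ 0) {y : Fin N} (hy : y ≠ y.rev) :
    (braidDefect (soR s)).mulVec (basis3 K y y.rev y) =
      -((xρ s y)⁻¹ ^ 2) • (braidDefect (soR s)).mulVec (basis3 K y.rev y y) := by
  have hx := xρ_ne_zero hs y
  have h := braidDefect_cupLeft hs y
  rw [cupLeft, Matrix.mulVec_sum, ← Finset.add_sum_erase _ _ (Finset.mem_univ y),
    ← Finset.add_sum_erase _ _ (Finset.mem_erase.mpr ⟨Ne.symm hy, Finset.mem_univ y.rev⟩),
    Finset.sum_eq_zero, add_zero, Matrix.mulVec_smul, Matrix.mulVec_smul, xρ_rev,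
    Fin.rev_rev] at h
  · linear_combination (norm := skip) (xρ s y)⁻¹ • h
    match_scalars <;> field_simp <;> ring
  · intro z hz
    rw [Finset.mem_erase, Finset.mem_erase] at hz
    rw [Matrix.mulVec_smul, braidDefect_left hs hz.2.1 hz.1, smul_zero]

theorem braidDefect_fixed (hs : s ≠ 0) {y : Fin N} (hy : y = y.rev) :
    (braidDefect (soR s)).mulVec (basis3 K y y y) = 0 := by
  have h := braidDefect_cupLeft hs y
  rw [cupLeft, Matrix.mulVec_sum, Finset.sum_eq_single y, Matrix.mulVec_smul, ← hy] at h
  · exact (smul_eq_zero.mp h).resolve_left (xρ_ne_zero hs y)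
  · intro z _ hz
    rw [Matrix.mulVec_smul, braidDefect_left hs hz (hy ▸ hz), smul_zero]
  · simp

/-- A linear map that vanishes on the images of the braid defect at `(y, y, -y)` vanishes on
all images. -/
theorem braidDefect_span (hs : s ≠ 0) {W : Type*} [AddCommGroup W] [Module K W]
    (φ : ((Fin 3 → Fin N) → K) →ₗ[K] W)
    (hφ : ∀ y : Fin N, y ≠ y.rev → φ ((braidDefect (soR s)).mulVec (basis3 K y y y.rev)) = 0)
    (a b c : Fin N) : φ ((braidDefect (soR s)).mulVec (basis3 K a b c)) = 0 := by
  have hpair : ∀ y : Fin N, y ≠ y.rev →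
      φ ((braidDefect (soR s)).mulVec (basis3 K y y.rev y)) = 0 := fun y hy => by
    rw [braidDefect_pair hs hy, map_smul, hφ y hy, smul_zero]
  have hpair' : ∀ y : Fin N, y ≠ y.rev →
      φ ((braidDefect (soR s)).mulVec (basis3 K y.rev y y)) = 0 := fun y hy => by
    have h := hpair y hy
    rw [braidDefect_pair' hs hy, map_smul] at h
    exact (smul_eq_zero.mp h).resolve_left
      (neg_ne_zero.mpr (pow_ne_zero 2 (inv_ne_zero (xρ_ne_zero hs y))))
  by_cases hab : b = a.rev
  · subst hab
    by_cases h : a = c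
    · subst h
      by_cases ha : a = a.rev
      · rw [← ha, braidDefect_fixed hs ha, map_zero]
      · exact hpair a ha
    · by_cases h' : a = c.rev
      · subst h'
        rw [Fin.rev_rev]
        exact hpair' c (Ne.symm h)
      · rw [braidDefect_left hs h h', map_zero]
  · by_cases hbc : c = b.rev
    · subst hbc
      by_cases h : b = a
      · subst h
        exact hφ b hab
      · rw [braidDefect_right hs h hab, map_zero]
    · by_cases hac : c = a.rev
      · subst hac
        rw [braidDefect_mid hs (fun h => hbc (by rw [h])) (ne_rev_symm hab), map_zero]
      · rw [braidDefect_mulVec, soR_braid_of_distinct hs hab hbc hac, sub_self, map_zero]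

theorem mulVec_basis3_apply (X : TMat K N 3) (a b c : Fin N) (i : Fin 3 → Fin N) :
    X.mulVec (basis3 K a b c) i = X i ![a, b, c] := by
  rw [basis3, Matrix.mulVec_single_one, Matrix.col_apply]

theorem braidDefect_eq_zero (hs : s ≠ 0) (hq : s ^ 2 + (s ^ 2)⁻¹ ≠ 0) :
    braidDefect (soR s : Mat2 K N) = 0 := by
  have hrow : ∀ y y' : Fin N, y ≠ y.rev → y' ≠ y'.rev →
      (braidDefect (soR s)).mulVec (basis3 K y y y.rev) ![y'.rev, y', y'] = 0 := by
    intro y y' hy hy'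
    set D := braidDefect (soR s : Mat2 K N) with hD
    set w := D.mulVec (basis3 K y y y.rev) with hw
    -- From $D\hat R_{12}=kD-\hat R_{23}D$ and $\hat R_{12}(y,y,-y)=q\,(y,y,-y)$: the eigenvalue is
    -- $k-q=-q^{-1}$.
    have h1 : actRight (soR s) w = -(s ^ 2)⁻¹ • w := by
      have h := congrArg (Matrix.mulVec · (basis3 K y y y.rev))
        (braidDefect_mul_onFirst (N := N) hs)
      simp only [Matrix.sub_mulVec, Matrix.smul_mulVec, ← Matrix.mulVec_mulVec, onFirst_mulVec,
        actLeft_basis3, soR_columnSum_of_ne hs hy, if_true, lt_irrefl, if_false, zero_smul,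
        add_zero, Matrix.mulVec_smul, onLast_mulVec, ← hD, ← hw] at h
      linear_combination (norm := module) h
    -- By symmetry the row of $\hat R_{23}$ at $(-y',y',y')$ is $q$ times a unit row. Together with
    -- `h1` this makes $(q+q^{-1})$ times the entry vanish.
    have h2 : (actRight (soR s) w) ![y'.rev, y', y'] = s ^ 2 * w ![y'.rev, y', y'] := by
      have h := actRight_basis3 (soR s) y'.rev y' y'
      rw [soR_columnSum_of_ne hs hy', if_pos rfl, if_neg (lt_irrefl _), zero_smul, add_zero] at h
      have hsym : ∀ i, (onLast (soR s) : TMat K N 3) ![y'.rev, y', y'] i =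
          (s ^ 2 • basis3 K y'.rev y' y') i := by
        intro i
        rw [← h, ← onLast_mulVec, mulVec_basis3_apply, ← Matrix.transpose_apply (onLast (soR s)),
          soR_atSite_transpose hs]
      rw [← onLast_mulVec, Matrix.mulVec, dotProduct]
      simp only [hsym, Pi.smul_apply, smul_eq_mul, basis3, Pi.single_apply, mul_ite, mul_one,
        mul_zero, ite_mul, zero_mul, Finset.sum_ite_eq', Finset.mem_univ, if_true]
    rw [h1, Pi.smul_apply, smul_eq_mul] at h2
    refine (mul_eq_zero.mp ?_).resolve_left hq
    linear_combination -h2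
  -- By `braidDefect_span` the whole row of the defect at $(-y',y',y')$ vanishes, hence so does the
  -- column, the defect being symmetric.
  have hcol : ∀ y' : Fin N, y' ≠ y'.rev →
      (braidDefect (soR s)).mulVec (basis3 K y'.rev y' y') = 0 := by
    intro y' hy'
    funext i
    have h := braidDefect_span hs (LinearMap.proj ![y'.rev, y', y'])
      (fun y hy => hrow y y' hy hy') (i 0) (i 1) (i 2)
    rw [LinearMap.proj_apply, mulVec_basis3_apply, tuple_three_eta,
      ← Matrix.transpose_apply (braidDefect (soR s)), braidDefect_transpose hs] at h
    rw [mulVec_basis3_apply, h, Pi.zero_apply]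
  refine tmat3_ext fun a b c => ?_
  rw [Matrix.zero_mulVec]
  refine braidDefect_span hs LinearMap.id (fun y hy => ?_) a b c
  have h := braidDefect_pair hs hy
  rw [braidDefect_pair' hs hy, hcol y hy, smul_zero] at h
  exact (smul_eq_zero.mp h.symm).resolve_left
    (neg_ne_zero.mpr (pow_ne_zero 2 (xρ_ne_zero hs y)))

theorem soR_bmwPair (hs : s ≠ 0) (hq : s ^ 2 + (s ^ 2)⁻¹ ≠ 0) :
    BMWPair (s ^ 2 - (s ^ 2)⁻¹) ((s ^ 2) ^ (1 - (N : ℤ))) (soR s : Mat2 K N) (soE s) where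
  skein := soR_skein hs
  twist := soR_twist hs
  symm_R := soR_transpose hs
  symm_E := soE_transpose s
  triple :=
    { braid := (sub_eq_zero.mp (braidDefect_eq_zero hs hq)).symm
      slide_left := soR_slide_last hs
      slide_left' := soR_slide_first hs
      slide_right := soR_slide_first_right hs
      slide_right' := soR_slide_last_right hs
      zigzag := by rw [mul_assoc]; exact soE_zigzag_last hs
      zigzag' := by rw [mul_assoc]; exact soE_zigzag_first hs }

end OrthogonalDefect

end QProj

namespace QProj

/-! ### The projectors of `U_q so(N)` -/

section OrthogonalProjectors
variable {K : Type*} [Field K] {N : ℕ}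

theorem soQ_eq (s : K) : soQ N s = ∑ a : Fin N, xρ s a * xρ s a := by
  rw [soQ]
  refine Finset.sum_congr rfl fun a _ => ?_
  simp [soG_apply]

theorem soE_mul_soE (s : K) : (soE s * soE s : Mat2 K N) = soQ N s • soE s := by
  refine mat2_ext fun a b f => ?_
  simp only [columnSum_mul, columnSum_smul, soE_columnSum]
  split_ifs
  · simp only [Finset.smul_sum, smul_smul]
    rw [Finset.sum_comm]
    refine Finset.sum_congr rfl fun v _ => ?_
    rw [← Finset.sum_smul, soQ_eq, Finset.sum_mul]
    congr 1
    exact Finset.sum_congr rfl fun u _ => by ring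
  · rw [smul_zero]

theorem soE_ne_zero (hN : 0 < N) {s : K} (hs : s ≠ 0) : (soE s : Mat2 K N) ≠ 0 := by
  intro h
  have h' := congrFun (congrFun h (⟨0, hN⟩, Fin.rev ⟨0, hN⟩)) (⟨0, hN⟩, Fin.rev ⟨0, hN⟩)
  rw [soE_apply, if_pos ⟨rfl, rfl⟩] at h'
  exact mul_ne_zero (xρ_ne_zero hs _) (xρ_ne_zero hs _) h'

/-- If $Q_N=0$, then $E^2=0$ and the skein relation times $E\ne0$ gives $(t-q)(t+q^{-1})=0$; with
$t=q^{1-N}$ this means $q^{-N}=1$ or $q^{2-N}=-1$. -/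
theorem soQ_ne_zero [CharZero K] (hN : 0 < N) {s : K} (hs : s ≠ 0)
    (hq : ∀ n : ℕ, 0 < n → (s ^ 2) ^ n ≠ 1) : soQ N s ≠ 0 := by
  intro hQ
  have hq0 : s ^ 2 ≠ 0 := pow_ne_zero 2 hs
  have h := congrArg (· * (soE s : Mat2 K N)) (soR_skein (N := N) hs)
  simp only [mul_assoc, sub_mul, add_mul, one_mul, smul_mul_assoc, soR_twist hs, mul_smul_comm,
    soE_mul_soE, hQ, zero_smul, smul_zero, sub_zero] at h
  set t : K := (s ^ 2) ^ (1 - (N : ℤ)) with ht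
  have h' : ((t - s ^ 2) * (t + (s ^ 2)⁻¹)) • (soE s : Mat2 K N) = 0 := by
    have e : (t - s ^ 2) * (t + (s ^ 2)⁻¹) = t * t - 1 - (s ^ 2 - (s ^ 2)⁻¹) * t := by
      field_simp
      ring
    rw [e]
    linear_combination (norm := module) h
  rcases mul_eq_zero.mp ((smul_eq_zero.mp h').resolve_right (soE_ne_zero hN hs)) with h1 | h1
  · refine zpow_ne_one_of_generic hq (n := -(N : ℤ)) (by omega) ?_
    have : t = (s ^ 2) ^ (-(N : ℤ)) * s ^ 2 := by
      rw [ht, ← zpow_add_one₀ hq0]; congr 1; ring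
    rw [this] at h1
    have h2 : ((s ^ 2) ^ (-(N : ℤ)) - 1) * s ^ 2 = 0 := by linear_combination h1
    exact sub_eq_zero.mp ((mul_eq_zero.mp h2).resolve_right hq0)
  · refine zpow_ne_neg_one_of_generic hq (2 - (N : ℤ)) ?_
    have : (s ^ 2) ^ (2 - (N : ℤ)) = t * s ^ 2 := by
      rw [ht, ← zpow_add_one₀ hq0]; congr 1; ring
    rw [this]
    field_simp at h1
    linear_combination h1

theorem soPt_eq (s : K) : (soPt s : Mat2 K N) = (soQ N s)⁻¹ • soE s := rfl

/-- The expansions are $\hat R=q\mathcal P^+-q^{-1}\mathcal P^-+q^{1-N}\mathcal P^t$ and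
$E=Q_N\mathcal P^t$. -/
theorem soP_spectralFamily [CharZero K] (hN : 0 < N) {s : K} (hs : s ≠ 0)
    (hq : ∀ n : ℕ, 0 < n → (s ^ 2) ^ n ≠ 1) (ε : PM) :
    SpectralFamily (eigenvalue (s ^ 2) ε) (soR s : Mat2 K N) (soE s) (soP s) (some ε) := by
  have hq0 : s ^ 2 ≠ 0 := pow_ne_zero 2 hs
  have hQ := soQ_ne_zero hN hs hq
  have hadd := add_inv_ne_zero_of_generic hq0 hq
  have h2 := sq_add_one_ne_zero_of_generic hq
  refine ⟨fun π => ?_, ⟨fun π => π.elim ((s ^ 2) ^ (1 - (N : ℤ))) (eigenvalue (s ^ 2)), ?_, rfl⟩,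
    ⟨fun π => π.elim (soQ N s) (fun _ => 0), ?_, rfl⟩⟩
  · cases π with
    | none => exact ⟨0, 0, (soQ N s)⁻¹, by simp [soP, soPt_eq], by simp⟩
    | some π =>
      refine ⟨(s ^ 2 + (s ^ 2)⁻¹)⁻¹ * (s ^ 2) ^ (-π.sgn), (s ^ 2 + (s ^ 2)⁻¹)⁻¹ * π.sgn,
        -((s ^ 2 + (s ^ 2)⁻¹)⁻¹ *
          (((s ^ 2) ^ (-π.sgn) + (π.sgn : K) * (s ^ 2) ^ (1 - (N : ℤ))) * (soQ N s)⁻¹)), ?_, ?_⟩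
      · rw [soP, soPt_eq]
        module
      · generalize s ^ 2 = q at *
        cases π <;> cases ε <;> simp [PM.sgn, eigenvalue] <;> field_simp <;> ring
  · rw [Fintype.sum_option, sum_pm]
    simp only [soP, Option.elim, eigenvalue, PM.sgn]
    generalize (s ^ 2) ^ (1 - (N : ℤ)) = t
    generalize s ^ 2 = q at *
    match_scalars <;> simp <;> field_simp <;> ring
  · rw [Fintype.sum_option, sum_pm]
    simp [soP, soPt_eq, smul_smul, hQ]

theorem soM_eq [CharZero K] (hN : 0 < N) {s : K} (hs : s ≠ 0)
    (hq : ∀ n : ℕ, 0 < n → (s ^ 2) ^ n ≠ 1) (ε : PM) (l : ℕ) :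
    (soM s ε l : Mat2 K N) = (recCoeffs N (s ^ 2) ε).factor l (soR s) (soE s) := by
  have hQ := soQ_ne_zero hN hs hq
  simp only [soM, Coeffs.factor, recCoeffs, soPt_eq, smul_add, smul_smul]
  congr 2
  field_simp

variable {F : Type*} [Field F] {S : Subring (F × K)}

theorem SpecMat.kroneckerVec {n : Type*} {A : Matrix n n F} {B : Matrix n n K}
    (h : SpecMat S A B) : SpecMat S
      (Matrix.of fun a b : n × n => A a.1 a.2 * A b.1 b.2)
      (Matrix.of fun a b : n × n => B a.1 a.2 * B b.1 b.2) :=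
  fun _ _ => S.mul_mem (h _ _) (h _ _)

theorem IsSpecialization.soE (hS : IsSpecialization S) {q : F} {v : K} (h : (q, v) ∈ S)
    (hv : v ≠ 0) : SpecMat S (soE q : Mat2 F N) (soE v) := by
  refine SpecMat.kroneckerVec fun a b => ?_
  simp only [soG, Matrix.of_apply]
  split_ifs
  · exact hS.zpow h hv _
  · exact S.zero_mem

theorem IsSpecialization.soR (hS : IsSpecialization S) {q : F} {v : K} (h : (q, v) ∈ S)
    (hv : v ≠ 0) : SpecMat S (soR q : Mat2 F N) (soR v) := by
  have h2 : (q ^ 2, v ^ 2) ∈ S := S.pow_mem h 2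
  have h2i := hS.inv _ _ h2 (pow_ne_zero 2 hv)
  exact ((((SpecMat.sum _ fun _ _ => specMat_kron _ _ _ _).smul h2).add
    (SpecMat.sum _ fun _ _ => SpecMat.sum _ fun _ _ => specMat_kron _ _ _ _)).add
    ((SpecMat.sum _ fun _ _ => specMat_kron _ _ _ _).smul h2i)).add
    (((SpecMat.sum _ fun _ _ => SpecMat.sum _ fun _ _ => specMat_kron _ _ _ _).sub
      (SpecMat.sum _ fun _ _ => SpecMat.sum _ fun _ _ =>
        (specMat_kron _ _ _ _).smul (hS.zpow h hv _))).smul (S.sub_mem h2 h2i))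

theorem soR_one : (QProj.soR 1 : Mat2 K N) = flipMat K N := by
  ext ⟨a, b⟩ ⟨c, d⟩
  rw [soR_apply one_ne_zero]
  simp [flipMat, wt]

theorem sum_soE_one (a b : Fin N) :
    ∑ x, (QProj.soE 1 : Mat2 K N) (a, x) (b, x) = if a = b then 1 else 0 := by
  simp only [soE_apply, xρ, one_zpow, mul_one]
  rw [Finset.sum_eq_single a.rev]
  · simp only [true_and, Fin.rev_inj]
  · intro x _ hx
    rw [if_neg (fun h => hx h.1)]
  · simp

/-- As for $gl$, but the variable stands for $q^{1/2}$, since half-integral powers of $q$ occur in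
the metric. -/
theorem so_trace [CharZero K] (hN : 0 < N) {s : K} (hs : s ≠ 0)
    (hq : ∀ n : ℕ, 0 < n → (s ^ 2) ^ n ≠ 1) (ε : PM) {l : ℕ} (hl : 1 ≤ l) :
    (tensorProj (recCoeffs N (s ^ 2) ε) (QProj.soR s : Mat2 K N) (QProj.soE s) l).trace =
      (soDim N ε l : K) := by
  have hX : ∀ n : ℕ, 0 < n → (fracX K ^ 2) ^ n ≠ 1 := fun n hn => by
    rw [← pow_mul]
    exact fracX_pow_ne_one (by omega)
  have hX0 : fracX K ^ 2 ≠ 0 := pow_ne_zero 2 fracX_ne_zero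
  have h := (soR_bmwPair (N := N) (fracX_ne_zero (K := K))
    (add_inv_ne_zero_of_generic hX0 hX)).trace_tensorProj_of_spec
    (evalRing_isSpecialization (1 : K)) hN ε hX0 hX
    (by simpa using (evalRing (1 : K)).pow_mem (fracX_mem 1) 2)
    (by
      rw [← soR_one]
      exact (evalRing_isSpecialization (1 : K)).soR (fracX_mem 1) one_ne_zero)
    ((evalRing_isSpecialization (1 : K)).soE (fracX_mem 1) one_ne_zero) (η := 1) sum_soE_one
    (d := soDim N ε) (soDim_one hN ε) (fun l hl => soDim_succ hN ε hl) hl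
  have hS := evalRing_isSpecialization s
  exact (SpecMat.tensorProj (hS.spec_recCoeffs hN ε ((evalRing s).pow_mem (fracX_mem s) 2)
    (pow_ne_zero 2 hs) hq) (hS.soR (fracX_mem s) hs) (hS.soE (fracX_mem s) hs) l).trace_eq hS h

/-! #### Compatibility with the metric -/

theorem metric_intertwines {A : Mat2 K N} {g : Matrix (Fin N) (Fin N) K} {y : Fin N → K}
    (hg : ∀ a b, g a b = if b = a.rev then y a else 0)
    (hA : ∀ i j h k, A (i, j) (h.rev, k.rev) * (y h.rev * y k.rev) =
      y i * y j * A (j.rev, i.rev) (k, h)) :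
    A * (g ⊗ₖ g) = (g ⊗ₖ g) * flip A := by
  ext ⟨i, j⟩ ⟨h, k⟩
  rw [Matrix.mul_apply, Matrix.mul_apply, Finset.sum_eq_single (h.rev, k.rev),
    Finset.sum_eq_single (i.rev, j.rev)]
  · simpa [hg, flip, Matrix.kroneckerMap_apply] using hA i j h k
  · rintro ⟨a, b⟩ _ hab
    rw [Matrix.kroneckerMap_apply, hg, hg]
    by_cases h1 : a = i.rev <;> by_cases h2 : b = j.rev <;> simp_all
  · simp
  · rintro ⟨a, b⟩ _ hab
    rw [Matrix.kroneckerMap_apply, hg, hg]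
    by_cases h1 : h = a.rev <;> by_cases h2 : k = b.rev <;> simp_all
  · simp

/-- Only $y_ay_{-a}=1$ matters, which holds both for the metric, $y_a=q^{-\rho_a}$, and for its
transpose, $y_a=q^{\rho_a}$. -/
theorem soR_metric {s : K} (hs : s ≠ 0) {g : Matrix (Fin N) (Fin N) K} {y : Fin N → K}
    (hg : ∀ a b, g a b = if b = a.rev then y a else 0) (hy : ∀ a, y a * y a.rev = 1) :
    QProj.soR s * (g ⊗ₖ g) = (g ⊗ₖ g) * flip (QProj.soR s) := by
  refine metric_intertwines hg fun i j h k => ?_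
  rw [soR_apply hs, soR_apply hs, wt_rev_rev, wt_comm _ j i, Fin.rev_rev, Fin.rev_rev,
    sub_mul, add_mul, mul_sub, mul_add]
  have e1 : i = k.rev ↔ i.rev = k := rev_eq_iff_eq_rev.symm
  have e2 : j = h.rev ↔ j.rev = h := rev_eq_iff_eq_rev.symm
  have e3 : i = h.rev ↔ i.rev = h := rev_eq_iff_eq_rev.symm
  have e4 : j = k.rev ↔ j.rev = k := rev_eq_iff_eq_rev.symm
  congr 1
  · congr 1
    · by_cases h1 : i = k.rev ∧ j = h.rev
      · rw [if_pos h1, if_pos ⟨e2.mp h1.2, e1.mp h1.1⟩, h1.1, h1.2]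
        ring
      · rw [if_neg h1, if_neg (fun h2 => h1 ⟨e1.mpr h2.2, e2.mpr h2.1⟩)]
        ring
    · by_cases h1 : i = h.rev ∧ j = k.rev ∧ i < j
      · rw [if_pos h1, if_pos ⟨e4.mp h1.2.1, e3.mp h1.1, Fin.rev_lt_rev.mpr h1.2.2⟩, h1.1, h1.2.1]
        ring
      · rw [if_neg h1,
          if_neg (fun h2 => h1 ⟨e3.mpr h2.2.1, e4.mpr h2.1, Fin.rev_lt_rev.mp h2.2.2⟩)]
        ring
  · by_cases h1 : j = i.rev ∧ k.rev = h ∧ i < h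
    · obtain ⟨rfl, rfl, h3⟩ := h1
      simp only [Fin.rev_rev, true_and, h3, if_true]
      have h4 := hy k
      have h5 := hy i
      linear_combination (s ^ 2 - (s ^ 2)⁻¹) * (xρ s i * xρ s k) * (h4 - h5)
    · rw [if_neg h1, if_neg]
      · ring
      · rintro ⟨h2, h3, h4⟩
        have h5 : j = i.rev := h2.symm
        refine h1 ⟨h5, h3.symm, ?_⟩
        rwa [h5, Fin.rev_rev, ← h3] at h4

theorem soE_metric {s : K} {g : Matrix (Fin N) (Fin N) K} {y : Fin N → K}
    (hg : ∀ a b, g a b = if b = a.rev then y a else 0) (hy : ∀ a, y a * y a.rev = 1) :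
    QProj.soE s * (g ⊗ₖ g) = (g ⊗ₖ g) * flip (QProj.soE s) := by
  refine metric_intertwines hg fun i j h k => ?_
  rw [soE_apply, soE_apply, Fin.rev_rev, Fin.rev_rev]
  by_cases h1 : j = i.rev ∧ k.rev = h
  · obtain ⟨rfl, rfl⟩ := h1
    simp only [Fin.rev_rev, and_self, if_true]
    have h4 := hy k
    have h5 := hy i
    linear_combination xρ s i * xρ s k * (h4 - h5)
  · rw [if_neg h1, if_neg (fun h2 => h1 ⟨h2.1.symm, h2.2.symm⟩)]
    ring

theorem so_projectors [CharZero K] (hN : 0 < N) {s : K} (hs : s ≠ 0)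
    (hq : ∀ n : ℕ, 0 < n → (s ^ 2) ^ n ≠ 1) (ε : PM) :
    (∀ l : ℕ, 1 ≤ l → ∃! P : TMat K N l, IsSoProjector s ε l P) ∧
    (∀ P : TMat K N 1, IsSoProjector s ε 1 P → P = 1) ∧
    (∀ (l : ℕ) (hl : 1 ≤ l) (P : TMat K N l) (P' : TMat K N (l + 1)),
      IsSoProjector s ε l P → IsSoProjector s ε (l + 1) P' →
        P' = tensorOne P * atSite (soM s ε l) (l - 1) (last_site_lt hl) * tensorOne P ∧
        P' = oneTensor P * atSite (soM s ε l) 0 (first_site_lt hl) * oneTensor P) ∧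
    (∀ l : ℕ, 1 ≤ l → ∀ P : TMat K N l, IsSoProjector s ε l P →
      P ∈ braidPolynomials (QProj.soR s) l ∧ P.transpose = P ∧
      MetricCompatible (soG s) P ∧ MetricCompatible (soG s).transpose P) := by
  have hq0 : s ^ 2 ≠ 0 := pow_ne_zero 2 hs
  have hRE := soR_bmwPair (N := N) hs (add_inv_ne_zero_of_generic hq0 hq)
  have hC := recCoeffs_generic hq0 hq hN ε
  have hp := soP_spectralFamily (N := N) hN hs hq ε
  have key : ∀ l, 1 ≤ l → ∀ P : TMat K N l, IsSoProjector s ε l P →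
      P = tensorProj (recCoeffs N (s ^ 2) ε) (QProj.soR s) (QProj.soE s) l := fun l hl P hP =>
    hRE.eq_tensorProj hC hp (so_trace hN hs hq ε hl) hP
  have hg : ∀ a b : Fin N, (soG s).transpose a b = if b = a.rev then (xρ s a)⁻¹ else 0 := by
    intro a b
    rw [Matrix.transpose_apply, soG_apply]
    by_cases h : b = a.rev
    · rw [if_pos h, h, Fin.rev_rev, if_pos rfl, xρ_rev]
    · rw [if_neg h, if_neg (fun h' => h (rev_eq_iff_eq_rev.mp h'.symm))]
  have hy : ∀ a : Fin N, xρ s a * xρ s a.rev = 1 := fun a => by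
    rw [xρ_rev, mul_inv_cancel₀ (xρ_ne_zero hs a)]
  have hy' : ∀ a : Fin N, (xρ s a)⁻¹ * (xρ s a.rev)⁻¹ = 1 := fun a => by
    rw [← mul_inv, hy, inv_one]
  refine ⟨fun l hl => ⟨_, hRE.isCompleteProjector hC hp (so_trace hN hs hq ε hl), key l hl⟩,
    fun P hP => key 1 le_rfl P hP, fun l hl P P' hP hP' => ?_, fun l hl P hP => ?_⟩
  · rw [key l hl P hP, key (l + 1) (by omega) P' hP', soM_eq hN hs hq]
    exact ⟨tensorProj_succ _ _ _ hl, hRE.tensorProj_succ' hC hl⟩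
  · rw [key l hl P hP]
    exact ⟨hRE.tensorProj_mem hC l, hRE.tensorProj_transpose _ l,
      hRE.tensorProj_metric hC _ (soR_metric hs (soG_apply s) hy) (soE_metric (soG_apply s) hy) l,
      hRE.tensorProj_metric hC _ (soR_metric hs hg hy') (soE_metric hg hy') l⟩

end OrthogonalProjectors

end QProj
-- The proposition for both series.
theorem proposition1 {K : Type*} [Field K] [CharZero K] (N : ℕ) (hN : 0 < N)
    (q : K) (hq0 : q ≠ 0) (hq : ∀ n : ℕ, 0 < n → q ^ n ≠ 1) :
    -- the series `U_q gl(N)`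
    (∀ ε : QProj.PM,
      (∀ l : ℕ, 1 ≤ l → ∃! P : QProj.TMat K N l, QProj.IsGlProjector q ε l P) ∧
      (∀ P : QProj.TMat K N 1, QProj.IsGlProjector q ε 1 P → P = 1) ∧
      (∀ (l : ℕ) (hl : 1 ≤ l) (P : QProj.TMat K N l) (P' : QProj.TMat K N (l + 1)),
        QProj.IsGlProjector q ε l P → QProj.IsGlProjector q ε (l + 1) P' →
          P' = QProj.tensorOne P * QProj.atSite (QProj.glM q ε l) (l - 1) (by omega)
                * QProj.tensorOne P ∧
          P' = QProj.oneTensor P * QProj.atSite (QProj.glM q ε l) 0 (by omega)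
                * QProj.oneTensor P) ∧
      (∀ l : ℕ, 1 ≤ l → ∀ P : QProj.TMat K N l, QProj.IsGlProjector q ε l P →
        P ∈ QProj.braidPolynomials (QProj.glR q) l ∧ P.transpose = P)) ∧
    -- the series `U_q so(N)`
    (∀ s : K, s ^ 2 = q → ∀ ε : QProj.PM,
      (∀ l : ℕ, 1 ≤ l → ∃! P : QProj.TMat K N l, QProj.IsSoProjector s ε l P) ∧
      (∀ P : QProj.TMat K N 1, QProj.IsSoProjector s ε 1 P → P = 1) ∧
      (∀ (l : ℕ) (hl : 1 ≤ l) (P : QProj.TMat K N l) (P' : QProj.TMat K N (l + 1)),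
        QProj.IsSoProjector s ε l P → QProj.IsSoProjector s ε (l + 1) P' →
          P' = QProj.tensorOne P * QProj.atSite (QProj.soM s ε l) (l - 1) (by omega)
                * QProj.tensorOne P ∧
          P' = QProj.oneTensor P * QProj.atSite (QProj.soM s ε l) 0 (by omega)
                * QProj.oneTensor P) ∧
      (∀ l : ℕ, 1 ≤ l → ∀ P : QProj.TMat K N l, QProj.IsSoProjector s ε l P →
        P ∈ QProj.braidPolynomials (QProj.soR s) l ∧ P.transpose = P ∧
        QProj.MetricCompatible (QProj.soG s) P ∧
        QProj.MetricCompatible (QProj.soG s).transpose P)) := by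
  refine ⟨fun ε => QProj.gl_projectors hN hq0 hq ε, fun s hs ε => ?_⟩
  subst hs
  exact QProj.so_projectors hN (ne_zero_pow two_ne_zero hq0) hq ε
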